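/- **Notation.** Let $\hat A$ be the $\mathbb{C}$-algebra of formal series $\sum_{\nu\ge 0}P_\nu(a)\,b^\nu$ with $P_\nu\in\mathbb{C}[[a]]$, where $ab-ba=b^2$ and left and right multiplication by $a$ are continuous for the $b$-adic filtration, and let $\tilde A\subset\hat A$ be the subalgebra of the series with $P_\nu\in\mathbb{C}[a]$ for all $\nu$. A *simple pole* module is a left $\hat A$-module $G$, free of finite rank over $\mathbb{C}[[b]]$, with $aG\subset bG$. A module $E$, free of finite rank over $\mathbb{C}[[b]]$, is *regular* if it embeds in a simple pole module; $E^\sharp$ is then the smallest simple pole module containing $E$, and the Bernstein polynomial of $E$ is the minimal polynomial of $-b^{-1}a$ on $E^\sharp/bE^\sharp$. For $\Lambda\subset\mathbb{Q}/\mathbb{Z}$, $E$ is *$[\Lambda]$-primitive* if it is regular and each root of its Bernstein polynomial is of the form $-q$ with $q\in\mathbb{Q}$ and $[q]\in\Lambda$. A *fresco* is a regular module which is generated by one element over $\tilde A$ and for which all the roots of the Bernstein polynomial are negative rational numbers; its rank is its rank over $\mathbb{C}[[b]]$. Fix a total order on $\mathbb{Q}/\mathbb{Z}$, and put $E_\mu:=\hat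 A/\hat A(a-\mu b)$. A rank $3$ fresco $E$ has *fundamental invariants* $\lambda_1,\lambda_2,\lambda_3\in\mathbb{Q}$ when it has a *principal Jordan–Hölder sequence* $0=F_0\subset F_1\subset F_2\subset F_3=E$ with $F_j/F_{j-1}\simeq E_{\lambda_j}$, i.e. a sequence of submodules such that each $E/F_j$ is free over $\mathbb{C}[[b]]$; for each $\mu\in\mathbb{Q}/\mathbb{Z}$ some $F_m$ is $[\{\nu\le\mu\}]$-primitive with $E/F_m$ $[\{\nu>\mu\}]$-primitive; and $\lambda_i+i\le\lambda_j+j$ whenever $i<j$ and $\lambda_i-\lambda_j\in\mathbb{Z}$. Put $p_1:=\lambda_2-\lambda_1+1$ and $p_2:=\lambda_3-\lambda_2+1$. A change of variable is a $\theta\in a\,\mathbb{C}[[a]]$ with $\theta'(0)\neq 0$; it is *unimodular* if $\theta'(0)=1$, i.e. $\theta(a)=a+\tau a^2+\cdots$. Let $\Theta$ be the continuous automorphism of $\hat A$ with $\Theta(a)=\theta(a)$ and $\Theta(b)=b\,\theta'(a)$. Then $\theta_*(E)$ is the vector space $E$ on which $u\in\hat A$ acts as $\Theta(u)$. **Theorem.**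 Let $E$ be a rank $3$ fresco with fundamental invariants $\lambda_1,\lambda_2,\lambda_3$. 1. There are $S_1,S_2\in\mathbb{C}[[b]]$ with $S_1(0)=S_2(0)=1$ and an isomorphism of left $\tilde A$-modules $$E\simeq\tilde A\big/\tilde A\,(a-\lambda_1b)\,S_1^{-1}\,(a-\lambda_2b)\,S_2^{-1}\,(a-\lambda_3b).$$ The complex number $$\gamma(E):=(p_2-1)\,S_1'(0)-(p_1-1)\,S_2'(0)$$ is the same for all such $S_1,S_2$; it depends only on the isomorphism class of $E$ as an $\tilde A$-module. 2. For each unimodular change of variable $\theta(a)=a+\tau a^2+\cdots$, $\theta_*(E)$ is a rank $3$ fresco with the same fundamental invariants $\lambda_1,\lambda_2,\lambda_3$, and $$\gamma(\theta_*(E))=\gamma(E)-(p_1-1)(p_2-1)(p_1+p_2-1)\,\tau .$$ -/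

import Mathlib

open scoped PowerSeries

universe u v

/-- The algebra `Â` of formal sums `∑ P_ν(a) b^ν` with `P_ν ∈ ℂ⟦a⟧`: such a sum is the sequence
of its coefficients `P_ν`. -/
def AHat : Type := ℕ → ℂ⟦X⟧

namespace AHat

noncomputable section

instance : AddCommGroup AHat := inferInstanceAs (AddCommGroup (ℕ → ℂ⟦X⟧))
instance : Module ℂ AHat := inferInstanceAs (Module ℂ (ℕ → ℂ⟦X⟧))

/-- The coefficient `P_ν(a)` of `b^ν`. -/
def coeff (x : AHat) (n : ℕ) : ℂ⟦X⟧ := x n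
/-- The sum `∑ f_ν(a) b^ν`. -/
def mk (f : ℕ → ℂ⟦X⟧) : AHat := f

@[simp] theorem coeff_mk (f : ℕ → ℂ⟦X⟧) (n : ℕ) : (mk f).coeff n = f n := rfl
@[ext] theorem ext {x y : AHat} (h : ∀ n, x.coeff n = y.coeff n) : x = y := funext h
@[simp] theorem coeff_zero (n : ℕ) : (0 : AHat).coeff n = 0 := rfl
@[simp] theorem coeff_add (x y : AHat) (n : ℕ) : (x + y).coeff n = x.coeff n + y.coeff n := rfl
@[simp] theorem coeff_neg (x : AHat) (n : ℕ) : (-x).coeff n = -x.coeff n := rfl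
@[simp] theorem coeff_sub (x y : AHat) (n : ℕ) : (x - y).coeff n = x.coeff n - y.coeff n := rfl
@[simp] theorem coeff_smul (c : ℂ) (x : AHat) (n : ℕ) : (c • x).coeff n = c • x.coeff n := rfl

/-- The binomial coefficient `C(-j, k)`. -/
def binom (j k : ℕ) : ℂ⟦X⟧ := ((Ring.choose (-(j : ℤ)) k : ℤ) : ℂ⟦X⟧)

/-- The iterated derivative `P^(k)`. -/
def D (k : ℕ) (f : ℂ⟦X⟧) : ℂ⟦X⟧ := (PowerSeries.derivative ℂ)^[k] f

/-- The product of `Â`. The commutation relation `a b - b a = b²` and `b`-adic continuity give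
`P(a) b^j · Q(a) b^l = ∑_k C(-j, k) P(a) Q^(k)(a) b^(j+k+l)`. -/
instance : Mul AHat := ⟨fun x y => mk fun n =>
  ∑ p ∈ Finset.HasAntidiagonal.antidiagonal n, ∑ q ∈ Finset.HasAntidiagonal.antidiagonal p.2,
    binom p.1 q.1 * (x.coeff p.1 * D q.1 (y.coeff q.2))⟩

instance : One AHat := ⟨mk fun n => if n = 0 then 1 else 0⟩

theorem coeff_mul (x y : AHat) (n : ℕ) : (x * y).coeff n =
  ∑ p ∈ Finset.HasAntidiagonal.antidiagonal n, ∑ q ∈ Finset.HasAntidiagonal.antidiagonal p.2,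
    binom p.1 q.1 * (x.coeff p.1 * D q.1 (y.coeff q.2)) := rfl

theorem coeff_one (n : ℕ) : (1 : AHat).coeff n = if n = 0 then 1 else 0 := rfl

theorem D_add (k : ℕ) (f g : ℂ⟦X⟧) : D k (f + g) = D k f + D k g :=
  iterate_map_add (PowerSeries.derivative ℂ) k f g

theorem D_zero (k : ℕ) : D k 0 = 0 := iterate_map_zero (PowerSeries.derivative ℂ) k
@[simp] theorem D_zero_left (f : ℂ⟦X⟧) : D 0 f = f := rfl

theorem D_smul (k : ℕ) (c : ℂ) (f : ℂ⟦X⟧) : D k (c • f) = c • D k f :=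
  by simp only [D, ← Derivation.coeFn_coe, ← Module.End.pow_apply]; exact map_smul _ _ _

theorem D_sum {ι : Type*} (s : Finset ι) (k : ℕ) (f : ι → ℂ⟦X⟧) :
    D k (∑ i ∈ s, f i) = ∑ i ∈ s, D k (f i) := by
  simp only [D, ← Derivation.coeFn_coe, ← Module.End.pow_apply]; exact map_sum _ _ _

theorem D_D (k l : ℕ) (f : ℂ⟦X⟧) : D k (D l f) = D (k + l) f :=
  (Function.iterate_add_apply _ k l f).symm

theorem D_succ (k : ℕ) (f : ℂ⟦X⟧) : D (k + 1) f = PowerSeries.derivative ℂ (D k f) :=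
  Function.iterate_succ_apply' _ k f

theorem D_succ' (k : ℕ) (f : ℂ⟦X⟧) : D (k + 1) f = D k (PowerSeries.derivative ℂ f) :=
  Function.iterate_succ_apply _ k f

theorem D_C (k : ℕ) (c : ℂ) : D k (PowerSeries.C c) = if k = 0 then PowerSeries.C c else 0 := by
  cases k with
  | zero => simp
  | succ k => simp [D_succ', D_zero]

theorem D_intCast_mul (k : ℕ) (m : ℤ) (f : ℂ⟦X⟧) :
    D k ((m : ℂ⟦X⟧) * f) = m * D k f := by
  have h : ∀ g : ℂ⟦X⟧, (m : ℂ⟦X⟧) * g = (m : ℂ) • g := by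
    intro g; rw [PowerSeries.smul_eq_C_mul]; simp
  rw [h, D_smul, h]

theorem D_mul (k : ℕ) (f g : ℂ⟦X⟧) : D k (f * g) =
    ∑ p ∈ Finset.HasAntidiagonal.antidiagonal k, (k.choose p.1 : ℂ⟦X⟧) * (D p.1 f * D p.2 g) := by
  induction k with
  | zero => simp
  | succ k ih =>
    rw [Finset.sum_antidiagonal_choose_succ_mul (fun i j => D i f * D j g), D_succ, ih, map_sum,
      ← Finset.sum_add_distrib]
    refine Finset.sum_congr rfl fun p hp => ?_
    rw [D_succ, D_succ]
    simp only [Derivation.leibniz, smul_eq_mul, Derivation.map_natCast]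
    rw [Finset.HasAntidiagonal.mem_antidiagonal] at hp
    rw [Nat.choose_symm_of_eq_add (n := k) (a := p.2) (b := p.1) (by omega)]
    ring

theorem binom_zero_right (j : ℕ) : binom j 0 = 1 := by simp [binom]
theorem binom_zero_left (k : ℕ) : binom 0 k = if k = 0 then 1 else 0 := by
  simp only [binom, Nat.cast_zero, neg_zero, Ring.choose_zero_ite]; split <;> simp

theorem binom_succ_succ (j k : ℕ) : binom j (k + 1) = binom (j + 1) k + binom (j + 1) (k + 1) := by
  have h := Ring.choose_succ_succ (-((j + 1 : ℕ) : ℤ)) k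
  have e : (-((j + 1 : ℕ) : ℤ)) + 1 = -(j : ℤ) := by push_cast; ring
  rw [e] at h
  simp only [binom, h]; push_cast; ring

theorem binom_vandermonde (i j k : ℕ) : binom (i + j) k =
    ∑ p ∈ Finset.HasAntidiagonal.antidiagonal k, binom i p.1 * binom j p.2 := by
  have h := Ring.add_choose_eq k (Commute.all (-(i : ℤ)) (-(j : ℤ)))
  have e : -((i + j : ℕ) : ℤ) = -(i : ℤ) + -(j : ℤ) := by push_cast; ring
  simp only [binom, e, h]; push_cast; rfl

theorem binom_mul_choose (j i r : ℕ) :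
    binom j (i + r) * ((i + r).choose i : ℂ⟦X⟧) = binom j i * binom (j + i) r := by
  have h := Ring.choose_smul_choose (-(j : ℤ)) (Nat.le_add_right i r)
  have e : (-((j + i : ℕ) : ℤ)) = -(j : ℤ) - (i : ℕ) := by push_cast; ring
  simp only [nsmul_eq_mul, Nat.add_sub_cancel_left] at h
  simp only [binom, e]
  rw [mul_comm]
  have := congrArg (Int.cast : ℤ → ℂ⟦X⟧) h
  push_cast at this ⊢
  exact this

theorem mul_assoc' (x y z : AHat) : x * y * z = x * (y * z) := by
  ext1 n
  have hL : (x * y * z).coeff n = ∑ p ∈ Finset.HasAntidiagonal.antidiagonal n, ∑ q ∈ Finset.HasAntidiagonal.antidiagonal p.2,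
      ∑ u ∈ Finset.HasAntidiagonal.antidiagonal p.1, ∑ v ∈ Finset.HasAntidiagonal.antidiagonal u.2,
      ∑ w ∈ Finset.HasAntidiagonal.antidiagonal q.1,
        binom u.1 v.1 * (binom (u.1 + v.1) w.1 * binom v.2 w.2) *
          (x.coeff u.1 * D v.1 (y.coeff v.2) * D (w.1 + w.2) (z.coeff q.2)) := by
    rw [coeff_mul]
    refine Finset.sum_congr rfl fun p hp => Finset.sum_congr rfl fun q hq => ?_
    rw [coeff_mul, Finset.sum_mul, Finset.mul_sum]
    refine Finset.sum_congr rfl fun u hu => ?_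
    rw [Finset.sum_mul, Finset.mul_sum]
    refine Finset.sum_congr rfl fun v hv => ?_
    simp only [Finset.HasAntidiagonal.mem_antidiagonal] at hp hq hu hv
    have e : p.1 = (u.1 + v.1) + v.2 := by omega
    rw [e, binom_vandermonde (u.1 + v.1) v.2 q.1, Finset.sum_mul]
    refine Finset.sum_congr rfl fun w hw => ?_
    simp only [Finset.HasAntidiagonal.mem_antidiagonal] at hw
    rw [hw]; ring
  have hR : (x * (y * z)).coeff n = ∑ p ∈ Finset.HasAntidiagonal.antidiagonal n, ∑ q ∈ Finset.HasAntidiagonal.antidiagonal p.2,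
      ∑ u ∈ Finset.HasAntidiagonal.antidiagonal q.2, ∑ v ∈ Finset.HasAntidiagonal.antidiagonal u.2,
      ∑ w ∈ Finset.HasAntidiagonal.antidiagonal q.1,
        binom p.1 w.1 * (binom (p.1 + w.1) w.2 * binom u.1 v.1) *
          (x.coeff p.1 * D w.1 (y.coeff u.1) * D (w.2 + v.1) (z.coeff v.2)) := by
    rw [coeff_mul]
    refine Finset.sum_congr rfl fun p hp => Finset.sum_congr rfl fun q hq => ?_
    rw [coeff_mul, D_sum, Finset.mul_sum, Finset.mul_sum]
    refine Finset.sum_congr rfl fun u hu => ?_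
    rw [D_sum, Finset.mul_sum, Finset.mul_sum]
    refine Finset.sum_congr rfl fun v hv => ?_
    rw [show binom u.1 v.1 = ((Ring.choose (-(u.1 : ℤ)) v.1 : ℤ) : ℂ⟦X⟧) from rfl,
      D_intCast_mul, D_mul, Finset.mul_sum, Finset.mul_sum, Finset.mul_sum]
    refine Finset.sum_congr rfl fun w hw => ?_
    simp only [Finset.HasAntidiagonal.mem_antidiagonal] at hw
    have := binom_mul_choose p.1 w.1 w.2
    rw [hw] at this
    rw [D_D]
    linear_combination (((Ring.choose (-(u.1 : ℤ)) v.1 : ℤ) : ℂ⟦X⟧) *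
      (x.coeff p.1 * D w.1 (y.coeff u.1) * D (w.2 + v.1) (z.coeff v.2))) * this
  rw [hL, hR]
  simp only [Finset.sum_sigma']
  refine Finset.sum_bij'
    (fun s _ => ⟨(s.2.2.1.1, s.2.2.2.1.1 + s.2.2.2.1.2 + s.2.2.2.2.1 + s.2.2.2.2.2 + s.2.1.2),
      (s.2.2.2.1.1 + s.2.2.2.2.1, s.2.2.2.1.2 + s.2.2.2.2.2 + s.2.1.2),
      (s.2.2.2.1.2, s.2.2.2.2.2 + s.2.1.2), (s.2.2.2.2.2, s.2.1.2), (s.2.2.2.1.1, s.2.2.2.2.1)⟩)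
    (fun s _ => ⟨(s.1.1 + s.2.2.2.2.1 + s.2.2.1.1, s.2.2.2.2.2 + s.2.2.2.1.1 + s.2.2.2.1.2),
      (s.2.2.2.2.2 + s.2.2.2.1.1, s.2.2.2.1.2), (s.1.1, s.2.2.2.2.1 + s.2.2.1.1),
      (s.2.2.2.2.1, s.2.2.1.1), (s.2.2.2.2.2, s.2.2.2.1.1)⟩)
    ?_ ?_ ?_ ?_ ?_
  · rintro ⟨⟨p1, p2⟩, ⟨q1, q2⟩, ⟨u1, u2⟩, ⟨v1, v2⟩, ⟨w1, w2⟩⟩ h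
    simp only [Finset.mem_sigma, Finset.HasAntidiagonal.mem_antidiagonal] at h ⊢
    simp only [and_true]
    omega
  · rintro ⟨⟨p1, p2⟩, ⟨q1, q2⟩, ⟨u1, u2⟩, ⟨v1, v2⟩, ⟨w1, w2⟩⟩ h
    simp only [Finset.mem_sigma, Finset.HasAntidiagonal.mem_antidiagonal] at h ⊢
    simp only [true_and, and_true]
    omega
  · rintro ⟨⟨p1, p2⟩, ⟨q1, q2⟩, ⟨u1, u2⟩, ⟨v1, v2⟩, ⟨w1, w2⟩⟩ h
    simp only [Finset.mem_sigma, Finset.HasAntidiagonal.mem_antidiagonal] at h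
    obtain ⟨h1, h2, h3, h4, h5⟩ := h
    simp only [Sigma.mk.injEq, Prod.mk.injEq, heq_eq_eq, true_and, and_true]
    omega
  · rintro ⟨⟨p1, p2⟩, ⟨q1, q2⟩, ⟨u1, u2⟩, ⟨v1, v2⟩, ⟨w1, w2⟩⟩ h
    simp only [Finset.mem_sigma, Finset.HasAntidiagonal.mem_antidiagonal] at h
    obtain ⟨h1, h2, h3, h4, h5⟩ := h
    simp only [Sigma.mk.injEq, Prod.mk.injEq, heq_eq_eq, true_and, and_true]
    omega
  · rintro ⟨⟨p1, p2⟩, ⟨q1, q2⟩, ⟨u1, u2⟩, ⟨v1, v2⟩, ⟨w1, w2⟩⟩ h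
    rfl

theorem binom_zero_mul_sum (n : ℕ) (f : ℂ⟦X⟧) (y : AHat) :
    (∑ q ∈ Finset.HasAntidiagonal.antidiagonal n, binom 0 q.1 * (f * D q.1 (y.coeff q.2))) = f * y.coeff n := by
  rw [Finset.sum_eq_single (0, n)]
  · simp [binom_zero_left]
  · rintro ⟨a, b⟩ _ hne
    have : a ≠ 0 := by
      rintro rfl
      simp_all
    simp [binom_zero_left, this]
  · simp

/-- The inclusion of `ℂ⟦a⟧` in `Â`. -/
def ofA (P : ℂ⟦X⟧) : AHat := mk fun n => if n = 0 then P else 0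

theorem coeff_ofA (P : ℂ⟦X⟧) (n : ℕ) : (ofA P).coeff n = if n = 0 then P else 0 := rfl

theorem coeff_ofA_mul (P : ℂ⟦X⟧) (y : AHat) (n : ℕ) :
    (ofA P * y).coeff n = P * y.coeff n := by
  rw [coeff_mul, Finset.sum_eq_single (0, n)]
  · simp [coeff_ofA, binom_zero_mul_sum]
  · rintro ⟨a, b⟩ _ hne
    have : a ≠ 0 := by
      rintro rfl
      simp_all
    simp [coeff_ofA, this]
  · simp

theorem mul_one' (x : AHat) : x * 1 = x := by
  ext1 n
  rw [coeff_mul, Finset.sum_eq_single (n, 0)]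
  · simp [coeff_one, binom_zero_right]
  · rintro ⟨a, b⟩ h hne
    refine Finset.sum_eq_zero ?_
    rintro ⟨c, d⟩ h'
    simp only [Finset.HasAntidiagonal.mem_antidiagonal] at h h'
    have hD : D c (coeff 1 d) = 0 := by
      rw [coeff_one]
      split_ifs with hd
      · have : c ≠ 0 := by
          rintro rfl
          apply hne
          simp only [Prod.mk.injEq]; omega
        rw [show (1 : ℂ⟦X⟧) = PowerSeries.C 1 by simp, D_C]; simp [this]
      · exact D_zero c
    simp [hD]
  · simp

instance : Ring AHat where
  __ := (inferInstance : AddCommGroup AHat)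
  mul_assoc := mul_assoc'
  one_mul y := by
    ext1 n
    have : (1 : AHat) = ofA 1 := rfl
    rw [this, coeff_ofA_mul, one_mul]
  mul_one := mul_one'
  left_distrib x y z := by
    ext1 n
    simp only [coeff_mul, coeff_add, D_add, mul_add, Finset.sum_add_distrib]
  right_distrib x y z := by
    ext1 n
    simp only [coeff_mul, coeff_add, add_mul, mul_add, Finset.sum_add_distrib]
  zero_mul x := by
    ext1 n
    simp [coeff_mul]
  mul_zero x := by
    ext1 n
    simp [coeff_mul, D_zero]

instance : Algebra ℂ AHat := Algebra.ofModule
  (fun c x y => by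
    ext1 n
    simp only [coeff_mul, coeff_smul, Finset.smul_sum, smul_mul_assoc, mul_smul_comm])
  (fun c x y => by
    ext1 n
    simp only [coeff_mul, coeff_smul, Finset.smul_sum, D_smul, mul_smul_comm])


theorem ofA_mul (P Q : ℂ⟦X⟧) : ofA (P * Q) = ofA P * ofA Q := by
  ext1 n
  rw [coeff_ofA_mul]
  simp only [coeff_ofA]
  split_ifs <;> simp

/-- The inclusion of `ℂ⟦a⟧` in `Â`, as a ring homomorphism. -/
def ofAHom : ℂ⟦X⟧ →+* AHat where
  toFun := ofA
  map_one' := rfl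
  map_mul' := ofA_mul
  map_zero' := by ext1 n; simp [coeff_ofA]
  map_add' P Q := by
    ext1 n
    simp only [coeff_ofA, coeff_add]
    split_ifs <;> simp

/-- The inclusion of `ℂ⟦b⟧` in `Â`. -/
def ofB (S : ℂ⟦X⟧) : AHat := mk fun n => PowerSeries.C (PowerSeries.coeff n S)

/-- The generator `a` of `Â`. -/
def a : AHat := ofA PowerSeries.X
/-- The generator `b` of `Â`. -/
def b : AHat := mk fun n => if n = 1 then 1 else 0

theorem coeff_b (n : ℕ) : b.coeff n = if n = 1 then 1 else 0 := rfl

theorem coeff_mul_b_zero (x : AHat) : (x * b).coeff 0 = 0 := by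
  simp [coeff_mul, coeff_b]

theorem coeff_mul_b_succ (x : AHat) (n : ℕ) : (x * b).coeff (n + 1) = x.coeff n := by
  rw [coeff_mul, Finset.sum_eq_single (n, 1)]
  · rw [Finset.sum_eq_single (0, 1)]
    · simp [binom_zero_right, coeff_b]
    · rintro ⟨c, d⟩ h hne
      simp only [Finset.HasAntidiagonal.mem_antidiagonal] at h
      have hd : d ≠ 1 := by
        rintro rfl
        apply hne
        simp only [Prod.mk.injEq, and_true]; omega
      simp [coeff_b, hd, D_zero]
    · simp
  · rintro ⟨p, q⟩ h hne
    refine Finset.sum_eq_zero ?_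
    rintro ⟨c, d⟩ h'
    simp only [Finset.HasAntidiagonal.mem_antidiagonal] at h h'
    have hD : D c (coeff b d) = 0 := by
      rw [coeff_b]
      split_ifs with hd
      · have : c ≠ 0 := by
          rintro rfl
          apply hne
          simp only [Prod.mk.injEq]; omega
        rw [show (1 : ℂ⟦X⟧) = PowerSeries.C 1 by simp, D_C]; simp [this]
      · exact D_zero c
    simp [hD]
  · simp

theorem coeff_b_mul_ofA_zero (T : ℂ⟦X⟧) : (b * ofA T).coeff 0 = 0 := by
  simp [coeff_mul, coeff_b]

theorem coeff_b_mul_ofA_succ (T : ℂ⟦X⟧) (n : ℕ) :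
    (b * ofA T).coeff (n + 1) = binom 1 n * D n T := by
  rw [coeff_mul, Finset.sum_eq_single (1, n)]
  · rw [Finset.sum_eq_single (n, 0)]
    · simp [coeff_b, coeff_ofA]
    · rintro ⟨c, d⟩ h hne
      simp only [Finset.HasAntidiagonal.mem_antidiagonal] at h
      have hd : d ≠ 0 := by
        rintro rfl
        apply hne
        simp only [Prod.mk.injEq, and_true]; omega
      simp [coeff_ofA, hd, D_zero]
    · simp
  · rintro ⟨p, q⟩ h hne
    simp only [Finset.HasAntidiagonal.mem_antidiagonal] at h
    have hp : p ≠ 1 := by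
      rintro rfl
      apply hne
      simp only [Prod.mk.injEq, true_and]; omega
    simp [coeff_b, hp]
  · intro h
    exfalso
    simp only [Finset.HasAntidiagonal.mem_antidiagonal] at h
    omega

theorem binom_one_succ (m : ℕ) : binom 1 (m + 1) = - binom 1 m := by
  have := binom_succ_succ 0 m
  rw [binom_zero_left, if_neg (Nat.succ_ne_zero m)] at this
  rw [zero_add] at this
  linear_combination -this

/-- `T(a) b = b T(a) + b T'(a) b` -/
theorem ofA_mul_b (T : ℂ⟦X⟧) :
    ofA T * b = b * ofA T + b * ofA (PowerSeries.derivative ℂ T) * b := by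
  ext1 n
  rw [coeff_add]
  match n with
  | 0 => simp [coeff_mul_b_zero, coeff_b_mul_ofA_zero]
  | 1 => simp [coeff_mul_b_succ, coeff_b_mul_ofA_zero, coeff_b_mul_ofA_succ, coeff_ofA,
      binom_zero_right]
  | m + 2 =>
    rw [coeff_mul_b_succ, coeff_mul_b_succ, coeff_b_mul_ofA_succ, coeff_b_mul_ofA_succ,
      binom_one_succ, D_succ', coeff_ofA, if_neg (Nat.succ_ne_zero m)]
    ring

/-- The defining commutation relation. -/
theorem a_mul_b_sub : a * b - b * a = b ^ 2 := by
  have h := ofA_mul_b PowerSeries.X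
  have h1 : ofA (PowerSeries.derivative ℂ PowerSeries.X) = 1 := by
    rw [PowerSeries.derivative_X]; rfl
  rw [h1, mul_one] at h
  rw [a, h, sq]; abel

/-- Elements divisible by `b ^ N`. -/
def van (N : ℕ) : AddSubgroup AHat where
  carrier := {x | ∀ n < N, x.coeff n = 0}
  zero_mem' := fun _ _ => rfl
  add_mem' := fun {x y} hx hy n hn => by rw [coeff_add, hx n hn, hy n hn, add_zero]
  neg_mem' := fun {x} hx n hn => by rw [coeff_neg, hx n hn, neg_zero]

theorem mem_van {N : ℕ} {x : AHat} : x ∈ van N ↔ ∀ n < N, x.coeff n = 0 := Iff.rfl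

theorem van_anti {M N : ℕ} (h : M ≤ N) {x : AHat} (hx : x ∈ van N) : x ∈ van M :=
  fun n hn => hx n (hn.trans_le h)

theorem mem_van_zero (x : AHat) : x ∈ van 0 := fun n hn => absurd hn (Nat.not_lt_zero n)

theorem van_mul {M N : ℕ} {x y : AHat} (hx : x ∈ van M) (hy : y ∈ van N) :
    x * y ∈ van (M + N) := by
  intro n hn
  rw [coeff_mul]
  refine Finset.sum_eq_zero fun p hp => Finset.sum_eq_zero fun q hq => ?_
  simp only [Finset.HasAntidiagonal.mem_antidiagonal] at hp hq
  by_cases h : p.1 < M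
  · simp [hx _ h]
  · have : q.2 < N := by omega
    simp [hy _ this, D_zero]

theorem van_mul_left {N : ℕ} (x : AHat) {y : AHat} (hy : y ∈ van N) : x * y ∈ van N := by
  simpa using van_mul (mem_van_zero x) hy

theorem van_mul_right {N : ℕ} {x : AHat} (y : AHat) (hx : x ∈ van N) : x * y ∈ van N := by
  simpa using van_mul hx (mem_van_zero y)

theorem van_pow {x : AHat} (hx : x ∈ van 1) (j : ℕ) : x ^ j ∈ van j := by
  induction j with
  | zero => exact mem_van_zero _
  | succ j ih => rw [pow_succ]; exact van_mul ih hx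

theorem b_mem_van : b ∈ van 1 := fun n hn => by
  obtain rfl : n = 0 := by omega
  rfl

/-- The abstract computation behind the change of variable: for a homomorphism `φ` from `ℂ⟦a⟧`
and an element `β` with the commutation relations of `ℂ⟦a⟧` and `b`. -/
theorem pow_mul_expand {φ : ℂ⟦X⟧ →+* AHat} {β : AHat} (hβ : β ∈ van 1)
    (h : ∀ Q, φ Q * β = β * φ Q + β * φ (PowerSeries.derivative ℂ Q) * β) (j N : ℕ) (Q : ℂ⟦X⟧) :
    β ^ j * φ Q - ∑ k ∈ Finset.range N, φ (binom j k * D k Q) * β ^ (j + k) ∈ van (N + j) := by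
  induction j generalizing N Q with
  | zero =>
    cases N with
    | zero => exact mem_van_zero _
    | succ N =>
      rw [Finset.sum_range_succ']
      simp [binom_zero_left, (van _).zero_mem]
  | succ j ihj =>
    induction N generalizing Q with
    | zero => simpa using van_mul_right (φ Q) (van_pow hβ (j + 1))
    | succ N ihN =>
      have h1 := van_mul (ihj (N + 1) Q) hβ
      have h2 := van_mul (ihN (PowerSeries.derivative ℂ Q)) hβ
      have h3 := (van (N + 1 + (j + 1))).sub_mem (van_anti (by omega) h1) (van_anti (by omega) h2)
      convert h3 using 1
      have e : β ^ (j + 1) * φ Q =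
          β ^ j * φ Q * β - β ^ (j + 1) * φ (PowerSeries.derivative ℂ Q) * β := by
        have := h Q
        rw [pow_succ, mul_assoc (β ^ j) (φ Q), this]
        noncomm_ring
      have e2 : ∑ k ∈ Finset.range (N + 1), φ (binom (j + 1) k * D k Q) * β ^ (j + 1 + k) =
          (∑ k ∈ Finset.range (N + 1), φ (binom j k * D k Q) * β ^ (j + k)) * β -
          (∑ k ∈ Finset.range N, φ (binom (j + 1) k * D k (PowerSeries.derivative ℂ Q)) *
            β ^ (j + 1 + k)) * β := by
        rw [Finset.sum_range_succ', Finset.sum_range_succ' _ N, add_mul, Finset.sum_mul,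
          Finset.sum_mul, add_sub_right_comm, ← Finset.sum_sub_distrib]
        congr 1
        · refine Finset.sum_congr rfl fun k _ => ?_
          rw [← D_succ', binom_succ_succ j k, mul_assoc, mul_assoc, ← pow_succ, ← pow_succ,
            show j + 1 + (k + 1) = j + (k + 1) + 1 by omega,
            show j + 1 + k + 1 = j + (k + 1) + 1 by omega, ← sub_mul, ← map_sub]
          congr 2
          ring
        · simp [binom_zero_right, pow_succ, mul_assoc]
      rw [e, e2]
      noncomm_ring

end

end AHat

noncomputable section

/-- A change of variable: `θ ∈ ℂ⟦a⟧` with `θ(0) = 0` and `θ'(0) ≠ 0`. -/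
structure ChangeOfVariable where
  series : ℂ⟦X⟧
  constantCoeff_eq_zero : PowerSeries.constantCoeff series = 0
  coeff_one_ne_zero : PowerSeries.coeff 1 series ≠ 0

namespace ChangeOfVariable

open AHat

variable (θ : ChangeOfVariable)

theorem hasSubst : PowerSeries.HasSubst θ.series :=
  PowerSeries.HasSubst.of_constantCoeff_zero' θ.constantCoeff_eq_zero

/-- `α = θ(a)`. -/
def alpha : AHat := ofA θ.series

/-- `β = b θ'(a)`. -/
def beta : AHat := b * ofA (PowerSeries.derivative ℂ θ.series)

/-- The map `P ↦ P(θ(a))` from `ℂ⟦a⟧` to `Â`. -/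
def substA : ℂ⟦X⟧ →+* AHat :=
  ofAHom.comp (PowerSeries.substAlgHom (R := ℂ) θ.hasSubst).toRingHom

theorem substA_apply (P : ℂ⟦X⟧) : θ.substA P = ofA (P.subst θ.series) := by
  simp only [substA, RingHom.comp_apply, AlgHom.toRingHom_eq_coe, RingHom.coe_coe,
    PowerSeries.coe_substAlgHom]
  rfl

theorem beta_mem : θ.beta ∈ van 1 := van_mul_right _ b_mem_van

theorem substA_mul_beta (Q : ℂ⟦X⟧) : θ.substA Q * θ.beta =
    θ.beta * θ.substA Q + θ.beta * θ.substA (PowerSeries.derivative ℂ Q) * θ.beta := by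
  simp only [substA_apply, beta]
  have h := ofA_mul_b (Q.subst θ.series)
  rw [PowerSeries.derivative_subst θ.hasSubst, ofA_mul] at h
  have c : ∀ P R : ℂ⟦X⟧, ofA P * ofA R = ofA R * ofA P := fun P R => by
    rw [← ofA_mul, ← ofA_mul, mul_comm]
  rw [← mul_assoc, h, add_mul, mul_assoc b, c (Q.subst θ.series),
    c ((PowerSeries.derivative ℂ Q).subst θ.series)]
  noncomm_ring

theorem commutation : θ.alpha * θ.beta - θ.beta * θ.alpha = θ.beta ^ 2 := by
  have h := θ.substA_mul_beta PowerSeries.X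
  rw [PowerSeries.derivative_X, map_one, substA_apply, PowerSeries.subst_X θ.hasSubst] at h
  rw [alpha, h]; noncomm_ring

/-- `Θ(∑ P_ν(a) b^ν) = ∑ P_ν(α) β^ν`; since `β^ν` is divisible by `b^ν`, only the terms
with `ν ≤ n` contribute to the coefficient of `b^n`. -/
def ThetaFun (x : AHat) : AHat := AHat.mk fun n =>
  ∑ ν ∈ Finset.range (n + 1),
    (PowerSeries.subst θ.series (x.coeff ν) : ℂ⟦X⟧) * (θ.beta ^ ν).coeff n

theorem ThetaFun_sub_mem (x : AHat) (N : ℕ) :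
    θ.ThetaFun x - ∑ ν ∈ Finset.range N, θ.substA (x.coeff ν) * θ.beta ^ ν ∈ van N := by
  intro n hn
  have hs : ∀ (s : Finset ℕ) (f : ℕ → AHat), (∑ i ∈ s, f i).coeff n = ∑ i ∈ s, (f i).coeff n :=
    fun s f => map_sum (⟨⟨fun x => x.coeff n, rfl⟩, fun _ _ => rfl⟩ : AHat →+ ℂ⟦X⟧) f s
  rw [coeff_sub, sub_eq_zero, hs, ThetaFun, AHat.coeff_mk]
  refine Finset.sum_subset_zero_on_sdiff (by simpa using hn) ?_ ?_
  · intro k hk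
    simp only [Finset.mem_sdiff, Finset.mem_range] at hk
    rw [substA_apply, coeff_ofA_mul, van_pow θ.beta_mem k n (by omega), mul_zero]
  · intro k _
    rw [substA_apply, coeff_ofA_mul]

theorem ThetaFun_mul (x y : AHat) : θ.ThetaFun (x * y) = θ.ThetaFun x * θ.ThetaFun y := by
  rw [← sub_eq_zero]
  ext1 n
  revert n
  suffices H : ∀ N, θ.ThetaFun (x * y) - θ.ThetaFun x * θ.ThetaFun y ∈ van N from
    fun n => H (n + 1) n (Nat.lt_succ_self n)
  intro N
  set β := θ.beta with hβ
  set φ := θ.substA with hφ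
  set X := ∑ ν ∈ Finset.range N, φ (x.coeff ν) * β ^ ν with hX
  set Y := ∑ ν ∈ Finset.range N, φ (y.coeff ν) * β ^ ν with hY
  have hx : θ.ThetaFun x - X ∈ van N := θ.ThetaFun_sub_mem x N
  have hy : θ.ThetaFun y - Y ∈ van N := θ.ThetaFun_sub_mem y N
  have hxy := θ.ThetaFun_sub_mem (x * y) N
  let f : ℕ × ℕ × ℕ → AHat := fun t =>
    φ (binom t.1 t.2.1 * (x.coeff t.1 * D t.2.1 (y.coeff t.2.2))) * β ^ (t.1 + t.2.1 + t.2.2)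
  let B := Finset.range N ×ˢ Finset.range N ×ˢ Finset.range N
  have hf : ∀ t, f t ∈ van (t.1 + t.2.1 + t.2.2) := fun t =>
    van_mul_left _ (van_pow θ.beta_mem _)
  have h1 : X * Y - ∑ t ∈ B, f t ∈ van N := by
    have e : ∑ t ∈ B, f t = ∑ j ∈ Finset.range N, ∑ l ∈ Finset.range N,
        φ (x.coeff j) * (∑ k ∈ Finset.range N, φ (binom j k * D k (y.coeff l)) * β ^ (j + k)) *
          β ^ l := by
      simp only [B, Finset.sum_product]
      refine Finset.sum_congr rfl fun j _ => ?_
      rw [Finset.sum_comm]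
      refine Finset.sum_congr rfl fun l _ => ?_
      rw [Finset.mul_sum, Finset.sum_mul]
      refine Finset.sum_congr rfl fun k _ => ?_
      simp only [f]
      rw [pow_add _ (j + k) l, show binom j k * (x.coeff j * D k (y.coeff l)) =
        x.coeff j * (binom j k * D k (y.coeff l)) by ring, map_mul φ (x.coeff j)]
      noncomm_ring
    rw [e, hX, hY, Finset.sum_mul_sum, ← Finset.sum_sub_distrib]
    refine (van N).sum_mem fun j _ => ?_
    rw [← Finset.sum_sub_distrib]
    refine (van N).sum_mem fun l _ => ?_
    have := pow_mul_expand θ.beta_mem θ.substA_mul_beta j N (y.coeff l)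
    have := van_mul_right (β ^ l) (van_mul_left (φ (x.coeff j)) (van_anti (M := N) (N := N + j) (by omega) this))
    convert this using 1
    noncomm_ring
  have h2 : ∑ ν ∈ Finset.range N, φ ((x * y).coeff ν) * β ^ ν - ∑ t ∈ B, f t ∈ van N := by
    have e : ∑ ν ∈ Finset.range N, φ ((x * y).coeff ν) * β ^ ν =
        ∑ t ∈ B with t.1 + t.2.1 + t.2.2 < N, f t := by
      have e1 : ∀ ν, φ ((x * y).coeff ν) * β ^ ν = ∑ p ∈ Finset.HasAntidiagonal.antidiagonal ν,
          ∑ q ∈ Finset.HasAntidiagonal.antidiagonal p.2,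
            φ (binom p.1 q.1 * (x.coeff p.1 * D q.1 (y.coeff q.2))) * β ^ ν := fun ν => by
        rw [coeff_mul, map_sum, Finset.sum_mul]
        refine Finset.sum_congr rfl fun p _ => ?_
        rw [map_sum, Finset.sum_mul]
      simp only [e1, Finset.sum_sigma']
      refine Finset.sum_bij' (fun s _ => (s.2.1.1, s.2.2.1, s.2.2.2))
        (fun t _ => ⟨t.1 + t.2.1 + t.2.2, (t.1, t.2.1 + t.2.2), (t.2.1, t.2.2)⟩) ?_ ?_ ?_ ?_ ?_
      · rintro ⟨m, ⟨p1, p2⟩, ⟨q1, q2⟩⟩ h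
        simp only [B, Finset.mem_sigma, Finset.HasAntidiagonal.mem_antidiagonal, Finset.mem_filter,
          Finset.mem_product, Finset.mem_range] at h ⊢
        omega
      · rintro ⟨j, k, l⟩ h
        simp only [B, Finset.mem_sigma, Finset.HasAntidiagonal.mem_antidiagonal, Finset.mem_filter,
          Finset.mem_product, Finset.mem_range, and_true] at h ⊢
        omega
      · rintro ⟨m, ⟨p1, p2⟩, ⟨q1, q2⟩⟩ h
        simp only [Finset.mem_sigma, Finset.HasAntidiagonal.mem_antidiagonal] at h
        obtain ⟨-, h1, h2⟩ := h
        subst h2 h1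
        simp [add_assoc]
      · rintro ⟨j, k, l⟩ h
        rfl
      · rintro ⟨m, ⟨p1, p2⟩, ⟨q1, q2⟩⟩ h
        simp only [Finset.mem_sigma, Finset.HasAntidiagonal.mem_antidiagonal] at h
        obtain ⟨-, h1, h2⟩ := h
        subst h2 h1
        simp [f, add_assoc]
    rw [e, ← Finset.sum_filter_add_sum_filter_not B (fun t => t.1 + t.2.1 + t.2.2 < N) f,
      sub_add_cancel_left]
    refine (van N).neg_mem ((van N).sum_mem fun t ht => ?_)
    exact van_anti (by simpa using (Finset.mem_filter.1 ht).2) (hf t)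
  have h3 : θ.ThetaFun x * θ.ThetaFun y - X * Y ∈ van N := by
    have := (van N).add_mem (van_mul_right (θ.ThetaFun y) hx) (van_mul_left X hy)
    convert this using 1
    noncomm_ring
  have := (van N).sub_mem ((van N).sub_mem ((van N).add_mem hxy h2) h1) h3
  convert this using 1
  abel

/-- The automorphism `Θ` of `Â` with `Θ(a) = α` and `Θ(b) = β`. -/
def Theta : AHat →+* AHat where
  toFun := θ.ThetaFun
  map_one' := by
    ext1 n
    simp only [ThetaFun, AHat.coeff_mk]
    rw [Finset.sum_range_succ', Finset.sum_eq_zero]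
    · simp [coeff_one, ← PowerSeries.coe_substAlgHom θ.hasSubst]
    · intro k _
      simp [coeff_one, ← PowerSeries.coe_substAlgHom θ.hasSubst]
  map_mul' := θ.ThetaFun_mul
  map_zero' := by
    ext1 n
    simp [ThetaFun, ← PowerSeries.coe_substAlgHom θ.hasSubst]
  map_add' x y := by
    ext1 n
    simp [ThetaFun, ← PowerSeries.coe_substAlgHom θ.hasSubst, add_mul, Finset.sum_add_distrib]

/-- A change of variable is unimodular when `θ'(0) = 1`. -/
def IsUnimodular : Prop := PowerSeries.coeff 1 θ.series = 1

/-- `θ_*(E)`: the vector space `E` on which `u ∈ Â` acts as `Θ(u)`. -/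
def Pushforward (_θ : ChangeOfVariable) (E : Type u) : Type u := E

instance (E : Type u) [AddCommGroup E] : AddCommGroup (θ.Pushforward E) :=
  inferInstanceAs (AddCommGroup E)

instance (E : Type u) [AddCommGroup E] [Module AHat E] : Module AHat (θ.Pushforward E) :=
  Module.compHom E θ.Theta

end ChangeOfVariable

/-- The subalgebra `Ã` of `Â`: the coefficients of the powers of `b` are polynomials in `a`. -/
def ATilde : Subalgebra ℂ AHat where
  carrier := {x | ∀ n, x.coeff n ∈ (Polynomial.coeToPowerSeries.ringHom (R := ℂ)).range}
  mul_mem' := fun {x y} hx hy n => by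
    rw [AHat.coeff_mul]
    refine Subring.sum_mem _ fun p _ => Subring.sum_mem _ fun q _ => ?_
    refine Subring.mul_mem _ (intCast_mem _ _) (Subring.mul_mem _ (hx _) ?_)
    obtain ⟨f, hf⟩ := hy q.2
    refine ⟨Polynomial.derivative^[q.1] f, ?_⟩
    rw [← hf]
    generalize q.1 = k
    induction k with
    | zero => rfl
    | succ k ih =>
      rw [Function.iterate_succ_apply', AHat.D_succ, ← ih]
      exact (PowerSeries.derivative_coe _).symm
  add_mem' := fun {x y} hx hy n => Subring.add_mem _ (hx n) (hy n)
  algebraMap_mem' := fun c n => by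
    rw [Algebra.algebraMap_eq_smul_one, AHat.coeff_smul, AHat.coeff_one]
    split_ifs
    · exact ⟨Polynomial.C c, by simp [PowerSeries.smul_eq_C_mul]⟩
    · rw [smul_zero]; exact Subring.zero_mem _

namespace ATilde

/-- The generator `a` of `Ã`. -/
def a : ATilde := ⟨AHat.a, fun n => by
  rw [AHat.a, AHat.coeff_ofA]
  split_ifs
  · exact ⟨Polynomial.X, by simp⟩
  · exact Subring.zero_mem _⟩

/-- The generator `b` of `Ã`. -/
def b : ATilde := ⟨AHat.b, fun n => by
  rw [AHat.coeff_b]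
  split_ifs
  · exact Subring.one_mem _
  · exact Subring.zero_mem _⟩

/-- The inclusion of `ℂ⟦b⟧` in `Ã`. -/
def ofB (S : ℂ⟦X⟧) : ATilde :=
  ⟨AHat.ofB S, fun n => ⟨Polynomial.C (PowerSeries.coeff n S), by simp [AHat.ofB]⟩⟩

end ATilde

/-- The left `Â`-module `E` is free of rank `k` over `ℂ⟦b⟧`: it has a `ℂ⟦b⟧`-basis
`e_1, …, e_k`. -/
def IsFreeOfRank (k : ℕ) (E : Type u) [AddCommGroup E] [Module AHat E] : Prop :=
  ∃ e : Fin k → E, ∀ x : E, ∃! c : Fin k → ℂ⟦X⟧, x = ∑ i, AHat.ofB (c i) • e i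

/-- Simple pole `(â,b)`-modules: free of finite type over `ℂ⟦b⟧`, with `a E ⊆ b E`. -/
def IsSimplePole (E : Type u) [AddCommGroup E] [Module AHat E] : Prop :=
  (∃ k, IsFreeOfRank k E) ∧ ∀ x : E, ∃ y : E, AHat.a • x = AHat.b • y

/-- `i : E → G` is the saturation `E → E^♯`: an embedding in a simple pole module `G`
such that no smaller simple pole submodule of `G` contains the image of `E`. A module is regular
when it can be embedded in a simple pole module, i.e. when it has a saturation. -/
structure IsSaturation {E G : Type u} [AddCommGroup E] [Module AHat E] [AddCommGroup G]
    [Module AHat G] (i : E →ₗ[AHat] G) : Prop where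
  injective : Function.Injective i
  simplePole : IsSimplePole G
  minimal : ∀ H : Submodule AHat G, (∀ x, i x ∈ H) →
    (∀ x ∈ H, ∃ y ∈ H, AHat.a • x = AHat.b • y) → H = ⊤

/-- For a simple pole module `G`, the complex number `z` is a root of the minimal polynomial of
the endomorphism `-b⁻¹a` of the finite dimensional vector space `G / b G`, i.e. it is an
eigenvalue: there is a class `[x] ≠ 0` with `-b⁻¹ a x - z x ∈ b G`. -/
def IsBernsteinRootOfSimplePole (G : Type u) [AddCommGroup G] [Module AHat G] (z : ℂ) : Prop :=
  ∃ x : G, (∀ y : G, x ≠ AHat.b • y) ∧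
    ∃ y : G, (AHat.a + z • AHat.b) • x = AHat.b ^ 2 • y

/-- `E` is regular and all the roots of its Bernstein polynomial, which is the minimal polynomial
of `-b⁻¹a` on `E^♯ / b E^♯`, satisfy the condition `C`. -/
def IsRegularWithBernsteinRoots (C : ℂ → Prop) (E : Type u) [AddCommGroup E]
    [Module AHat E] : Prop :=
  ∃ (G : Type u) (_ : AddCommGroup G) (_ : Module AHat G) (i : E →ₗ[AHat] G),
    IsSaturation i ∧ ∀ z : ℂ, IsBernsteinRootOfSimplePole G z → C z

/-- Geometric modules: regular, and the roots of the Bernstein polynomial are negative rational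
numbers. -/
def IsGeometric (E : Type u) [AddCommGroup E] [Module AHat E] : Prop :=
  IsRegularWithBernsteinRoots (fun z => ∃ q : ℚ, q < 0 ∧ z = (q : ℂ)) E

/-- `[Λ]`-primitive modules, for a subset `Λ` of `ℚ/ℤ`: each root of the Bernstein polynomial is
the opposite of a rational number whose class modulo `ℤ` is in `Λ`. -/
def IsPrimitive (Λ : Set (AddCircle (1 : ℚ))) (E : Type u) [AddCommGroup E]
    [Module AHat E] : Prop :=
  IsRegularWithBernsteinRoots (fun z => ∃ q : ℚ, (q : AddCircle (1 : ℚ)) ∈ Λ ∧ z = -(q : ℂ)) E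

/-- Rank `k` frescos: geometric modules, free of rank `k` over `ℂ⟦b⟧`, generated by one element
over `Ã`. -/
structure IsFresco (k : ℕ) (E : Type u) [AddCommGroup E] [Module AHat E] : Prop where
  free : IsFreeOfRank k E
  geometric : IsGeometric E
  monogenic : ∃ e : E, Submodule.span ATilde {e} = ⊤

/-- The rank one module `E_μ = Â / Â (a - μ b)`. -/
abbrev RankOne (μ : ℚ) : Type :=
  AHat ⧸ Submodule.span AHat {AHat.a - (μ : ℂ) • AHat.b}

/-- For a fixed total order on `ℚ/ℤ`, the sequence of submodules
`0 = F_0 ⊆ F_1 ⊆ ⋯ ⊆ F_k = E` is the principal Jordan–Hölder sequence of `E`, with successive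
quotients `E_{λ_1}, …, E_{λ_k}` (the index `j : Fin k` stands for `j + 1`). -/
structure IsPrincipalJordanHolder (ord : LinearOrder (AddCircle (1 : ℚ))) {k : ℕ}
    (lam : Fin k → ℚ) {E : Type u} [AddCommGroup E] [Module AHat E]
    (F : Fin (k + 1) → Submodule AHat E) : Prop where
  bot : F 0 = ⊥
  top : F (Fin.last k) = ⊤
  mono : Monotone F
  /-- Each term is normal: the quotient is free over `ℂ⟦b⟧`. -/
  normal : ∀ j, ∃ r, IsFreeOfRank r (E ⧸ F j)
  quotient : ∀ j : Fin k, Nonempty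
    ((F j.succ ⧸ (F j.castSucc).submoduleOf (F j.succ)) ≃ₗ[AHat] RankOne (lam j))
  /-- Compatibility with the primitive filtration: for each class `μ`, the `{ν ≤ μ}`-primitive
  part of `E` (the primitive submodule for `{ν ≤ μ}` such that the quotient is primitive for the
  complement) is a term of the sequence. -/
  primitive : ∀ μ : AddCircle (1 : ℚ), ∃ m,
    IsPrimitive {ν | ord.le ν μ} (F m) ∧ IsPrimitive {ν | ord.le ν μ}ᶜ (E ⧸ F m)
  /-- In each graded piece of the primitive filtration, `λ_j + j` is non decreasing. -/
  principal : ∀ i j : Fin k, i < j → (lam i : AddCircle (1 : ℚ)) = (lam j : AddCircle (1 : ℚ)) →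
    lam i + ((i : ℕ) + 1 : ℚ) ≤ lam j + ((j : ℕ) + 1 : ℚ)

/-- `E` is a rank `k` fresco with fundamental invariants `λ_1, …, λ_k`, for the given total order
on `ℚ/ℤ`. -/
def HasFundamentalInvariants (ord : LinearOrder (AddCircle (1 : ℚ))) {k : ℕ} (lam : Fin k → ℚ)
    (E : Type u) [AddCommGroup E] [Module AHat E] : Prop :=
  IsFresco k E ∧ ∃ F : Fin (k + 1) → Submodule AHat E, IsPrincipalJordanHolder ord lam F

/-- `S_1, S_2 ∈ ℂ⟦b⟧` have constant term `1` and `E` is isomorphic, as a left `Ã`-module, to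
`Ã / Ã (a - λ_1 b) S_1⁻¹ (a - λ_2 b) S_2⁻¹ (a - λ_3 b)`. -/
structure IsPresentation (l₁ l₂ l₃ : ℚ) (S₁ S₂ : ℂ⟦X⟧) (E : Type u) [AddCommGroup E]
    [Module AHat E] : Prop where
  constantCoeff_left : PowerSeries.constantCoeff S₁ = 1
  constantCoeff_right : PowerSeries.constantCoeff S₂ = 1
  iso : Nonempty (E ≃ₗ[ATilde] (ATilde ⧸ Submodule.span ATilde
    {(ATilde.a - (l₁ : ℂ) • ATilde.b) * ATilde.ofB S₁⁻¹ * (ATilde.a - (l₂ : ℂ) • ATilde.b) *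
      ATilde.ofB S₂⁻¹ * (ATilde.a - (l₃ : ℂ) • ATilde.b)}))

/-- `(p_2 - 1) S_1'(0) - (p_1 - 1) S_2'(0)`, where `p_1 = λ_2 - λ_1 + 1`,
`p_2 = λ_3 - λ_2 + 1`. -/
def gammaValue (l₁ l₂ l₃ : ℚ) (S₁ S₂ : ℂ⟦X⟧) : ℂ :=
  (((l₃ - l₂ + 1 : ℚ) : ℂ) - 1) * PowerSeries.constantCoeff (PowerSeries.derivative ℂ S₁) -
    (((l₂ - l₁ + 1 : ℚ) : ℂ) - 1) * PowerSeries.constantCoeff (PowerSeries.derivative ℂ S₂)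

open Classical in
/-- The number `γ(E)`, computed from some presentation of `E` (and `0` if there is none). -/
def gammaParam (l₁ l₂ l₃ : ℚ) (E : Type u) [AddCommGroup E] [Module AHat E] : ℂ :=
  if h : ∃ S : ℂ⟦X⟧ × ℂ⟦X⟧, IsPresentation l₁ l₂ l₃ S.1 S.2 E then
    gammaValue l₁ l₂ l₃ h.choose.1 h.choose.2
  else 0

end

/-! A generator of `E` is pushed down the principal Jordan–Hölder sequence. Its class in the rank
one quotient `F_j / F_{j-1}` must be a unit multiple of a basis element. Once this unit is
normalised, right division by `a - λ_j b` with remainder in `ℂ⟦b⟧` (`exists_division`) shows that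
`(a - λ_j b) e_j` generates `F_{j-1}` over `Ã`, so the argument repeats
(`IsRankOneStep.exists_normalized`). The outcome is a triangular basis `e₁, e₂, e₃`, and dividing
three times computes the annihilator of `e₃`; this is the presentation.

In the coordinates of such a basis, `a` acts as `λ_j b + b² d/db` plus a shift from `e_{j+1}` to
`e_j` weighted by the series `S_j`. Let `f_j ∈ F_j` satisfy triangular relations for a pair `(α, β)
= (a + τ a² + ⋯, b + 2τ b a + ⋯)`. Comparing coefficients of order at most two leaves, apart from a
nonzero scale, one free number: the order zero coefficient of `f₃` along `e₂`. It shifts the two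
first order terms by multiples of `λ₂ - λ₁` and `λ₃ - λ₂`, and `γ` is the combination in which it
cancels. What remains is the term in `τ`. The single lemma `linear_invariant_comparison` thus gives
both invariance (`τ = 0`) and the transformation formula.

A second presentation of `E` does not come with `f_j ∈ F_j`. The unwanted coordinates satisfy Euler
equations `(n + λ_j - λ_i) y_n = 0`, start at order `j - i + 1`, and the principality inequalities
exclude every resonance from there on (`coordinates_eq_zero`).

For `θ_*(E)`, the sequence `F` itself is transported: `β E = b E`, and on a simple pole module `α +
z β` is `θ'(0)(a + z b)` modulo `b²`. Hence freeness, saturations, Bernstein roots and the rank one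
quotients carry over. A generator over `Ã` stays one because `a³ E ⊆ b E` allows power series in `a`
to be truncated modulo `b`. -/

namespace AHat

/-! ### Products with `a` and with power series in `b` -/

theorem binom_one_right (j : ℕ) : binom j 1 = -(j : ℂ⟦X⟧) := by
  simp [binom]

theorem coeff_mul_a_zero (x : AHat) : (x * a).coeff 0 = x.coeff 0 * PowerSeries.X := by
  simp [coeff_mul, a, coeff_ofA, binom_zero_left]

theorem D_succ_X (k : ℕ) : D (k + 1) (PowerSeries.X : ℂ⟦X⟧) = if k = 0 then 1 else 0 := by
  rw [D_succ', PowerSeries.derivative_X, show (1 : ℂ⟦X⟧) = PowerSeries.C 1 by simp, D_C]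

/-- The derivatives of `X` beyond the first vanish, so only two terms of the product formula
survive: `b^n a = a b^n - n b^(n+1)`. -/
theorem coeff_mul_a_succ (x : AHat) (n : ℕ) :
    (x * a).coeff (n + 1) = x.coeff (n + 1) * PowerSeries.X - (n : ℂ⟦X⟧) * x.coeff n := by
  have inner : ∀ p : ℕ × ℕ, ∑ q ∈ Finset.HasAntidiagonal.antidiagonal p.2,
      binom p.1 q.1 * (x.coeff p.1 * D q.1 (a.coeff q.2)) =
      binom p.1 p.2 * (x.coeff p.1 * D p.2 PowerSeries.X) := by
    intro p
    rw [Finset.sum_eq_single (p.2, 0)]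
    · simp [a, coeff_ofA]
    · rintro ⟨c, d⟩ h hne
      simp only [Finset.HasAntidiagonal.mem_antidiagonal] at h
      have hd : d ≠ 0 := by
        rintro rfl
        apply hne
        simp only [Prod.mk.injEq, and_true]; omega
      simp [a, coeff_ofA, hd, D_zero]
    · simp
  rw [coeff_mul, Finset.sum_congr rfl fun p _ => inner p, Finset.Nat.sum_antidiagonal_succ',
    ← Finset.sum_subset (s₁ := {(n, 0)})]
  · simp [D_succ_X, binom_one_right, binom_zero_right]; ring
  · simp
  · rintro ⟨c, d⟩ h hne
    simp only [Finset.HasAntidiagonal.mem_antidiagonal] at h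
    have hd : d ≠ 0 := by
      rintro rfl
      apply hne
      simp only [Finset.mem_singleton, Prod.mk.injEq, and_true]; omega
    simp [D_succ_X, hd]

theorem coeff_ofB (S : ℂ⟦X⟧) (n : ℕ) :
    (ofB S).coeff n = PowerSeries.C (PowerSeries.coeff n S) := rfl

theorem ofB_mul (S T : ℂ⟦X⟧) : ofB (S * T) = ofB S * ofB T := by
  ext1 n
  rw [coeff_mul, coeff_ofB, PowerSeries.coeff_mul, map_sum]
  refine Finset.sum_congr rfl fun p _ => ?_
  rw [Finset.sum_eq_single (0, p.2)]
  · simp [coeff_ofB, binom_zero_right]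
  · rintro ⟨c, d⟩ h hne
    simp only [Finset.HasAntidiagonal.mem_antidiagonal] at h
    have hc : c ≠ 0 := by
      rintro rfl
      apply hne
      simp only [Prod.mk.injEq, true_and]; omega
    simp [coeff_ofB, D_C, hc]
  · simp

/-- The inclusion of `ℂ⟦b⟧` in `Â`, as a ring homomorphism. -/
noncomputable def ofBHom : ℂ⟦X⟧ →+* AHat where
  toFun := ofB
  map_one' := by
    ext1 n
    rw [coeff_ofB, coeff_one, PowerSeries.coeff_one]
    split_ifs <;> simp
  map_mul' := ofB_mul
  map_zero' := by ext1 n; simp [coeff_ofB]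
  map_add' P Q := by ext1 n; simp [coeff_ofB]

theorem ofB_one : ofB 1 = 1 := map_one ofBHom
theorem ofB_zero : ofB 0 = 0 := map_zero ofBHom
theorem ofB_add (S T : ℂ⟦X⟧) : ofB (S + T) = ofB S + ofB T := map_add ofBHom S T
theorem ofB_sub (S T : ℂ⟦X⟧) : ofB (S - T) = ofB S - ofB T := map_sub ofBHom S T

theorem ofB_comm (S T : ℂ⟦X⟧) : ofB S * ofB T = ofB T * ofB S := by
  rw [← ofB_mul, mul_comm, ofB_mul]

theorem ofB_X : ofB PowerSeries.X = b := by
  ext1 n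
  rw [coeff_ofB, coeff_b, PowerSeries.coeff_X]
  split_ifs <;> simp

theorem ofB_C (c : ℂ) : ofB (PowerSeries.C c) = c • 1 := by
  ext1 n
  rw [coeff_ofB, coeff_smul, coeff_one, PowerSeries.coeff_C]
  split_ifs <;> simp [PowerSeries.smul_eq_C_mul]

theorem ofA_C (c : ℂ) : ofA (PowerSeries.C c) = c • 1 := by
  ext1 n
  rw [coeff_ofA, coeff_smul, coeff_one]
  split_ifs <;> simp [PowerSeries.smul_eq_C_mul]

theorem ofB_C_mul (c : ℂ) (x : AHat) : ofB (PowerSeries.C c) * x = c • x := by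
  rw [ofB_C, smul_mul_assoc, one_mul]

theorem mul_ofB_C (c : ℂ) (x : AHat) : x * ofB (PowerSeries.C c) = c • x := by
  rw [ofB_C, mul_smul_comm, mul_one]

theorem ofB_mul_b (S : ℂ⟦X⟧) : ofB S * b = b * ofB S := by
  rw [← ofB_X, ofB_comm]

theorem ofB_inv_mul {S : ℂ⟦X⟧} (h : PowerSeries.constantCoeff S ≠ 0) : ofB S⁻¹ * ofB S = 1 := by
  rw [← ofB_mul, PowerSeries.inv_mul_cancel _ h, ofB_one]

theorem ofB_mul_inv {S : ℂ⟦X⟧} (h : PowerSeries.constantCoeff S ≠ 0) : ofB S * ofB S⁻¹ = 1 := by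
  rw [ofB_comm, ofB_inv_mul h]

theorem ofA_comm (P Q : ℂ⟦X⟧) : ofA P * ofA Q = ofA Q * ofA P := by
  rw [← ofA_mul, mul_comm, ofA_mul]

theorem ofA_inv_mul {S : ℂ⟦X⟧} (h : PowerSeries.constantCoeff S ≠ 0) : ofA S⁻¹ * ofA S = 1 := by
  rw [← ofA_mul, PowerSeries.inv_mul_cancel _ h]; rfl

theorem ofA_mul_inv {S : ℂ⟦X⟧} (h : PowerSeries.constantCoeff S ≠ 0) : ofA S * ofA S⁻¹ = 1 := by
  rw [ofA_comm, ofA_inv_mul h]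

/-- `a S(b) = S(b) a + b² S'(b)` -/
theorem a_mul_ofB (S : ℂ⟦X⟧) :
    a * ofB S = ofB S * a + ofB (PowerSeries.X ^ 2 * PowerSeries.derivative ℂ S) := by
  -- In degree `n + 1` the series `X² S'` has coefficient `n` times that of `S` in degree `n`,
  -- including `n = 0`, where both vanish.
  have key : ∀ n m : ℕ, (PowerSeries.coeff m) (PowerSeries.X ^ 2 * PowerSeries.derivative ℂ S) =
      if m = n + 1 then PowerSeries.coeff n S * n else PowerSeries.coeff m
        (PowerSeries.X ^ 2 * PowerSeries.derivative ℂ S) := by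
    intro n m
    split_ifs with h
    · subst h
      rw [PowerSeries.coeff_X_pow_mul']
      split_ifs with h
      · obtain ⟨k, rfl⟩ : ∃ k, n = k + 1 := ⟨n - 1, by omega⟩
        rw [show k + 1 + 1 - 2 = k by omega, PowerSeries.coeff_derivative]
        push_cast; ring
      · obtain rfl : n = 0 := by omega
        simp
    · rfl
  ext1 n
  rw [coeff_add, a, coeff_ofA_mul, ← a]
  cases n with
  | zero =>
    rw [coeff_mul_a_zero, coeff_ofB, coeff_ofB, PowerSeries.coeff_X_pow_mul']
    simp [mul_comm]
  | succ n =>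
    rw [coeff_mul_a_succ, coeff_ofB, coeff_ofB, coeff_ofB, key n, if_pos rfl]
    simp only [map_mul, map_natCast]
    ring

/-! ### Divisibility by powers of `b` -/

theorem coeff_sum {ι : Type*} (s : Finset ι) (f : ι → AHat) (n : ℕ) :
    (∑ i ∈ s, f i).coeff n = ∑ i ∈ s, (f i).coeff n :=
  map_sum (⟨⟨fun x => x.coeff n, rfl⟩, fun _ _ => rfl⟩ : AHat →+ ℂ⟦X⟧) f s

theorem eq_zero_of_forall_mem_van {x : AHat} (h : ∀ N, x ∈ van N) : x = 0 := by
  ext1 n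
  exact h (n + 1) n (Nat.lt_succ_self n)

theorem exists_eq_mul_b {N : ℕ} {x : AHat} (hx : x ∈ van (N + 1)) :
    ∃ y ∈ van N, x = y * b := by
  refine ⟨mk fun n => x.coeff (n + 1), fun n hn => hx (n + 1) (by omega), ?_⟩
  ext1 n
  cases n with
  | zero => rw [coeff_mul_b_zero]; exact hx 0 (by omega)
  | succ n => rw [coeff_mul_b_succ, coeff_mk]

/-- Termwise differentiation of the coefficients. -/
noncomputable def deriv (x : AHat) : AHat := mk fun n => PowerSeries.derivative ℂ (x.coeff n)

theorem coeff_b_mul_zero (x : AHat) : (b * x).coeff 0 = 0 := van_mul_right x b_mem_van 0 one_pos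

theorem coeff_b_mul_succ (x : AHat) (n : ℕ) : (b * x).coeff (n + 1) =
    ∑ q ∈ Finset.HasAntidiagonal.antidiagonal n, binom 1 q.1 * D q.1 (x.coeff q.2) := by
  rw [coeff_mul, Finset.sum_eq_single (1, n)]
  · simp [coeff_b]
  · rintro ⟨p, q⟩ h hne
    simp only [Finset.HasAntidiagonal.mem_antidiagonal] at h
    have hp : p ≠ 1 := by
      rintro rfl
      apply hne
      simp only [Prod.mk.injEq, true_and]; omega
    simp [coeff_b, hp]
  · intro h
    exfalso
    simp only [Finset.HasAntidiagonal.mem_antidiagonal] at h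
    omega

/-- The alternating series of derivatives for `b x` and for `b x' b` cancel except for one term.
This makes left and right divisibility by `b` interchangeable. -/
theorem mul_b_eq (x : AHat) : x * b = b * (x + x.deriv * b) := by
  ext1 n
  cases n with
  | zero => rw [coeff_mul_b_zero, coeff_b_mul_zero]
  | succ n =>
    rw [coeff_mul_b_succ, mul_add, coeff_add, coeff_b_mul_succ, coeff_b_mul_succ]
    cases n with
    | zero => simp [coeff_mul_b_zero, binom_zero_right]
    | succ n =>
      rw [Finset.Nat.sum_antidiagonal_succ, Finset.Nat.sum_antidiagonal_succ']
      simp only [coeff_mul_b_zero, coeff_mul_b_succ, binom_one_succ, deriv, coeff_mk,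
        D_succ', binom_zero_right, D_zero_left]
      simp [D_zero]

theorem exists_eq_b_mul {N : ℕ} {x : AHat} (hx : x ∈ van (N + 1)) :
    ∃ y ∈ van N, x = b * y := by
  obtain ⟨y, hy, rfl⟩ := exists_eq_mul_b hx
  refine ⟨_, (van N).add_mem hy (van_mul_right _ fun n hn => ?_), mul_b_eq y⟩
  rw [deriv, coeff_mk, hy n hn, map_zero]

theorem exists_eq_b_pow_mul {N : ℕ} {x : AHat} (hx : x ∈ van N) : ∃ y, x = b ^ N * y := by
  induction N generalizing x with
  | zero => exact ⟨x, by simp⟩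
  | succ N ih =>
    obtain ⟨y, hy, rfl⟩ := exists_eq_b_mul hx
    obtain ⟨z, rfl⟩ := ih hy
    exact ⟨z, by rw [pow_succ', mul_assoc]⟩

theorem b_pow_mul_mem_van (N : ℕ) (x : AHat) : b ^ N * x ∈ van N :=
  van_mul_right x (van_pow b_mem_van N)

theorem sub_ofA_coeff_zero_mem_van (u : AHat) : u - ofA (u.coeff 0) ∈ van 1 := by
  intro n hn
  obtain rfl : n = 0 := by omega
  simp [coeff_ofA]

theorem exists_eq_ofA_add (u : AHat) : ∃ w, u = ofA (u.coeff 0) + b * w := by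
  obtain ⟨w, -, hw⟩ := exists_eq_b_mul (N := 0) (sub_ofA_coeff_zero_mem_van u)
  exact ⟨w, by rw [← hw]; abel⟩

/-- Division of a power series by `X`, dropping the constant term. -/
noncomputable def shift (f : ℂ⟦X⟧) : ℂ⟦X⟧ := PowerSeries.mk fun p => PowerSeries.coeff (p + 1) f

theorem eq_shift (f : ℂ⟦X⟧) :
    f = shift f * PowerSeries.X + PowerSeries.C (PowerSeries.constantCoeff f) :=
  PowerSeries.eq_shift_mul_X_add_const f

theorem ofA_eq (f : ℂ⟦X⟧) : ofA f = PowerSeries.constantCoeff f • 1 + a * ofA (shift f) := by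
  have h := congrArg ofAHom (PowerSeries.eq_X_mul_shift_add_const f)
  rw [map_add, map_mul] at h
  rw [← ofA_C, add_comm]
  exact h

/-- Every element of `Â` is a constant modulo the right ideal generated by `a` and `b`. -/
theorem exists_eq_const_add (u : AHat) :
    ∃ c : ℂ, ∃ v w, u = ofB (PowerSeries.C c) + a * v + b * w := by
  obtain ⟨w, hw⟩ := exists_eq_ofA_add u
  exact ⟨_, _, w, by rw [ofB_C, ← ofA_eq, ← hw]⟩

/-- Only `f 0, …, f m` reach the coefficient of `b^m`, so the `b`-adic sum is finite in each degree;
for the same reason it stays in `Ã` when its terms do. -/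
theorem exists_tsum (f : ℕ → AHat) (hf : ∀ n, f n ∈ van n) :
    ∃ y : AHat, ((∀ n, f n ∈ ATilde) → y ∈ ATilde) ∧
      ∀ N, y - ∑ n ∈ Finset.range N, f n ∈ van N := by
  refine ⟨mk fun m => ∑ n ∈ Finset.range (m + 1), (f n).coeff m, fun h m => ?_, fun N m hm => ?_⟩
  · rw [coeff_mk]
    exact Subring.sum_mem _ fun n _ => h n m
  · rw [coeff_sub, coeff_mk, coeff_sum, sub_eq_zero]
    refine Finset.sum_subset_zero_on_sdiff (by simpa using hm) ?_ fun _ _ => rfl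
    intro k hk
    simp only [Finset.mem_sdiff, Finset.mem_range] at hk
    exact hf k m (by omega)

/-! ### Right division by `a - c b` -/

theorem shift_coe (p : Polynomial ℂ) : shift p = (p.divX : Polynomial ℂ) := by
  ext n
  simp [shift, Polynomial.coeff_divX]

/-- The coefficients of the quotient in the right division by `a - c b`. -/
noncomputable def quotCoeff (c : ℂ) (u : AHat) : ℕ → ℂ⟦X⟧
  | 0 => shift (u.coeff 0)
  | n + 1 => shift (u.coeff (n + 1) + PowerSeries.C (n + c) * quotCoeff c u n)

theorem coeff_mul_linear_zero (c : ℂ) (v : AHat) :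
    (v * (a - c • b)).coeff 0 = v.coeff 0 * PowerSeries.X := by
  rw [mul_sub, coeff_sub, coeff_mul_a_zero, mul_smul_comm, coeff_smul, coeff_mul_b_zero]
  simp

theorem coeff_mul_linear_succ (c : ℂ) (v : AHat) (n : ℕ) : (v * (a - c • b)).coeff (n + 1) =
    v.coeff (n + 1) * PowerSeries.X - PowerSeries.C (n + c) * v.coeff n := by
  rw [mul_sub, coeff_sub, coeff_mul_a_succ, mul_smul_comm, coeff_smul, coeff_mul_b_succ,
    PowerSeries.smul_eq_C_mul]
  simp only [map_add, map_natCast]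
  ring

/-- The product `v (a - c b)` has coefficients `v_0 X` and `v_(n+1) X - (n + c) v_n`. Each `v_n` is
therefore found by dividing by `X`, and the constants left over form the remainder. Dividing a
polynomial by `X` gives a polynomial, which is why the quotient stays in `Ã`. -/
theorem exists_division (c : ℂ) (u : AHat) :
    ∃ v r, (u ∈ ATilde → v ∈ ATilde) ∧ u = v * (a - c • b) + ofB r := by
  refine ⟨mk (quotCoeff c u), PowerSeries.mk fun n => match n with
    | 0 => PowerSeries.constantCoeff (u.coeff 0)
    | n + 1 => PowerSeries.constantCoeff (u.coeff (n + 1) + PowerSeries.C (n + c) * quotCoeff c u n),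
    fun hu n => ?_, ?_⟩
  · have hs : ∀ f ∈ (Polynomial.coeToPowerSeries.ringHom (R := ℂ)).range,
        shift f ∈ (Polynomial.coeToPowerSeries.ringHom (R := ℂ)).range := by
      rintro _ ⟨p, rfl⟩
      exact ⟨p.divX, (shift_coe p).symm⟩
    rw [coeff_mk]
    induction n with
    | zero => exact hs _ (hu 0)
    | succ n ih =>
      refine hs _ (Subring.add_mem _ (hu _) (Subring.mul_mem _ ⟨Polynomial.C (n + c), ?_⟩ ih))
      exact Polynomial.coe_C _
  · ext1 n
    rw [coeff_add]
    cases n with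
    | zero =>
      rw [coeff_mul_linear_zero, coeff_mk, coeff_ofB, PowerSeries.coeff_mk]
      exact eq_shift _
    | succ n =>
      rw [coeff_mul_linear_succ, coeff_mk, coeff_mk, coeff_ofB, PowerSeries.coeff_mk]
      have := eq_shift (u.coeff (n + 1) + PowerSeries.C (n + c) * quotCoeff c u n)
      rw [quotCoeff]
      linear_combination this

/-- By induction on the degree, a multiple of `X` equals a constant only if both are zero. With
`exists_division`, this makes the class of `1` a `ℂ⟦b⟧`-basis of `Â / Â (a - c b)`. -/
theorem eq_zero_of_mul_linear_eq_ofB {c : ℂ} {v : AHat} {r : ℂ⟦X⟧}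
    (h : v * (a - c • b) = ofB r) : r = 0 := by
  have key : ∀ (f : ℂ⟦X⟧) (z : ℂ), f * PowerSeries.X = PowerSeries.C z → f = 0 ∧ z = 0 := by
    intro f z hf
    have hz : z = 0 := by simpa using (congrArg PowerSeries.constantCoeff hf).symm
    refine ⟨?_, hz⟩
    rw [hz, map_zero] at hf
    exact (mul_eq_zero.1 hf).resolve_right PowerSeries.X_ne_zero
  have hv : ∀ n, v.coeff n = 0 ∧ PowerSeries.coeff n r = 0 := by
    intro n
    have hn := congrArg (fun x => x.coeff n) h
    induction n with
    | zero =>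
      simp only [coeff_mul_linear_zero, coeff_ofB] at hn
      exact key _ _ hn
    | succ n ih =>
      simp only [coeff_mul_linear_succ, coeff_ofB, (ih (congrArg (fun x => x.coeff n) h)).1,
        mul_zero, sub_zero] at hn
      exact key _ _ hn
  ext n
  simpa using (hv n).2

end AHat

open AHat

/-! ### Freeness over `ℂ⟦b⟧` as a `b`-adic condition -/

section Modules

variable {E : Type u} [AddCommGroup E] [Module AHat E]

theorem ofB_C_add_X_mul (S : ℂ⟦X⟧) : ofB S =
    ofB (PowerSeries.C (PowerSeries.constantCoeff S)) + b * ofB (shift S) := by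
  nth_rewrite 1 [eq_shift S]
  rw [ofB_add, mul_comm, ofB_mul, ofB_X, add_comm]

theorem ofB_C_smul_comm (c : ℂ) (u : AHat) (x : E) :
    ofB (PowerSeries.C c) • u • x = u • ofB (PowerSeries.C c) • x := by
  rw [← mul_smul, ← mul_smul, ofB_C_mul, mul_ofB_C]

theorem smul_smul_eq (c : ℂ) (u : AHat) (x : E) : (c • u) • x = ofB (PowerSeries.C c) • u • x := by
  rw [← ofB_C_mul, mul_smul]

theorem a_smul_b_smul (x : E) : a • b • x = b • (a • x + b • x) := by
  have hab : a * b = b * a + b ^ 2 := by rw [← a_mul_b_sub]; abel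
  rw [← mul_smul, hab, add_smul, mul_smul, pow_two, mul_smul, smul_add]

/-- A finite family of elements of `E` is a `ℂ`-basis modulo `b E`. -/
structure IsBasisModB {k : ℕ} (e : Fin k → E) : Prop where
  span : ∀ x : E, ∃ c : Fin k → ℂ, ∃ y, x = ∑ i, ofB (PowerSeries.C (c i)) • e i + b • y
  indep : ∀ (c : Fin k → ℂ) (y : E), ∑ i, ofB (PowerSeries.C (c i)) • e i = b • y → c = 0

/-- `b` is injective and `E` is separated for the `b`-adic topology. -/
structure IsBSeparated (E : Type u) [AddCommGroup E] [Module AHat E] : Prop where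
  inj : ∀ x : E, b • x = 0 → x = 0
  sep : ∀ x : E, (∀ N : ℕ, ∃ y : E, x = b ^ N • y) → x = 0

theorem sum_ofB_X_mul_smul {k : ℕ} (c : Fin k → ℂ⟦X⟧) (e : Fin k → E) :
    ∑ i, ofB (PowerSeries.X * c i) • e i = b • ∑ i, ofB (c i) • e i := by
  rw [Finset.smul_sum]
  exact Finset.sum_congr rfl fun i _ => by rw [ofB_mul, ofB_X, mul_smul]

theorem sum_ofB_eq {k : ℕ} (c : Fin k → ℂ⟦X⟧) (e : Fin k → E) :
    ∑ i, ofB (c i) • e i = ∑ i, ofB (PowerSeries.C (PowerSeries.constantCoeff (c i))) • e i +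
      b • ∑ i, ofB (shift (c i)) • e i := by
  rw [Finset.smul_sum, ← Finset.sum_add_distrib]
  exact Finset.sum_congr rfl fun i _ => by
    rw [← mul_smul, ← add_smul, ← ofB_C_add_X_mul]

/-- Successive approximation: expand modulo `b`, divide the remainder by `b`, repeat. The constants
obtained are already the coefficients of power series, so no completeness of `E` is needed, only
separation. For uniqueness, a relation loses one coefficient at a time, since `b` is injective. -/
theorem IsBasisModB.exists_unique {k : ℕ} {e : Fin k → E} (he : IsBasisModB e)
    (hE : IsBSeparated E) (x : E) : ∃! c : Fin k → ℂ⟦X⟧, x = ∑ i, ofB (c i) • e i := by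
  choose c y hy using he.span
  -- `z N` is the remainder after `N` divisions by `b`, and `S N i` collects the constants produced
  -- from that stage on.
  let z : ℕ → E := fun n => y^[n] x
  let S : ℕ → Fin k → ℂ⟦X⟧ := fun N i => PowerSeries.mk fun n => c (z (N + n)) i
  have hS : ∀ N i, S N i = PowerSeries.X * S (N + 1) i + PowerSeries.C (c (z N) i) := by
    intro N i
    ext n
    cases n with
    | zero => simp [S]
    | succ n =>
      rw [map_add, PowerSeries.coeff_succ_X_mul, PowerSeries.coeff_C, if_neg n.succ_ne_zero,
        PowerSeries.coeff_mk, PowerSeries.coeff_mk, add_zero, add_assoc, add_comm 1 n]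
  have hz : ∀ N, z N = ∑ i, ofB (PowerSeries.C (c (z N) i)) • e i + b • z (N + 1) := by
    intro N
    nth_rewrite 1 [hy (z N)]
    simp only [z, Function.iterate_succ_apply']
  have hd : ∀ N, z N - ∑ i, ofB (S N i) • e i = b • (z (N + 1) - ∑ i, ofB (S (N + 1) i) • e i) := by
    intro N
    nth_rewrite 1 [hz N]
    simp only [hS N, ofB_add, add_smul, Finset.sum_add_distrib, sum_ofB_X_mul_smul, smul_sub]
    abel
  have hd' : ∀ N, z 0 - ∑ i, ofB (S 0 i) • e i = b ^ N • (z N - ∑ i, ofB (S N i) • e i) := by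
    intro N
    induction N with
    | zero => simp
    | succ N ih => rw [ih, hd N, pow_succ, mul_smul]
  have huniq : ∀ d : Fin k → ℂ⟦X⟧, ∑ i, ofB (d i) • e i = 0 → d = 0 := by
    have h0 : ∀ d : Fin k → ℂ⟦X⟧, ∑ i, ofB (d i) • e i = 0 →
        (∀ i, PowerSeries.constantCoeff (d i) = 0) ∧ ∑ i, ofB (shift (d i)) • e i = 0 := by
      intro d hd
      have h1 := sum_ofB_eq d e
      rw [hd] at h1
      have h2 := he.indep _ (-∑ i, ofB (shift (d i)) • e i)
        (by rw [smul_neg]; exact eq_neg_of_add_eq_zero_left h1.symm)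
      refine ⟨fun i => congrFun h2 i, hE.inj _ ?_⟩
      have h3 : ∀ i, PowerSeries.constantCoeff (d i) = 0 := fun i => congrFun h2 i
      simp only [h3, map_zero, ofB_zero, zero_smul, Finset.sum_const_zero, zero_add] at h1
      exact h1.symm
    intro d hd
    funext i
    ext n
    induction n generalizing d with
    | zero => simpa using (h0 d hd).1 i
    | succ n ih => simpa [shift] using ih _ (h0 d hd).2
  refine ⟨S 0, sub_eq_zero.1 (hE.sep _ fun N => ⟨_, hd' N⟩), fun d hd => ?_⟩
  refine sub_eq_zero.1 (huniq _ ?_)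
  have h1 : x = ∑ i, ofB (S 0 i) • e i := sub_eq_zero.1 (hE.sep _ fun N => ⟨_, hd' N⟩)
  simp only [Pi.sub_apply, ofB_sub, sub_smul, Finset.sum_sub_distrib]
  rw [← hd, ← h1, sub_self]

theorem isBasisModB_of_exists_unique {k : ℕ} {e : Fin k → E}
    (he : ∀ x : E, ∃! c : Fin k → ℂ⟦X⟧, x = ∑ i, ofB (c i) • e i) :
    IsBasisModB e ∧ IsBSeparated E := by
  choose c hc hu using he
  have hX : ∀ (d : Fin k → ℂ⟦X⟧) N, b ^ N • ∑ i, ofB (d i) • e i =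
      ∑ i, ofB (PowerSeries.X ^ N * d i) • e i := by
    intro d N
    induction N with
    | zero => simp
    | succ N ih => simp only [pow_succ', mul_assoc, sum_ofB_X_mul_smul, ← ih, mul_smul]
  have hinj : ∀ d d' : Fin k → ℂ⟦X⟧, ∑ i, ofB (d i) • e i = ∑ i, ofB (d' i) • e i → d = d' :=
    fun d d' h => (hu _ d rfl).trans (hu _ d' h).symm
  refine ⟨⟨fun x => ⟨_, _, (hc x).trans (sum_ofB_eq _ _)⟩, fun d y hy => ?_⟩, fun x hx => ?_,
    fun x hx => ?_⟩
  · rw [hc y, ← sum_ofB_X_mul_smul] at hy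
    have := hinj _ _ hy
    funext i
    simpa using congrArg PowerSeries.constantCoeff (congrFun this i)
  · rw [hc x, ← sum_ofB_X_mul_smul, show (0 : E) = ∑ i, ofB ((0 : Fin k → ℂ⟦X⟧) i) • e i by
      simp [ofB_zero]] at hx
    have := hinj _ _ hx
    rw [hc x]
    refine Finset.sum_eq_zero fun i _ => ?_
    have h0 := congrFun this i
    simp only [Pi.zero_apply, mul_eq_zero, PowerSeries.X_ne_zero, false_or] at h0
    rw [h0, ofB_zero, zero_smul]
  · rw [hc x]
    refine Finset.sum_eq_zero fun i _ => ?_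
    have h0 : c x i = 0 := by
      ext n
      obtain ⟨y, hy⟩ := hx (n + 1)
      rw [hc y, hX, hc x] at hy
      rw [congrFun (hinj _ _ hy) i, PowerSeries.coeff_X_pow_mul']
      simp
    rw [h0, ofB_zero, zero_smul]

/-- The right-hand side involves only classes modulo `b E` and `b`-adic separation. These survive
the replacement of `b` by `β = b θ'(a)`, whereas the `ℂ⟦b⟧`-structure itself changes. -/
theorem isFreeOfRank_iff {k : ℕ} :
    IsFreeOfRank k E ↔ IsBSeparated E ∧ ∃ e : Fin k → E, IsBasisModB e := by
  constructor
  · rintro ⟨e, he⟩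
    exact ⟨(isBasisModB_of_exists_unique he).2, e, (isBasisModB_of_exists_unique he).1⟩
  · rintro ⟨hE, e, he⟩
    exact ⟨e, he.exists_unique hE⟩

/-! ### Modules of rank one -/

theorem exists_eq_ofB_smul_of_linear_smul_eq_zero {c : ℂ} {e : E} (he : (a - c • b) • e = 0) (u : AHat) :
    ∃ r, u • e = ofB r • e := by
  obtain ⟨v, r, -, rfl⟩ := exists_division c u
  exact ⟨r, by rw [add_smul, mul_smul, he, smul_zero, zero_add]⟩

theorem rankOne_mk_eq_zero_iff (l : ℚ) (r : ℂ⟦X⟧) :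
    ofB r • (Submodule.Quotient.mk 1 : RankOne l) = 0 ↔ r = 0 := by
  rw [← Submodule.Quotient.mk_smul, Submodule.Quotient.mk_eq_zero, smul_eq_mul, mul_one,
    Submodule.mem_span_singleton]
  constructor
  · rintro ⟨v, hv⟩
    exact eq_zero_of_mul_linear_eq_ofB hv
  · rintro rfl
    exact ⟨0, by simp [ofB_zero]⟩

theorem rankOne_linear_smul (l : ℚ) :
    (a - (l : ℂ) • b) • (Submodule.Quotient.mk 1 : RankOne l) = 0 := by
  rw [← Submodule.Quotient.mk_smul, Submodule.Quotient.mk_eq_zero, smul_eq_mul, mul_one]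
  exact Submodule.mem_span_singleton_self _

theorem rankOne_exists (l : ℚ) (x : RankOne l) :
    ∃ r, x = ofB r • (Submodule.Quotient.mk 1 : RankOne l) := by
  obtain ⟨u, rfl⟩ := Submodule.Quotient.mk_surjective _ x
  obtain ⟨r, hr⟩ := exists_eq_ofB_smul_of_linear_smul_eq_zero (rankOne_linear_smul l) u
  refine ⟨r, ?_⟩
  rw [← hr, ← Submodule.Quotient.mk_smul, smul_eq_mul, mul_one]

/-- The equation `T' = -s T`. -/
theorem exists_derivative_eq (s : ℂ⟦X⟧) : ∃ T : ℂ⟦X⟧, PowerSeries.constantCoeff T = 1 ∧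
    PowerSeries.derivative ℂ T = -s * T := by
  -- `g` is the primitive of `-s` without constant term, and `T = exp g`.
  let g : ℂ⟦X⟧ := PowerSeries.X * PowerSeries.mk fun n => -PowerSeries.coeff n s / (n + 1)
  have hg0 : PowerSeries.constantCoeff g = 0 := by simp [g]
  have hg : PowerSeries.HasSubst g := PowerSeries.HasSubst.of_constantCoeff_zero' hg0
  have hg' : PowerSeries.derivative ℂ g = -s := by
    ext n
    rw [PowerSeries.coeff_derivative, PowerSeries.coeff_succ_X_mul, PowerSeries.coeff_mk, map_neg]
    have : (n : ℂ) + 1 ≠ 0 := Nat.cast_add_one_ne_zero n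
    field_simp
  refine ⟨(PowerSeries.exp ℂ).subst g, ?_, ?_⟩
  · have h := PowerSeries.eq_X_mul_shift_add_const (PowerSeries.exp ℂ)
    rw [h, PowerSeries.subst_add hg, PowerSeries.subst_mul hg, PowerSeries.subst_X hg,
      PowerSeries.constantCoeff_exp, PowerSeries.subst_C]
    simp only [map_add, map_mul, hg0, zero_mul, zero_add]
    exact map_one _
  · rw [PowerSeries.derivative_subst hg, PowerSeries.derivative_exp, hg', mul_comm]

theorem linear_smul_ofB_smul (c : ℂ) (r : ℂ⟦X⟧) (e : E) : (a - c • b) • ofB r • e =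
    ofB r • (a - c • b) • e + ofB (PowerSeries.X ^ 2 * PowerSeries.derivative ℂ r) • e := by
  rw [← mul_smul, ← mul_smul, ← add_smul]
  congr 1
  rw [sub_mul, mul_sub, a_mul_ofB, smul_mul_assoc, mul_smul_comm, ofB_mul_b]
  abel

theorem ofB_X_sq_mul (r : ℂ⟦X⟧) : ofB (PowerSeries.X ^ 2 * r) = b ^ 2 * ofB r := by
  rw [pow_two, mul_assoc, ofB_mul, ofB_mul, ofB_X, pow_two, mul_assoc]

/-- If `u` kills `e`, so does the remainder of `u` modulo `a - λ b`; freeness makes that remainder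
zero, so the annihilator is the left ideal of `a - λ b`. -/
theorem nonempty_equiv_rankOne_of_linear_smul {l : ℚ} {e : E} (he : ∀ x : E, ∃ r, x = ofB r • e)
    (he' : ∀ r, ofB r • e = 0 → r = 0)
    (h : (a - (l : ℂ) • b) • e = 0) : Nonempty (E ≃ₗ[AHat] RankOne l) := by
  let f : AHat →ₗ[AHat] E := LinearMap.toSpanSingleton AHat E e
  have hf : Function.Surjective f := fun x => by
    obtain ⟨r, rfl⟩ := he x
    exact ⟨ofB r, rfl⟩
  have hk : LinearMap.ker f = Submodule.span AHat {a - (l : ℂ) • b} := by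
    ext u
    rw [LinearMap.mem_ker, LinearMap.toSpanSingleton_apply, Submodule.mem_span_singleton]
    constructor
    · intro hu
      obtain ⟨v, r, -, rfl⟩ := exists_division l u
      rw [add_smul, mul_smul, h, smul_zero, zero_add] at hu
      exact ⟨v, by rw [he' r hu, ofB_zero, add_zero, smul_eq_mul]⟩
    · rintro ⟨v, rfl⟩
      rw [smul_assoc, h, smul_zero]
  exact ⟨((Submodule.quotEquivOfEq _ _ hk).symm.trans (f.quotKerEquivOfSurjective hf)).symm⟩

/-- A rank one module with a generator `e` such that `a e ∈ λ b e + b² E` is `E_λ`. -/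
theorem nonempty_equiv_rankOne {l : ℚ} {e : E} (he : ∀ x : E, ∃ r, x = ofB r • e)
    (he' : ∀ r, ofB r • e = 0 → r = 0) {y : E}
    (hy : (a - (l : ℂ) • b) • e = b ^ 2 • y) : Nonempty (E ≃ₗ[AHat] RankOne l) := by
  obtain ⟨s, rfl⟩ := he y
  -- The error is gauged away: `(a - λ b) T e = b² (s T + T') e`, which vanishes for `T' = -s T`.
  obtain ⟨T, hT, hT'⟩ := exists_derivative_eq s
  have hT0 : PowerSeries.constantCoeff T ≠ 0 := by rw [hT]; exact one_ne_zero
  have e1 : ∀ r, ofB r • e = ofB (r * T⁻¹) • ofB T • e := fun r => by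
    rw [← mul_smul, ← ofB_mul, mul_assoc, PowerSeries.inv_mul_cancel _ hT0, mul_one]
  refine nonempty_equiv_rankOne_of_linear_smul (e := ofB T • e) (fun x => ?_) (fun r hr => ?_) ?_
  · obtain ⟨r, rfl⟩ := he x
    exact ⟨_, e1 r⟩
  · rw [← mul_smul, ← ofB_mul] at hr
    refine (mul_eq_zero.1 (he' _ hr)).resolve_right ?_
    rintro rfl
    simp at hT0
  · rw [linear_smul_ofB_smul, hy, ← mul_smul (b ^ 2), ← ofB_X_sq_mul, ← mul_smul, ← ofB_mul, ← add_smul,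
      ← ofB_add, hT', show T * (PowerSeries.X ^ 2 * s) + PowerSeries.X ^ 2 * (-s * T) = 0 by ring,
      ofB_zero, zero_smul]

end Modules

namespace ChangeOfVariable

variable (θ : ChangeOfVariable)

/-! ### The automorphism `Θ` -/

theorem Theta_ofA (P : ℂ⟦X⟧) : θ.Theta (ofA P) = ofA (P.subst θ.series) := by
  ext1 n
  change ∑ ν ∈ Finset.range (n + 1), _ = _
  rw [Finset.sum_range_succ', Finset.sum_eq_zero]
  · simp [coeff_ofA, coeff_one]
  · intro k _
    simp [coeff_ofA, ← PowerSeries.coe_substAlgHom θ.hasSubst]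

theorem Theta_smul (c : ℂ) (x : AHat) : θ.Theta (c • x) = c • θ.Theta x := by
  have h : θ.Theta (c • 1) = c • 1 := by
    rw [← ofA_C, Theta_ofA, PowerSeries.subst_C]; rfl
  rw [← one_mul x, ← smul_mul_assoc, map_mul, h, smul_mul_assoc, one_mul, one_mul]

theorem Theta_ofB_C (c : ℂ) : θ.Theta (ofB (PowerSeries.C c)) = ofB (PowerSeries.C c) := by
  rw [ofB_C, Theta_smul, map_one]

theorem Theta_mem_van {N : ℕ} {x : AHat} (hx : x ∈ van N) : θ.Theta x ∈ van N := by
  have h := θ.ThetaFun_sub_mem x N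
  rw [Finset.sum_eq_zero, sub_zero] at h
  · exact h
  · intro k hk
    rw [hx k (Finset.mem_range.1 hk), map_zero, zero_mul]

theorem Theta_a : θ.Theta a = θ.alpha := by
  rw [a, Theta_ofA, PowerSeries.subst_X θ.hasSubst, alpha]

theorem Theta_b : θ.Theta b = θ.beta := by
  ext1 n
  change ∑ ν ∈ Finset.range (n + 1), _ = _
  cases n with
  | zero =>
    simp [coeff_b, ← PowerSeries.coe_substAlgHom θ.hasSubst]
    exact (θ.beta_mem 0 one_pos).symm
  | succ n =>
    rw [Finset.sum_eq_single 1]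
    · simp [coeff_b, ← PowerSeries.coe_substAlgHom θ.hasSubst]
    · intro k _ hk
      simp [coeff_b, hk, ← PowerSeries.coe_substAlgHom θ.hasSubst]
    · simp

theorem constantCoeff_shift : PowerSeries.constantCoeff (shift θ.series) ≠ 0 := by
  simpa [shift] using θ.coeff_one_ne_zero

theorem series_eq : θ.series = shift θ.series * PowerSeries.X := by
  have := eq_shift θ.series
  rwa [θ.constantCoeff_eq_zero, map_zero, add_zero] at this

theorem constantCoeff_derivative :
    PowerSeries.constantCoeff (PowerSeries.derivative ℂ θ.series) ≠ 0 := by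
  rw [← PowerSeries.coeff_zero_eq_constantCoeff_apply, PowerSeries.coeff_derivative]
  simpa using θ.coeff_one_ne_zero

theorem alpha_eq : θ.alpha = a * ofA (shift θ.series) := by
  rw [alpha, a, ← ofA_mul, mul_comm, ← series_eq]

theorem alpha_mul : θ.alpha * ofA (shift θ.series)⁻¹ = a := by
  rw [alpha_eq, mul_assoc, ofA_mul_inv θ.constantCoeff_shift, mul_one]

theorem beta_mul : θ.beta * ofA (PowerSeries.derivative ℂ θ.series)⁻¹ = b := by
  rw [beta, mul_assoc, ofA_mul_inv θ.constantCoeff_derivative, mul_one]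

theorem exists_subst_eq (Q : ℂ⟦X⟧) : ∃ P : ℂ⟦X⟧, P.subst θ.series = Q := by
  have hu : IsUnit (PowerSeries.coeff 1 θ.series) := θ.coeff_one_ne_zero.isUnit
  refine ⟨Q.subst (θ.series.substInvOfIsUnit hu), ?_⟩
  rw [PowerSeries.subst_comp_subst_apply (PowerSeries.HasSubst.substInvOfIsUnit _ hu) θ.hasSubst,
    PowerSeries.subst_substInvOfIsUnit_left _ θ.constantCoeff_eq_zero hu, PowerSeries.X_subst]

/-- If `e` generates `E` modulo `β E` by the action of `ℂ⟦θ(a)⟧`, then it generates `θ_*(E)`. -/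
theorem exists_Theta_smul_eq {E : Type u} [AddCommGroup E] [Module AHat E]
    (hE : ∀ x : E, (∀ N : ℕ, ∃ y : E, x = b ^ N • y) → x = 0) (p : Prop) (e : E)
    (h : ∀ x : E, ∃ (P : ℂ⟦X⟧) (y : E), (p → ofA P ∈ ATilde) ∧
      x = θ.Theta (ofA P) • e + θ.beta • y) (x : E) :
    ∃ u, (p → u ∈ ATilde) ∧ x = θ.Theta u • e := by
  choose P y hp hy using h
  let z : ℕ → E := fun n => y^[n] x
  -- The powers of `b` stand on the left because iterating `x = Θ(P) e + β y` gives the terms `β^n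
  -- Θ(P_n) e = Θ(b^n P_n) e`.
  obtain ⟨u, hu, hu'⟩ := exists_tsum (fun n => b ^ n * ofA (P (z n)))
    (fun n => b_pow_mul_mem_van n _)
  refine ⟨u, fun h => hu fun n => ATilde.mul_mem (ATilde.pow_mem ATilde.b.2 n) (hp _ h), ?_⟩
  have hz : ∀ N, x = θ.Theta (∑ n ∈ Finset.range N, b ^ n * ofA (P (z n))) • e +
      θ.beta ^ N • z N := by
    intro N
    induction N with
    | zero => simp [z]
    | succ N ih =>
      nth_rewrite 1 [ih]
      nth_rewrite 1 [hy (z N)]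
      rw [Finset.sum_range_succ, map_add, map_mul, map_pow, Theta_b, add_smul, smul_add,
        ← mul_smul, ← mul_smul, pow_succ, add_assoc]
      simp only [z, Function.iterate_succ_apply']
  refine sub_eq_zero.1 (hE _ fun N => ?_)
  obtain ⟨w, hw⟩ := exists_eq_b_pow_mul (van_pow θ.beta_mem N)
  obtain ⟨w', hw'⟩ := exists_eq_b_pow_mul (θ.Theta_mem_van (hu' N))
  refine ⟨w • z N - w' • e, ?_⟩
  rw [smul_sub, ← mul_smul, ← mul_smul, ← hw, ← hw']
  nth_rewrite 1 [hz N]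
  rw [map_sub, sub_smul]
  abel

/-- This is the previous approximation for the module `Â` and the element `1`: modulo `β Â` every
element is a power series in `a`, hence one in `θ(a)`. The clause about `Ã` is switched off by
taking `p = False`. -/
theorem Theta_surjective : Function.Surjective θ.Theta := by
  intro x
  have hsep : ∀ x : AHat, (∀ N : ℕ, ∃ y : AHat, x = b ^ N • y) → x = 0 := by
    intro x hx
    refine eq_zero_of_forall_mem_van fun N => ?_
    obtain ⟨y, rfl⟩ := hx N
    exact b_pow_mul_mem_van N y
  obtain ⟨u, -, hu⟩ := θ.exists_Theta_smul_eq hsep False 1 (fun x => by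
    obtain ⟨w, hw⟩ := exists_eq_ofA_add x
    obtain ⟨P, hP⟩ := θ.exists_subst_eq (x.coeff 0)
    refine ⟨P, ofA (PowerSeries.derivative ℂ θ.series)⁻¹ * w, False.elim, ?_⟩
    rw [Theta_ofA, hP, smul_eq_mul, smul_eq_mul, ← mul_assoc, beta_mul, mul_one]
    exact hw) x
  exact ⟨u, by rw [hu, smul_eq_mul, mul_one]⟩

/-! ### The functor `θ_*` -/

section Functor

variable {E : Type u} [AddCommGroup E] [Module AHat E]

/-- The identity map from `E` to `θ_*(E)`. -/
noncomputable def push : E ≃+ θ.Pushforward E := AddEquiv.refl E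

theorem smul_push (u : AHat) (x : E) : u • θ.push x = θ.push (θ.Theta u • x) := rfl

theorem a_smul_push (x : E) : a • θ.push x = θ.push (θ.alpha • x) := by
  rw [smul_push, Theta_a]

theorem b_smul_push (x : E) : b • θ.push x = θ.push (θ.beta • x) := by
  rw [smul_push, Theta_b]

theorem ofB_C_smul_push (c : ℂ) (x : E) :
    ofB (PowerSeries.C c) • θ.push x = θ.push (ofB (PowerSeries.C c) • x) := by
  rw [smul_push, Theta_ofB_C]

theorem beta_smul (x : E) : θ.beta • x = b • ofA (PowerSeries.derivative ℂ θ.series) • x := by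
  rw [beta, mul_smul]

theorem b_smul (x : E) : b • x = θ.beta • ofA (PowerSeries.derivative ℂ θ.series)⁻¹ • x := by
  rw [← mul_smul, beta_mul]

theorem alpha_smul (x : E) : θ.alpha • x = a • ofA (shift θ.series) • x := by
  rw [alpha_eq, mul_smul]

theorem a_smul (x : E) : a • x = θ.alpha • ofA (shift θ.series)⁻¹ • x := by
  rw [← mul_smul, alpha_mul]

theorem isBSeparated_pushforward (hE : IsBSeparated E) : IsBSeparated (θ.Pushforward E) where
  inj x hx := by
    obtain ⟨x, rfl⟩ := θ.push.surjective x
    rw [b_smul_push, beta_smul, map_eq_zero_iff _ θ.push.injective] at hx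
    have := hE.inj _ hx
    rw [map_eq_zero_iff _ θ.push.injective, ← one_smul AHat x,
      ← ofA_inv_mul θ.constantCoeff_derivative, mul_smul, this, smul_zero]
  sep x hx := by
    obtain ⟨x, rfl⟩ := θ.push.surjective x
    rw [map_eq_zero_iff _ θ.push.injective]
    refine hE.sep x fun N => ?_
    obtain ⟨y, hy⟩ := hx N
    obtain ⟨y, rfl⟩ := θ.push.surjective y
    rw [smul_push, map_pow, Theta_b] at hy
    obtain ⟨w, hw⟩ := exists_eq_b_pow_mul (van_pow θ.beta_mem N)
    exact ⟨w • y, by rw [θ.push.injective hy, hw, mul_smul]⟩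

theorem isBasisModB_pushforward {k : ℕ} {e : Fin k → E} (he : IsBasisModB e) :
    IsBasisModB fun i => θ.push (e i) where
  span x := by
    obtain ⟨x, rfl⟩ := θ.push.surjective x
    obtain ⟨c, y, hy⟩ := he.span x
    refine ⟨c, θ.push (ofA (PowerSeries.derivative ℂ θ.series)⁻¹ • y), ?_⟩
    rw [b_smul_push, ← b_smul]
    simp only [ofB_C_smul_push]
    rw [← map_sum, ← map_add, ← hy]
  indep c y h := by
    obtain ⟨y, rfl⟩ := θ.push.surjective y
    rw [b_smul_push, beta_smul] at h
    simp only [ofB_C_smul_push] at h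
    rw [← map_sum] at h
    exact he.indep c _ (θ.push.injective h)

theorem isFreeOfRank_pushforward {k : ℕ} (hE : IsFreeOfRank k E) :
    IsFreeOfRank k (θ.Pushforward E) := by
  obtain ⟨h, e, he⟩ := isFreeOfRank_iff.1 hE
  exact isFreeOfRank_iff.2 ⟨θ.isBSeparated_pushforward h, _, θ.isBasisModB_pushforward he⟩

theorem isSimplePole_pushforward (hE : IsSimplePole E) : IsSimplePole (θ.Pushforward E) := by
  obtain ⟨⟨k, hk⟩, h⟩ := hE
  refine ⟨⟨k, θ.isFreeOfRank_pushforward hk⟩, fun x => ?_⟩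
  obtain ⟨x, rfl⟩ := θ.push.surjective x
  obtain ⟨y, hy⟩ := h (ofA (shift θ.series) • x)
  refine ⟨θ.push (ofA (PowerSeries.derivative ℂ θ.series)⁻¹ • y), ?_⟩
  rw [a_smul_push, b_smul_push, ← b_smul, alpha_smul, hy]

variable {G : Type v} [AddCommGroup G] [Module AHat G]

/-- The linear map `θ_*(E) → θ_*(G)` induced by a linear map `E → G`. -/
noncomputable def pushMap (f : E →ₗ[AHat] G) : θ.Pushforward E →ₗ[AHat] θ.Pushforward G where
  toFun x := θ.push (f (θ.push.symm x))
  map_add' x y := by simp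
  map_smul' c x := by
    obtain ⟨x, rfl⟩ := θ.push.surjective x
    rw [smul_push]
    simp [smul_push]

/-- The linear equivalence `θ_*(E) ≃ θ_*(G)` induced by a linear equivalence `E ≃ G`. -/
noncomputable def pushEquiv (f : E ≃ₗ[AHat] G) : θ.Pushforward E ≃ₗ[AHat] θ.Pushforward G :=
  { θ.pushMap f.toLinearMap with
    invFun := θ.pushMap f.symm.toLinearMap
    left_inv := fun x => f.symm_apply_apply x
    right_inv := fun x => f.apply_symm_apply x }

/-- A submodule of `E`, as a submodule of `θ_*(E)`. -/
noncomputable def pushSub (F : Submodule AHat E) : Submodule AHat (θ.Pushforward E) where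
  carrier := {x | θ.push.symm x ∈ F}
  add_mem' hx hy := F.add_mem hx hy
  zero_mem' := F.zero_mem
  smul_mem' c _ hx := F.smul_mem (θ.Theta c) hx

/-- `θ_*` commutes with subobjects. -/
noncomputable def pushSubEquiv (F : Submodule AHat E) : θ.pushSub F ≃ₗ[AHat] θ.Pushforward F where
  toFun x := θ.push ⟨θ.push.symm x.1, x.2⟩
  invFun x := ⟨θ.push (θ.push.symm x : F).1, (θ.push.symm x : F).2⟩
  map_add' _ _ := rfl
  map_smul' _ _ := rfl
  left_inv _ := rfl
  right_inv _ := rfl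

theorem nonempty_pushSub_quotient_equiv (F F' : Submodule AHat E) :
    Nonempty ((θ.pushSub F' ⧸ (θ.pushSub F).submoduleOf (θ.pushSub F')) ≃ₗ[AHat]
      θ.Pushforward (F' ⧸ F.submoduleOf F')) := by
  let f : θ.pushSub F' →ₗ[AHat] θ.Pushforward (F' ⧸ F.submoduleOf F') :=
    (θ.pushMap (F.submoduleOf F').mkQ).comp (θ.pushSubEquiv F').toLinearMap
  have hf : Function.Surjective f := fun x => by
    obtain ⟨x, rfl⟩ := θ.push.surjective x
    obtain ⟨x, rfl⟩ := Submodule.mkQ_surjective _ x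
    exact ⟨⟨θ.push x.1, x.2⟩, rfl⟩
  have hk : LinearMap.ker f = (θ.pushSub F).submoduleOf (θ.pushSub F') := by
    ext x
    have : f x = 0 ↔ (F.submoduleOf F').mkQ ⟨θ.push.symm x.1, x.2⟩ = 0 := Iff.rfl
    rw [LinearMap.mem_ker, this, Submodule.mkQ_apply, Submodule.Quotient.mk_eq_zero]
    rfl
  exact ⟨(Submodule.quotEquivOfEq _ _ hk).symm.trans (f.quotKerEquivOfSurjective hf)⟩

theorem nonempty_quotient_pushSub_equiv (F : Submodule AHat E) :
    Nonempty ((θ.Pushforward E ⧸ θ.pushSub F) ≃ₗ[AHat] θ.Pushforward (E ⧸ F)) := by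
  let f : θ.Pushforward E →ₗ[AHat] θ.Pushforward (E ⧸ F) := θ.pushMap F.mkQ
  have hf : Function.Surjective f := fun x => by
    obtain ⟨x, rfl⟩ := θ.push.surjective x
    obtain ⟨x, rfl⟩ := Submodule.mkQ_surjective _ x
    exact ⟨θ.push x, rfl⟩
  have hk : LinearMap.ker f = θ.pushSub F := by
    ext x
    have : f x = 0 ↔ F.mkQ (θ.push.symm x) = 0 := Iff.rfl
    rw [LinearMap.mem_ker, this, Submodule.mkQ_apply, Submodule.Quotient.mk_eq_zero]
    rfl
  exact ⟨(Submodule.quotEquivOfEq _ _ hk).symm.trans (f.quotKerEquivOfSurjective hf)⟩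

end Functor

end ChangeOfVariable

/-! ### Transport along isomorphisms -/

section Transport

variable {E : Type u} [AddCommGroup E] [Module AHat E] {E' : Type v} [AddCommGroup E']
  [Module AHat E']

theorem IsFreeOfRank.of_equiv {k : ℕ} (f : E ≃ₗ[AHat] E') (h : IsFreeOfRank k E) :
    IsFreeOfRank k E' := by
  obtain ⟨e, he⟩ := h
  refine ⟨fun i => f (e i), fun x => ?_⟩
  obtain ⟨c, hc, hu⟩ := he (f.symm x)
  have key : ∀ c : Fin k → ℂ⟦X⟧, x = ∑ i, ofB (c i) • f (e i) ↔
      f.symm x = ∑ i, ofB (c i) • e i := by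
    intro c
    rw [LinearEquiv.symm_apply_eq]
    simp
  exact ⟨c, (key c).2 hc, fun d hd => hu d ((key d).1 hd)⟩

theorem IsSaturation.comp_equiv {E E' G : Type u} [AddCommGroup E] [Module AHat E]
    [AddCommGroup E'] [Module AHat E'] [AddCommGroup G] [Module AHat G] {i : E →ₗ[AHat] G}
    (h : IsSaturation i) (f : E' ≃ₗ[AHat] E) : IsSaturation (i.comp f.toLinearMap) where
  injective := h.injective.comp f.injective
  simplePole := h.simplePole
  minimal H hH := h.minimal H fun x => by simpa using hH (f.symm x)

theorem IsRegularWithBernsteinRoots.of_equiv {E : Type u} [AddCommGroup E] [Module AHat E]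
    {E' : Type u} [AddCommGroup E'] [Module AHat E'] {C : ℂ → Prop} (f : E' ≃ₗ[AHat] E)
    (h : IsRegularWithBernsteinRoots C E) : IsRegularWithBernsteinRoots C E' := by
  obtain ⟨G, _, _, i, hi, hG⟩ := h
  exact ⟨G, _, _, _, hi.comp_equiv f, hG⟩

end Transport

/-! ### Bernstein roots, rank one modules and generators under `θ_*` -/

namespace ChangeOfVariable

variable (θ : ChangeOfVariable) {E : Type u} [AddCommGroup E] [Module AHat E]

theorem exists_alpha_eq : ∃ z, θ.alpha = PowerSeries.coeff 1 θ.series • a +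
    PowerSeries.coeff 2 θ.series • (a * a) + a * (a * (a * z)) := by
  refine ⟨ofA (shift (shift (shift θ.series))), ?_⟩
  rw [alpha_eq, ofA_eq (shift θ.series), ofA_eq (shift (shift θ.series))]
  simp only [mul_add, mul_smul_comm, mul_one, add_assoc]
  simp [shift]

theorem exists_beta_eq : ∃ z, θ.beta = PowerSeries.coeff 1 θ.series • b +
    (2 * PowerSeries.coeff 2 θ.series) • (b * a) + b * (a * (a * z)) := by
  refine ⟨ofA (shift (shift (PowerSeries.derivative ℂ θ.series))), ?_⟩
  have h0 : PowerSeries.constantCoeff (PowerSeries.derivative ℂ θ.series) =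
      PowerSeries.coeff 1 θ.series := by
    rw [← PowerSeries.coeff_zero_eq_constantCoeff_apply, PowerSeries.coeff_derivative]
    simp
  have h1 : PowerSeries.constantCoeff (shift (PowerSeries.derivative ℂ θ.series)) =
      2 * PowerSeries.coeff 2 θ.series := by
    rw [← PowerSeries.coeff_zero_eq_constantCoeff_apply, shift, PowerSeries.coeff_mk,
      PowerSeries.coeff_derivative]
    norm_num [mul_comm]
  rw [beta, ofA_eq (PowerSeries.derivative ℂ θ.series), ofA_eq (shift _), h0, h1]
  simp only [mul_add, mul_smul_comm, mul_one, add_assoc]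

/-- Each `b` is `β θ'(a)⁻¹`. The unit between the two factors is moved to the right of `β` by the
commutation relation, once it is written as a power series in `θ(a)`. -/
theorem exists_b_sq_smul_eq (x : E) : ∃ y : E, b ^ 2 • x = θ.beta ^ 2 • y := by
  obtain ⟨P, hP⟩ := θ.exists_subst_eq (PowerSeries.derivative ℂ θ.series)⁻¹
  have h := θ.substA_mul_beta P
  rw [substA_apply, hP, mul_assoc, ← mul_add] at h
  rw [pow_two, mul_smul, θ.b_smul x, θ.b_smul, ← mul_smul (ofA _) θ.beta, h, pow_two]
  exact ⟨_, by rw [mul_smul, mul_smul]⟩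

/-- With `a E ⊆ b E`, every term of degree at least two in `a` and `b` lands in `b² E`, so only the
linear parts of `α` and `β` remain, both with factor `θ'(0)`. -/
theorem exists_alpha_add_beta_smul_eq (hE : ∀ x : E, ∃ y : E, a • x = b • y) (z : ℂ) (x : E) :
    ∃ y : E, (θ.alpha + z • θ.beta) • x =
      ofB (PowerSeries.C (PowerSeries.coeff 1 θ.series)) • (a + z • b) • x + b ^ 2 • y := by
  have haa : ∀ x : E, ∃ y : E, a • a • x = b ^ 2 • y := by
    intro x
    obtain ⟨y₁, h₁⟩ := hE x
    obtain ⟨y₂, h₂⟩ := hE y₁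
    exact ⟨y₂ + y₁, by rw [h₁, a_smul_b_smul, h₂, ← smul_add, pow_two, mul_smul]⟩
  have hba : ∀ x : E, ∃ y : E, b • a • x = b ^ 2 • y := by
    intro x
    obtain ⟨y₁, h₁⟩ := hE x
    exact ⟨y₁, by rw [h₁, pow_two, mul_smul]⟩
  obtain ⟨p, hp⟩ := θ.exists_alpha_eq
  obtain ⟨q, hq⟩ := θ.exists_beta_eq
  obtain ⟨y₁, h₁⟩ := haa x
  obtain ⟨y₂, h₂⟩ := haa (a • p • x)
  obtain ⟨y₃, h₃⟩ := hba x
  obtain ⟨y₄, h₄⟩ := hba (a • q • x)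
  set K := ofB (PowerSeries.C (PowerSeries.coeff 1 θ.series))
  set Z := ofB (PowerSeries.C z)
  set T := ofB (PowerSeries.C (PowerSeries.coeff 2 θ.series))
  set T' := ofB (PowerSeries.C (2 * PowerSeries.coeff 2 θ.series))
  have hα : θ.alpha • x = K • a • x + b ^ 2 • (T • y₁ + y₂) := by
    rw [hp, add_smul, add_smul, smul_smul_eq, smul_smul_eq, mul_smul, mul_smul, mul_smul, mul_smul,
      h₁, h₂, ofB_C_smul_comm _ (b ^ 2), smul_add, add_assoc]
  have hβ : θ.beta • x = K • b • x + b ^ 2 • (T' • y₃ + y₄) := by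
    rw [hq, add_smul, add_smul, smul_smul_eq, smul_smul_eq, mul_smul, mul_smul, mul_smul, mul_smul,
      h₃, h₄, ofB_C_smul_comm _ (b ^ 2), smul_add, add_assoc]
  refine ⟨T • y₁ + y₂ + Z • (T' • y₃ + y₄), ?_⟩
  rw [add_smul, smul_smul_eq, hα, hβ, smul_add Z, ofB_C_smul_comm z K, ofB_C_smul_comm z (b ^ 2),
    add_smul, smul_smul_eq, smul_add K, smul_add (b ^ 2) (T • y₁ + y₂)]
  abel

/-- The same `x` serves as eigenvector: `β²` lies in `b² Â`, and `α + z β` is the nonzero multiple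
`θ'(0)` of `a + z b` modulo `b²`. Unimodularity plays no role. -/
theorem isBernsteinRoot_of_pushforward {z : ℂ} (hE : IsSimplePole E)
    (h : IsBernsteinRootOfSimplePole (θ.Pushforward E) z) : IsBernsteinRootOfSimplePole E z := by
  obtain ⟨x, hx, y, hy⟩ := h
  obtain ⟨x, rfl⟩ := θ.push.surjective x
  obtain ⟨y, rfl⟩ := θ.push.surjective y
  refine ⟨x, fun w hw => hx (θ.push (ofA (PowerSeries.derivative ℂ θ.series)⁻¹ • w)) ?_, ?_⟩
  · rw [b_smul_push, ← b_smul, hw]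
  rw [smul_push, smul_push, map_add, map_pow, Theta_smul, Theta_a, Theta_b] at hy
  have hy := θ.push.injective hy
  obtain ⟨w, hw⟩ := exists_eq_b_pow_mul (van_pow θ.beta_mem 2)
  obtain ⟨y', hy'⟩ := θ.exists_alpha_add_beta_smul_eq hE.2 z x
  refine ⟨ofB (PowerSeries.C (PowerSeries.coeff 1 θ.series)⁻¹) • (w • y - y'), ?_⟩
  rw [← ofB_C_smul_comm, smul_sub (b ^ 2), ← mul_smul _ w, ← hw, ← hy, hy',
    add_sub_cancel_right, ← mul_smul, ← ofB_mul, ← map_mul, inv_mul_cancel₀ θ.coeff_one_ne_zero,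
    map_one, ofB_one, one_smul]

theorem isSaturation_pushforward {G : Type u} [AddCommGroup G] [Module AHat G] {i : E →ₗ[AHat] G}
    (h : IsSaturation i) : IsSaturation (θ.pushMap i) where
  injective := h.injective
  simplePole := θ.isSimplePole_pushforward h.simplePole
  minimal H hH hs := by
    -- `H` is only stable under the operators `Θ(c)`; surjectivity of `Θ` makes it an `Â`-submodule
    -- of `G`.
    let K : Submodule AHat G :=
      { carrier := {x | θ.push x ∈ H}
        add_mem' := fun hx hy => H.add_mem hx hy
        zero_mem' := H.zero_mem
        smul_mem' := fun c x hx => by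
          obtain ⟨c, rfl⟩ := θ.Theta_surjective c
          exact H.smul_mem c hx }
    have hK : K = ⊤ := by
      refine h.minimal K (fun x => hH (θ.push x)) fun x hx => ?_
      obtain ⟨y, hy, h⟩ := hs (θ.push (ofA (shift θ.series)⁻¹ • x))
        (K.smul_mem (ofA (shift θ.series)⁻¹) hx)
      obtain ⟨y, rfl⟩ := θ.push.surjective y
      refine ⟨ofA (PowerSeries.derivative ℂ θ.series) • y, K.smul_mem _ hy, ?_⟩
      rw [a_smul_push, b_smul_push, ← a_smul, beta_smul] at h
      exact θ.push.injective h
    refine eq_top_iff.2 fun x _ => ?_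
    have : θ.push.symm x ∈ K := hK ▸ Submodule.mem_top
    exact this

theorem isRegularWithBernsteinRoots_pushforward {C : ℂ → Prop}
    (h : IsRegularWithBernsteinRoots C E) : IsRegularWithBernsteinRoots C (θ.Pushforward E) := by
  obtain ⟨G, _, _, i, hi, hG⟩ := h
  exact ⟨θ.Pushforward G, _, _, _, θ.isSaturation_pushforward hi,
    fun z hz => hG z (θ.isBernsteinRoot_of_pushforward hi.simplePole hz)⟩

/-- The class of `1` remains a basis. Since `a - λ b` kills it, `α - λ β` sends it into `b² E ⊆ β²
E`, and `nonempty_equiv_rankOne` corrects such an approximate relation to an exact one. -/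
theorem nonempty_pushforward_rankOne_equiv (l : ℚ) :
    Nonempty (θ.Pushforward (RankOne l) ≃ₗ[AHat] RankOne l) := by
  let e : RankOne l := Submodule.Quotient.mk 1
  have he : ∀ x : RankOne l, ∃! c : Fin 1 → ℂ⟦X⟧, x = ∑ i, ofB (c i) • (fun _ => e) i := by
    intro x
    obtain ⟨r, hr⟩ := rankOne_exists l x
    refine ⟨fun _ => r, by simpa using hr, fun d hd => ?_⟩
    funext i
    obtain rfl : i = 0 := Subsingleton.elim _ _
    rw [hr] at hd
    simp only [Fin.isValue, Finset.univ_unique, Fin.default_eq_zero, Finset.sum_singleton] at hd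
    rw [← sub_eq_zero, ← sub_smul, ← ofB_sub, rankOne_mk_eq_zero_iff] at hd
    exact (sub_eq_zero.1 hd).symm
  obtain ⟨hb, hs⟩ := isBasisModB_of_exists_unique he
  have hu := (θ.isBasisModB_pushforward hb).exists_unique (θ.isBSeparated_pushforward hs)
  have hsp : ∀ x : RankOne l, ∃ y : RankOne l, a • x = b • y := by
    intro x
    obtain ⟨r, rfl⟩ := rankOne_exists l x
    have h := linear_smul_ofB_smul (l : ℂ) r e
    rw [rankOne_linear_smul, smul_zero, zero_add, sub_smul, sub_eq_iff_eq_add, ofB_X_sq_mul, pow_two,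
      mul_assoc, mul_smul, smul_smul_eq, ofB_C_smul_comm, ← smul_add] at h
    exact ⟨_, h⟩
  obtain ⟨y, hy⟩ : ∃ y : RankOne l, (θ.alpha - (l : ℂ) • θ.beta) • e = θ.beta ^ 2 • y := by
    obtain ⟨y, hy⟩ := θ.exists_alpha_add_beta_smul_eq hsp (-(l : ℂ)) e
    obtain ⟨y', hy'⟩ := θ.exists_b_sq_smul_eq y
    rw [neg_smul, neg_smul, ← sub_eq_add_neg, ← sub_eq_add_neg, rankOne_linear_smul, smul_zero,
      zero_add, hy'] at hy
    exact ⟨y', hy⟩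
  refine nonempty_equiv_rankOne (e := θ.push e) (y := θ.push y) (fun x => ?_) (fun r hr => ?_) ?_
  · obtain ⟨c, hc, -⟩ := hu x
    exact ⟨c 0, by simpa using hc⟩
  · have := (hu 0).unique (y₁ := fun _ => r) (y₂ := 0) (by simpa using hr.symm)
      (by simp [ofB_zero])
    exact congrFun this 0
  · rw [smul_push, smul_push, map_sub, map_pow, Theta_smul, Theta_a, Theta_b, hy]

/-- A generator of `E` over `Ã` is also a generator of `θ_*(E)`. -/
theorem span_push_eq_top (hE : IsBSeparated E) {N : ℕ} (ha : ∀ x : E, ∃ y : E, a ^ N • x = b • y)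
    {e : E} (he : Submodule.span ATilde {e} = ⊤) : Submodule.span ATilde {θ.push e} = ⊤ := by
  refine eq_top_iff.2 fun x _ => ?_
  obtain ⟨x, rfl⟩ := θ.push.surjective x
  suffices h : ∀ x : E, ∃ (P : ℂ⟦X⟧) (y : E), (True → ofA P ∈ ATilde) ∧
      x = θ.Theta (ofA P) • e + θ.beta • y by
    obtain ⟨u, hu, hx⟩ := θ.exists_Theta_smul_eq hE.sep True e h x
    exact Submodule.mem_span_singleton.2 ⟨⟨u, hu trivial⟩, congrArg θ.push hx.symm⟩
  intro x
  obtain ⟨u, hu⟩ := Submodule.mem_span_singleton.1 (he ▸ Submodule.mem_top : x ∈ _)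
  obtain ⟨w, hw⟩ := exists_eq_ofA_add u.1
  obtain ⟨P, hP⟩ := θ.exists_subst_eq (u.1.coeff 0)
  -- Acting on `e` requires a polynomial in `a`, so `P` is truncated. The discarded part is
  -- divisible by `X^N`, and `θ(a)^N` is a multiple of `a^N`, which maps `E` into `b E`.
  let t : ℂ⟦X⟧ := (PowerSeries.trunc N P : Polynomial ℂ)
  obtain ⟨Q, hQ⟩ : PowerSeries.X ^ N ∣ P - t := by
    rw [PowerSeries.X_pow_dvd_iff]
    intro m hm
    simp [t, PowerSeries.coeff_trunc, hm]
  obtain ⟨y, hy⟩ := ha (ofA (shift θ.series ^ N * Q.subst θ.series) • e)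
  have h1 : θ.Theta (ofA P) • e = θ.Theta (ofA t) • e
      + b • y := by
    have hP' : P = t + PowerSeries.X ^ N * Q := by
      rw [← hQ]; ring
    have : a ^ N = ofA (PowerSeries.X ^ N) := (map_pow ofAHom _ N).symm
    rw [← hy, ← mul_smul, ← add_smul]
    congr 1
    nth_rewrite 1 [hP']
    rw [Theta_ofA, Theta_ofA, PowerSeries.subst_add θ.hasSubst, PowerSeries.subst_mul θ.hasSubst,
      PowerSeries.subst_pow θ.hasSubst, PowerSeries.subst_X θ.hasSubst, this, ← ofA_mul]
    nth_rewrite 2 [θ.series_eq]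
    rw [mul_pow, mul_right_comm, mul_comm]
    exact map_add ofAHom _ _
  refine ⟨t,
    ofA (PowerSeries.derivative ℂ θ.series)⁻¹ • (w • e + y), fun _ n => ?_, ?_⟩
  · rw [coeff_ofA]
    split_ifs
    · exact ⟨_, rfl⟩
    · exact Subring.zero_mem _
  · rw [← b_smul, ← hu, Subalgebra.smul_def, hw, add_smul, ← hP, ← Theta_ofA, h1, smul_add,
      mul_smul]
    abel

/-- The same subspaces form the sequence, and the numbers `λ_j` do not change because `θ_*` fixes
each rank one module. The nilpotency of `a` modulo `b` is needed only for the generator over `Ã`. -/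
theorem hasFundamentalInvariants_pushforward {ord : LinearOrder (AddCircle (1 : ℚ))} {k : ℕ}
    {lam : Fin k → ℚ} {N : ℕ} (ha : ∀ x : E, ∃ y : E, a ^ N • x = b • y) (hE : IsFresco k E)
    {F : Fin (k + 1) → Submodule AHat E} (hF : IsPrincipalJordanHolder ord lam F) :
    IsFresco k (θ.Pushforward E) ∧ IsPrincipalJordanHolder ord lam fun j => θ.pushSub (F j) := by
  refine ⟨⟨θ.isFreeOfRank_pushforward hE.free,
    θ.isRegularWithBernsteinRoots_pushforward hE.geometric, ?_⟩, ?_⟩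
  · obtain ⟨e, he⟩ := hE.monogenic
    exact ⟨θ.push e, θ.span_push_eq_top (isFreeOfRank_iff.1 hE.free).1 ha he⟩
  · refine ⟨?_, ?_, fun i j h => ?_, fun j => ?_, fun j => ?_, fun μ => ?_, hF.principal⟩
    · rw [hF.bot]; rfl
    · rw [hF.top]; rfl
    · exact fun x hx => hF.mono h hx
    · obtain ⟨r, hr⟩ := hF.normal j
      obtain ⟨f⟩ := θ.nonempty_quotient_pushSub_equiv (F j)
      exact ⟨r, (θ.isFreeOfRank_pushforward hr).of_equiv f.symm⟩
    · obtain ⟨f⟩ := θ.nonempty_pushSub_quotient_equiv (F j.castSucc) (F j.succ)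
      obtain ⟨g⟩ := hF.quotient j
      obtain ⟨h⟩ := θ.nonempty_pushforward_rankOne_equiv (lam j)
      exact ⟨(f.trans (θ.pushEquiv g)).trans h⟩
    · obtain ⟨m, h1, h2⟩ := hF.primitive μ
      obtain ⟨f⟩ := θ.nonempty_quotient_pushSub_equiv (F m)
      exact ⟨m, (θ.isRegularWithBernsteinRoots_pushforward h1).of_equiv (θ.pushSubEquiv (F m)),
        (θ.isRegularWithBernsteinRoots_pushforward h2).of_equiv f⟩

end ChangeOfVariable

/-! ### Triangular bases adapted to a Jordan–Hölder sequence -/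

section Steps

variable {E : Type u} [AddCommGroup E] [Module AHat E]

/-- `F ⊆ F'` and the class of `g` is a `ℂ⟦b⟧`-basis of `F' / F`, on which `a` acts as `λ b`. -/
structure IsRankOneStep (c : ℂ) (F F' : Submodule AHat E) (g : E) : Prop where
  le : F ≤ F'
  mem : g ∈ F'
  linear_smul_mem : (a - c • b) • g ∈ F
  span : ∀ x ∈ F', ∃ r, x - ofB r • g ∈ F
  indep : ∀ r, ofB r • g ∈ F → r = 0

theorem exists_isRankOneStep {l : ℚ} {F F' : Submodule AHat E} (hle : F ≤ F')
    (h : Nonempty ((F' ⧸ F.submoduleOf F') ≃ₗ[AHat] RankOne l)) :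
    ∃ g, IsRankOneStep (l : ℂ) F F' g := by
  obtain ⟨f⟩ := h
  obtain ⟨g, hg⟩ := Submodule.mkQ_surjective _ (f.symm (Submodule.Quotient.mk 1))
  have key : ∀ x : F', (x : E) ∈ F ↔ f ((F.submoduleOf F').mkQ x) = 0 := by
    intro x
    rw [map_eq_zero_iff f f.injective, Submodule.mkQ_apply, Submodule.Quotient.mk_eq_zero]
    rfl
  have hfg : ∀ u : AHat, f ((F.submoduleOf F').mkQ (u • g)) =
      u • (Submodule.Quotient.mk 1 : RankOne l) := by
    intro u
    rw [map_smul, map_smul, hg, f.apply_symm_apply]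
  refine ⟨g, hle, g.2, ?_, fun x hx => ?_, fun r hr => ?_⟩
  · exact (key ((a - (l : ℂ) • b) • g)).2 (by rw [hfg, rankOne_linear_smul])
  · obtain ⟨r, hr⟩ := rankOne_exists l (f ((F.submoduleOf F').mkQ ⟨x, hx⟩))
    exact ⟨r, (key (⟨x, hx⟩ - ofB r • g)).2 (by rw [map_sub, map_sub, hfg, hr, sub_self])⟩
  · rw [← rankOne_mk_eq_zero_iff l, ← hfg]
    exact (key (ofB r • g)).1 hr

/-- The elements of `F'` which are divisible by `b` modulo `F`, when `F ⊆ F'` is a rank one step. -/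
theorem IsRankOneStep.smul_mem_of {c : ℂ} {F F' : Submodule AHat E} {g : E}
    (h : IsRankOneStep c F F' g) {x : E} (hx : x ∈ F') {r : ℂ⟦X⟧}
    (hr : x - ofB (PowerSeries.X * r) • g ∈ F) (u : AHat) :
    ∃ s, u • x - ofB (PowerSeries.X * s) • g ∈ F := by
  obtain ⟨z, v, w, rfl⟩ := exists_eq_const_add u
  obtain ⟨r₁, h₁⟩ := h.span _ (F'.smul_mem v hx)
  obtain ⟨r₂, h₂⟩ := h.span _ (F'.smul_mem w hx)
  have e₀ := F.smul_mem (ofB (PowerSeries.C z)) hr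
  have e₁ := F.smul_mem a h₁
  have e₂ := F.smul_mem b h₂
  have e₃ : a • ofB r₁ • g - ofB (PowerSeries.X * (PowerSeries.C c * r₁ +
      PowerSeries.X * PowerSeries.derivative ℂ r₁)) • g ∈ F := by
    have e := linear_smul_ofB_smul c r₁ g
    have e' := F.smul_mem (ofB r₁) h.linear_smul_mem
    rw [eq_sub_of_add_eq e.symm, sub_smul, smul_smul_eq, ← mul_smul b, ← ofB_X, ← mul_smul (ofB (PowerSeries.C c)),
      ← ofB_mul, ← ofB_mul, sub_sub, ← add_smul, ← ofB_add] at e'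
    convert e' using 4
    ring
  refine ⟨PowerSeries.C z * r + (PowerSeries.C c * r₁ +
      PowerSeries.X * PowerSeries.derivative ℂ r₁) + r₂, ?_⟩
  convert F.add_mem (F.add_mem (F.add_mem e₀ e₁) e₃) e₂ using 1
  simp only [smul_sub, ← mul_smul, ← ofB_mul, ← ofB_X, mul_add, ofB_add, add_smul,
    mul_left_comm (PowerSeries.C z)]
  abel

/-- If the class of the generator `x` in `F'/F` were divisible by `b`, so would be all its
multiples, and `g` could not be reached. Its coefficient is thus a unit; dividing by it gives `e`.
The last clause is what allows iteration: `(a - c b) e` generates `F` in the same sense as `x`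
generates `F'`. -/
theorem IsRankOneStep.exists_normalized {c : ℂ} {F F' : Submodule AHat E} {g : E}
    (hg : IsRankOneStep c F F' g) {x : E} (hx : x ∈ F')
    (hgen : ∀ y ∈ F', ∃ u ∈ ATilde, y = u • x) :
    ∃ S e, PowerSeries.constantCoeff S = 1 ∧ x = ofB S • e ∧ IsRankOneStep c F F' e ∧
      ∀ y ∈ F, ∃ u ∈ ATilde, y = u • (a - c • b) • e := by
  obtain ⟨r, hr⟩ := hg.span x hx
  have hr0 : PowerSeries.constantCoeff r ≠ 0 := by
    intro h0
    obtain ⟨u, -, hu⟩ := hgen g hg.mem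
    obtain ⟨r', rfl⟩ := PowerSeries.X_dvd_iff.2 h0
    obtain ⟨s, hs⟩ := hg.smul_mem_of hx hr u
    rw [← hu] at hs
    have h1 := hg.indep (1 - PowerSeries.X * s) (by rwa [ofB_sub, ofB_one, sub_smul, one_smul])
    simpa using congrArg PowerSeries.constantCoeff h1
  set r₀ := PowerSeries.constantCoeff r with hr₀
  have hS : PowerSeries.constantCoeff (PowerSeries.C r₀⁻¹ * r) = 1 := by
    simp [← hr₀, hr0]
  have hS0 : PowerSeries.constantCoeff (PowerSeries.C r₀⁻¹ * r) ≠ 0 := by rw [hS]; exact one_ne_zero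
  set S := PowerSeries.C r₀⁻¹ * r with hSdef
  have hrS : r = PowerSeries.C r₀ * S := by
    rw [hSdef, ← mul_assoc, ← map_mul, mul_inv_cancel₀ hr0, map_one, one_mul]
  -- Only the part of `r` with constant term `1` is divided out; the scalar `r₀` stays in `e`, which
  -- is `r₀ g` modulo `F`.
  set e := ofB S⁻¹ • x with he
  have hxe : x = ofB S • e := by rw [he, ← mul_smul, ofB_mul_inv hS0, one_smul]
  have heg : e - ofB (PowerSeries.C r₀) • g ∈ F := by
    have := F.smul_mem (ofB S⁻¹) hr
    rwa [smul_sub, ← mul_smul, ← ofB_mul, hrS, mul_left_comm, PowerSeries.inv_mul_cancel _ hS0,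
      mul_one] at this
  have hmem : e ∈ F' := F'.smul_mem _ hx
  clear_value e
  have hstep : IsRankOneStep c F F' e := by
    refine ⟨hg.le, hmem, ?_, fun y hy => ?_, fun s hs => ?_⟩
    · have h1 := F.smul_mem (a - c • b) heg
      have h2 := F.smul_mem (ofB (PowerSeries.C r₀)) hg.linear_smul_mem
      rw [smul_sub, ← ofB_C_smul_comm] at h1
      simpa using F.add_mem h1 h2
    · obtain ⟨s, hs⟩ := hg.span y hy
      refine ⟨s * PowerSeries.C r₀⁻¹, ?_⟩
      have h1 := F.smul_mem (ofB (s * PowerSeries.C r₀⁻¹)) heg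
      rw [smul_sub, ← mul_smul, ← ofB_mul, mul_assoc, ← map_mul, inv_mul_cancel₀ hr0, map_one,
        mul_one] at h1
      convert F.sub_mem hs h1 using 1
      abel
    · have h1 := F.sub_mem hs (F.smul_mem (ofB s) heg)
      rw [smul_sub, sub_sub_cancel, ← mul_smul, ← ofB_mul] at h1
      refine (mul_eq_zero.1 (hg.indep _ h1)).resolve_right ?_
      simpa using hr0
  refine ⟨S, e, hS, hxe, hstep, fun y hy => ?_⟩
  obtain ⟨u, hu, rfl⟩ := hgen y (hg.le hy)
  -- From `u S = v (a - c b) + s`, an element `u x` of `F` has `s e ∈ F`, hence `s = 0`.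
  obtain ⟨v, s, hv, h⟩ := exists_division c (u * ofB S)
  refine ⟨v, hv (ATilde.mul_mem hu (ATilde.ofB S).2), ?_⟩
  rw [hxe, ← mul_smul, h, add_smul, mul_smul] at hy ⊢
  have := hstep.indep s (by
    convert F.sub_mem hy (F.smul_mem v hstep.linear_smul_mem) using 1
    abel)
  rw [this, ofB_zero, zero_smul, add_zero]

/-- A `ℂ⟦b⟧`-basis `e₁, e₂, e₃` with `(a - λ₁ b) e₁ = 0`, `(a - λ₂ b) e₂ = S₁ e₁` and
`(a - λ₃ b) e₃ = S₂ e₂`. -/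
structure IsTriangularBasis (l₁ l₂ l₃ : ℂ) (S₁ S₂ : ℂ⟦X⟧) (e₁ e₂ e₃ : E) : Prop where
  constantCoeff_left : PowerSeries.constantCoeff S₁ = 1
  constantCoeff_right : PowerSeries.constantCoeff S₂ = 1
  smul₁ : (a - l₁ • b) • e₁ = 0
  smul₂ : (a - l₂ • b) • e₂ = ofB S₁ • e₁
  smul₃ : (a - l₃ • b) • e₃ = ofB S₂ • e₂
  span : ∀ x : E, ∃ c₁ c₂ c₃, x = ofB c₁ • e₁ + ofB c₂ • e₂ + ofB c₃ • e₃
  indep : ∀ c₁ c₂ c₃, ofB c₁ • e₁ + ofB c₂ • e₂ + ofB c₃ • e₃ = 0 → c₁ = 0 ∧ c₂ = 0 ∧ c₃ = 0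

/-- Normalisation runs from the top down, each `(a - λ_j b) e_j` serving as the generator for the
next step. The unit split off at the top is dropped, since `e₃` may replace the original generator.
The descriptions of `F 1` and `F 2` are kept because the comparison needs elements lying in these
submodules. -/
theorem IsPrincipalJordanHolder.exists_isTriangularBasis {ord : LinearOrder (AddCircle (1 : ℚ))}
    {l₁ l₂ l₃ : ℚ} {F : Fin 4 → Submodule AHat E}
    (hF : IsPrincipalJordanHolder ord ![l₁, l₂, l₃] F)
    (hE : ∃ e : E, Submodule.span ATilde {e} = ⊤) :
    ∃ (S₁ S₂ : ℂ⟦X⟧) (e₁ e₂ e₃ : E), IsTriangularBasis (l₁ : ℂ) l₂ l₃ S₁ S₂ e₁ e₂ e₃ ∧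
      (∀ x, x ∈ F 1 ↔ ∃ c₁, x = ofB c₁ • e₁) ∧
      (∀ x, x ∈ F 2 ↔ ∃ c₁ c₂, x = ofB c₁ • e₁ + ofB c₂ • e₂) := by
  obtain ⟨x, hx⟩ := hE
  obtain ⟨g₁, h₁⟩ := exists_isRankOneStep (hF.mono (Fin.castSucc_le_succ 0)) (hF.quotient 0)
  obtain ⟨g₂, h₂⟩ := exists_isRankOneStep (hF.mono (Fin.castSucc_le_succ 1)) (hF.quotient 1)
  obtain ⟨g₃, h₃⟩ := exists_isRankOneStep (hF.mono (Fin.castSucc_le_succ 2)) (hF.quotient 2)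
  change IsRankOneStep (l₁ : ℂ) (F 0) (F 1) g₁ at h₁
  change IsRankOneStep (l₂ : ℂ) (F 1) (F 2) g₂ at h₂
  change IsRankOneStep (l₃ : ℂ) (F 2) (F 3) g₃ at h₃
  have h0 : F 0 = ⊥ := hF.bot
  have htop : F 3 = ⊤ := hF.top
  obtain ⟨S₃, e₃, -, -, k₃, u₃⟩ := h₃.exists_normalized (x := x) (htop ▸ Submodule.mem_top)
    (fun y _ => by
      obtain ⟨u, hu⟩ := Submodule.mem_span_singleton.1 (hx ▸ Submodule.mem_top : y ∈ _)
      exact ⟨u.1, u.2, hu.symm⟩)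
  obtain ⟨S₂, e₂, hS₂, q₂, k₂, u₂⟩ := h₂.exists_normalized k₃.linear_smul_mem u₃
  obtain ⟨S₁, e₁, hS₁, q₁, k₁, -⟩ := h₁.exists_normalized k₂.linear_smul_mem u₂
  have m₁ : ∀ x, x ∈ F 1 ↔ ∃ c₁, x = ofB c₁ • e₁ := by
    intro x
    constructor
    · intro hx
      obtain ⟨r, hr⟩ := k₁.span x hx
      rw [h0, Submodule.mem_bot, sub_eq_zero] at hr
      exact ⟨r, hr⟩
    · rintro ⟨c, rfl⟩
      exact (F 1).smul_mem _ k₁.mem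
  have m₂ : ∀ x, x ∈ F 2 ↔ ∃ c₁ c₂, x = ofB c₁ • e₁ + ofB c₂ • e₂ := by
    intro x
    constructor
    · intro hx
      obtain ⟨r, hr⟩ := k₂.span x hx
      obtain ⟨s, hs⟩ := (m₁ _).1 hr
      exact ⟨s, r, sub_eq_iff_eq_add.1 hs⟩
    · rintro ⟨c, d, rfl⟩
      exact (F 2).add_mem (k₂.le ((F 1).smul_mem _ k₁.mem)) ((F 2).smul_mem _ k₂.mem)
  refine ⟨S₁, S₂, e₁, e₂, e₃, ⟨hS₁, hS₂, ?_, q₁, q₂, fun x => ?_, fun c₁ c₂ c₃ h => ?_⟩, m₁, m₂⟩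
  · have := k₁.linear_smul_mem
    rwa [h0, Submodule.mem_bot] at this
  · obtain ⟨r, hr⟩ := k₃.span x (htop ▸ Submodule.mem_top)
    obtain ⟨s, t, hs⟩ := (m₂ _).1 hr
    exact ⟨s, t, r, sub_eq_iff_eq_add.1 hs⟩
  · obtain rfl : c₃ = 0 := k₃.indep _ (by
      rw [← neg_eq_of_add_eq_zero_right h]
      exact (F 2).neg_mem ((m₂ _).2 ⟨_, _, rfl⟩))
    rw [ofB_zero, zero_smul, add_zero] at h
    obtain rfl : c₂ = 0 := k₂.indep _ (by
      rw [← neg_eq_of_add_eq_zero_right h]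
      exact (F 1).neg_mem ((m₁ _).2 ⟨_, rfl⟩))
    rw [ofB_zero, zero_smul, add_zero] at h
    exact ⟨k₁.indep _ (by rw [h]; exact Submodule.zero_mem _), rfl, rfl⟩

/-! ### Presentations -/

/-- Divide `u` by `a - λ₃ b`, then the quotient times `S₂` by `a - λ₂ b`, then the next quotient
times `S₁` by `a - λ₁ b`. The three remainders are the coordinates of `u e₃`, so `u` annihilates
`e₃` exactly when it is a multiple of the product. -/
theorem IsTriangularBasis.isPresentation {l₁ l₂ l₃ : ℚ} {S₁ S₂ : ℂ⟦X⟧} {e₁ e₂ e₃ : E}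
    (h : IsTriangularBasis (l₁ : ℂ) l₂ l₃ S₁ S₂ e₁ e₂ e₃) : IsPresentation l₁ l₂ l₃ S₁ S₂ E := by
  have hS₁ : PowerSeries.constantCoeff S₁ ≠ 0 := by rw [h.constantCoeff_left]; exact one_ne_zero
  have hS₂ : PowerSeries.constantCoeff S₂ ≠ 0 := by rw [h.constantCoeff_right]; exact one_ne_zero
  have q₂ : e₂ = ofB S₂⁻¹ • (a - (l₃ : ℂ) • b) • e₃ := by
    rw [h.smul₃, ← mul_smul, ofB_inv_mul hS₂, one_smul]
  have q₁ : e₁ = ofB S₁⁻¹ • (a - (l₂ : ℂ) • b) • e₂ := by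
    rw [h.smul₂, ← mul_smul, ofB_inv_mul hS₁, one_smul]
  refine ⟨h.constantCoeff_left, h.constantCoeff_right, ?_⟩
  let f : ATilde →ₗ[ATilde] E := LinearMap.toSpanSingleton ATilde E e₃
  let A : ℂ → ATilde := fun c => ATilde.a - c • ATilde.b
  have hA : ∀ (c : ℂ) (x : E), A c • x = (a - c • b) • x := fun _ _ => rfl
  have hB : ∀ (S : ℂ⟦X⟧) (x : E), ATilde.ofB S • x = ofB S • x := fun _ _ => rfl
  have hf : Function.Surjective f := fun x => by
    obtain ⟨c₁, c₂, c₃, rfl⟩ := h.span x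
    refine ⟨ATilde.ofB c₁ * (ATilde.ofB S₁⁻¹ * (A l₂ * (ATilde.ofB S₂⁻¹ * A l₃))) +
      ATilde.ofB c₂ * (ATilde.ofB S₂⁻¹ * A l₃) + ATilde.ofB c₃, ?_⟩
    simp only [f, LinearMap.toSpanSingleton_apply, add_smul, mul_smul, hA, hB]
    rw [← q₂, ← q₁]
  have hdiv : ∀ (c : ℂ) (u : ATilde), ∃ v r, u = v * A c + ATilde.ofB r := by
    intro c u
    obtain ⟨v, r, hv, huv⟩ := exists_division c u.1
    exact ⟨⟨v, hv u.2⟩, r, Subtype.ext huv⟩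
  have hinv : ∀ S : ℂ⟦X⟧, PowerSeries.constantCoeff S ≠ 0 →
      ATilde.ofB S * ATilde.ofB S⁻¹ = 1 := fun S hS => Subtype.ext (ofB_mul_inv hS)
  have hk : LinearMap.ker f = Submodule.span ATilde
      {A l₁ * ATilde.ofB S₁⁻¹ * A l₂ * ATilde.ofB S₂⁻¹ * A l₃} := by
    ext u
    rw [LinearMap.mem_ker, LinearMap.toSpanSingleton_apply, Submodule.mem_span_singleton]
    constructor
    · intro hu
      obtain ⟨v₃, r₃, rfl⟩ := hdiv l₃ u
      obtain ⟨v₂, r₂, h₂⟩ := hdiv l₂ (v₃ * ATilde.ofB S₂)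
      obtain ⟨v₁, r₁, h₁⟩ := hdiv l₁ (v₂ * ATilde.ofB S₁)
      have h₂' : v₃ = (v₂ * A l₂ + ATilde.ofB r₂) * ATilde.ofB S₂⁻¹ := by
        rw [← h₂, mul_assoc, hinv S₂ hS₂, mul_one]
      have h₁' : v₂ = (v₁ * A l₁ + ATilde.ofB r₁) * ATilde.ofB S₁⁻¹ := by
        rw [← h₁, mul_assoc, hinv S₁ hS₁, mul_one]
      have h₀ := hu
      rw [h₂', h₁'] at h₀
      simp only [add_smul, mul_smul, hA, hB] at h₀
      rw [← q₂, ← q₁, h.smul₁, smul_zero, zero_add] at h₀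
      obtain ⟨rfl, rfl, rfl⟩ := h.indep _ _ _ h₀
      have z : ATilde.ofB 0 = 0 := Subtype.ext ofB_zero
      refine ⟨v₁, ?_⟩
      rw [h₂', h₁', z, add_zero, add_zero, add_zero, smul_eq_mul]
      simp only [mul_assoc]
    · rintro ⟨v, rfl⟩
      simp only [smul_eq_mul, mul_smul, hA, hB]
      rw [← q₂, ← q₁, h.smul₁, smul_zero]
  exact ⟨((Submodule.quotEquivOfEq _ _ hk).symm.trans (f.quotKerEquivOfSurjective hf)).symm⟩

/-- The class of `1` gives `f₃`, and `f₂`, `f₁` are forced by the relations. No position relative to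
a filtration of `E` is obtained here; that is the task of `coordinates_eq_zero`. -/
theorem IsPresentation.exists_generator {l₁ l₂ l₃ : ℚ} {S₁ S₂ : ℂ⟦X⟧}
    (h : IsPresentation l₁ l₂ l₃ S₁ S₂ E) : ∃ f₁ f₂ f₃ : E, (a - (l₁ : ℂ) • b) • f₁ = 0 ∧
      (a - (l₂ : ℂ) • b) • f₂ = ofB S₁ • f₁ ∧ (a - (l₃ : ℂ) • b) • f₃ = ofB S₂ • f₂ ∧
      ∀ x : E, ∃ u : AHat, x = u • f₃ := by
  have hS₁ : PowerSeries.constantCoeff S₁ ≠ 0 := by rw [h.constantCoeff_left]; exact one_ne_zero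
  have hS₂ : PowerSeries.constantCoeff S₂ ≠ 0 := by rw [h.constantCoeff_right]; exact one_ne_zero
  obtain ⟨φ⟩ := h.iso
  set f₃ : E := φ.symm (Submodule.Quotient.mk 1) with hf₃
  have hφ : ∀ u : ATilde, u • f₃ = φ.symm (Submodule.Quotient.mk u) := by
    intro u
    rw [hf₃, ← map_smul, ← Submodule.Quotient.mk_smul, smul_eq_mul, mul_one]
  refine ⟨ofB S₁⁻¹ • (a - (l₂ : ℂ) • b) • ofB S₂⁻¹ • (a - (l₃ : ℂ) • b) • f₃,
    ofB S₂⁻¹ • (a - (l₃ : ℂ) • b) • f₃, f₃, ?_, ?_, ?_, fun x => ?_⟩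
  · have := hφ ((ATilde.a - (l₁ : ℂ) • ATilde.b) * ATilde.ofB S₁⁻¹ *
      (ATilde.a - (l₂ : ℂ) • ATilde.b) * ATilde.ofB S₂⁻¹ * (ATilde.a - (l₃ : ℂ) • ATilde.b))
    rw [(Submodule.Quotient.mk_eq_zero _).2 (Submodule.mem_span_singleton_self _), map_zero] at this
    simp only [mul_smul] at this
    exact this
  · rw [← mul_smul (ofB S₁), ofB_mul_inv hS₁, one_smul]
  · rw [← mul_smul (ofB S₂), ofB_mul_inv hS₂, one_smul]
  · obtain ⟨u, hu⟩ := Submodule.Quotient.mk_surjective _ (φ x)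
    refine ⟨u.1, ?_⟩
    rw [show u.1 • f₃ = u • f₃ from rfl, hφ, hu, φ.symm_apply_apply]

end Steps

/-! ### The action of `a` in triangular coordinates -/

section Coordinates

variable {E : Type u} [AddCommGroup E] [Module AHat E]

/-- `p` is `ℂ⟦b⟧`-linear. -/
def IsBLinear (p : E →+ ℂ⟦X⟧) : Prop := ∀ r x, p (ofB r • x) = r * p x

theorem IsBLinear.b_smul {p : E →+ ℂ⟦X⟧} (hp : IsBLinear p) (x : E) :
    p (b • x) = PowerSeries.X * p x := by
  rw [← ofB_X, hp]

theorem IsBLinear.smul_smul {p : E →+ ℂ⟦X⟧} (hp : IsBLinear p) (c : ℂ) (u : AHat) (x : E) :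
    p ((c • u) • x) = PowerSeries.C c * p (u • x) := by
  rw [smul_smul_eq, hp]

/-- The action of `a` on the coordinates of a triangular module: on `F`, the coordinate `q` of
weight `l` receives the contribution `S p` of the coordinate `p`. -/
def IsCoordinate (F : Submodule AHat E) (l : ℂ) (S : ℂ⟦X⟧) (p q : E →+ ℂ⟦X⟧) : Prop :=
  ∀ x ∈ F, q (a • x) = PowerSeries.C l * (PowerSeries.X * q x) +
    PowerSeries.X ^ 2 * PowerSeries.derivative ℂ (q x) + S * p x

/-- Uniqueness of coordinates makes them additive and `ℂ⟦b⟧`-linear. Moving `a` past a coefficient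
`r` produces `b² r'`, hence the Euler operator, while the triangular relations give the shift. -/
theorem IsTriangularBasis.exists_coordinates {l₁ l₂ l₃ : ℂ} {S₁ S₂ : ℂ⟦X⟧} {e₁ e₂ e₃ : E}
    (h : IsTriangularBasis l₁ l₂ l₃ S₁ S₂ e₁ e₂ e₃) : ∃ c₁ c₂ c₃ : E →+ ℂ⟦X⟧,
      (IsBLinear c₁ ∧ IsBLinear c₂ ∧ IsBLinear c₃) ∧
      (IsCoordinate ⊤ l₁ S₁ c₂ c₁ ∧ IsCoordinate ⊤ l₂ S₂ c₃ c₂ ∧ IsCoordinate ⊤ l₃ 0 0 c₃) ∧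
      (∀ d₁ d₂ d₃, c₁ (ofB d₁ • e₁ + ofB d₂ • e₂ + ofB d₃ • e₃) = d₁ ∧
        c₂ (ofB d₁ • e₁ + ofB d₂ • e₂ + ofB d₃ • e₃) = d₂ ∧
        c₃ (ofB d₁ • e₁ + ofB d₂ • e₂ + ofB d₃ • e₃) = d₃) := by
  choose c₁ c₂ c₃ hc using h.span
  have hu : ∀ x d₁ d₂ d₃, x = ofB d₁ • e₁ + ofB d₂ • e₂ + ofB d₃ • e₃ →
      c₁ x = d₁ ∧ c₂ x = d₂ ∧ c₃ x = d₃ := by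
    intro x d₁ d₂ d₃ hx
    have := h.indep (c₁ x - d₁) (c₂ x - d₂) (c₃ x - d₃) (by
      have e := sub_eq_zero.2 ((hc x).symm.trans hx)
      rw [← e]
      simp only [ofB_sub, sub_smul]
      abel)
    simpa only [sub_eq_zero] using this
  have hadd : ∀ x y, c₁ (x + y) = c₁ x + c₁ y ∧ c₂ (x + y) = c₂ x + c₂ y ∧
      c₃ (x + y) = c₃ x + c₃ y := by
    intro x y
    refine hu _ _ _ _ ?_
    nth_rewrite 1 [hc x, hc y]
    simp only [ofB_add, add_smul]
    abel
  have hB : ∀ r x, c₁ (ofB r • x) = r * c₁ x ∧ c₂ (ofB r • x) = r * c₂ x ∧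
      c₃ (ofB r • x) = r * c₃ x := by
    intro r x
    refine hu _ _ _ _ ?_
    nth_rewrite 1 [hc x]
    simp only [ofB_mul, mul_smul, smul_add]
  have ha : ∀ x, c₁ (a • x) = PowerSeries.C l₁ * (PowerSeries.X * c₁ x) +
      PowerSeries.X ^ 2 * PowerSeries.derivative ℂ (c₁ x) + S₁ * c₂ x ∧
      c₂ (a • x) = PowerSeries.C l₂ * (PowerSeries.X * c₂ x) +
      PowerSeries.X ^ 2 * PowerSeries.derivative ℂ (c₂ x) + S₂ * c₃ x ∧
      c₃ (a • x) = PowerSeries.C l₃ * (PowerSeries.X * c₃ x) +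
      PowerSeries.X ^ 2 * PowerSeries.derivative ℂ (c₃ x) := by
    intro x
    refine hu _ _ _ _ ?_
    have key : ∀ (l : ℂ) (r : ℂ⟦X⟧) (e : E), a • ofB r • e =
        ofB (PowerSeries.C l * (PowerSeries.X * r)) • e + ofB r • (a - l • b) • e +
        ofB (PowerSeries.X ^ 2 * PowerSeries.derivative ℂ r) • e := by
      intro l r e
      have := linear_smul_ofB_smul l r e
      rw [sub_smul, sub_eq_iff_eq_add, smul_smul_eq, ← mul_smul b,
        show b * ofB r = ofB (PowerSeries.X * r) by rw [ofB_mul, ofB_X],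
        ← mul_smul (ofB (PowerSeries.C l)), ← ofB_mul] at this
      rw [this]
      abel
    nth_rewrite 1 [hc x]
    rw [smul_add, smul_add, key l₁, key l₂, key l₃, h.smul₁, h.smul₂, h.smul₃, smul_zero,
      ← mul_smul _ (ofB S₁), ← mul_smul _ (ofB S₂), ← ofB_mul, ← ofB_mul, mul_comm _ S₁,
      mul_comm _ S₂]
    simp only [ofB_add, add_smul]
    abel
  refine ⟨AddMonoidHom.mk' c₁ fun x y => (hadd x y).1, AddMonoidHom.mk' c₂ fun x y => (hadd x y).2.1,
    AddMonoidHom.mk' c₃ fun x y => (hadd x y).2.2, ⟨fun r x => (hB r x).1, fun r x => (hB r x).2.1,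
    fun r x => (hB r x).2.2⟩, ⟨fun x _ => (ha x).1, fun x _ => (ha x).2.1, fun x _ => ?_⟩,
    fun d₁ d₂ d₃ => hu _ _ _ _ rfl⟩
  rw [zero_mul, add_zero]
  exact (ha x).2.2

/-! ### Low order coefficients and the comparison of first order terms -/

section Coefficients

open PowerSeries (coeff constantCoeff C)

variable {F : Submodule AHat E} {l l' l'' : ℂ} {S S' : ℂ⟦X⟧} {p q m : E →+ ℂ⟦X⟧}

theorem IsBLinear.coeff_zero_b_smul (hp : IsBLinear p) (x : E) : coeff 0 (p (b • x)) = 0 := by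
  rw [hp.b_smul]; simp

theorem IsBLinear.coeff_succ_b_smul (hp : IsBLinear p) (x : E) (n : ℕ) :
    coeff (n + 1) (p (b • x)) = coeff n (p x) := by
  rw [hp.b_smul, PowerSeries.coeff_succ_X_mul]

theorem IsCoordinate.coeff_zero_a_smul (hq : IsCoordinate F l S p q) {x : E} (hx : x ∈ F) :
    coeff 0 (q (a • x)) = coeff 0 S * coeff 0 (p x) := by
  rw [hq x hx]; simp

theorem IsCoordinate.coeff_one_a_smul (hq : IsCoordinate F l S p q) {x : E} (hx : x ∈ F) :
    coeff 1 (q (a • x)) = l * coeff 0 (q x) + coeff 0 S * coeff 1 (p x) +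
      coeff 1 S * coeff 0 (p x) := by
  rw [hq x hx, map_add, map_add, PowerSeries.coeff_C_mul, PowerSeries.coeff_X_pow_mul',
    PowerSeries.coeff_succ_X_mul, PowerSeries.coeff_mul, Finset.Nat.sum_antidiagonal_succ]
  simp; ring

theorem IsCoordinate.coeff_two_a_smul (hq : IsCoordinate F l 0 p q) {x : E} (hx : x ∈ F) :
    coeff 2 (q (a • x)) = (l + 1) * coeff 1 (q x) := by
  rw [hq x hx, zero_mul, add_zero, map_add, PowerSeries.coeff_C_mul,
    PowerSeries.coeff_succ_X_mul, PowerSeries.coeff_X_pow_mul', if_pos le_rfl, Nat.sub_self,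
    PowerSeries.coeff_derivative]
  push_cast; ring

variable {α β z w : AHat} {τ : ℂ} {f : E}

/-- In degree two `a` has factor `l + 1` against `l` for `l β`, leaving the degree one coefficient.
The quadratic terms give `τ (l (l + 1) - 2 l²)`, and the cubic ones have order at least three. -/
theorem coeff_two_linear_smul (hp : IsBLinear p) (hpa : IsCoordinate F l 0 0 p)
    (hα : α = a + τ • (a * a) + a * (a * (a * z)))
    (hβ : β = b + (2 * τ) • (b * a) + b * (a * (a * w))) (hf : f ∈ F) :
    coeff 2 (p ((α - l • β) • f)) =
      coeff 1 (p f) + τ * (l - l ^ 2) * coeff 0 (p f) := by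
  have h0 := fun x (hx : x ∈ F) => hpa.coeff_zero_a_smul hx
  have h1 := fun x (hx : x ∈ F) => hpa.coeff_one_a_smul hx
  have h2 := fun x (hx : x ∈ F) => hpa.coeff_two_a_smul hx
  have hF₁ := fun u => F.smul_mem u hf
  have hF₂ := fun u v => F.smul_mem u (hF₁ v)
  have hF₃ := fun u v w => F.smul_mem u (hF₂ v w)
  rw [sub_smul, map_sub, hp.smul_smul, hα, hβ]
  simp only [add_smul, mul_smul, map_add, map_sub, hp.smul_smul, PowerSeries.coeff_C_mul,
    hp.coeff_succ_b_smul _ 1, h0, h1, h2, AddMonoidHom.zero_apply, hF₁, hF₂, hF₃, hf, map_zero, mul_zero, add_zero]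
  ring

/-- The `τ`-terms are `l' + l` from `a²` and `-2 l` from `l β`, whence the factor `l' - l`. The
order zero coefficient of `q` carries the same factor because `q` has weight `l'` and not `l`. -/
theorem coeff_one_linear_smul (hpa : IsCoordinate F l 0 0 p)
    (hq : IsBLinear q) (hqa : IsCoordinate F l' S p q) (hS : constantCoeff S = 1)
    (hα : α = a + τ • (a * a) + a * (a * (a * z)))
    (hβ : β = b + (2 * τ) • (b * a) + b * (a * (a * w))) (hf : f ∈ F) :
    coeff 1 (q ((α - l • β) • f)) = coeff 1 (p f) + coeff 1 S * coeff 0 (p f) +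
      (l' - l) * (coeff 0 (q f) + τ * coeff 0 (p f)) := by
  have h0 := fun x (hx : x ∈ F) => hpa.coeff_zero_a_smul hx
  have h1 := fun x (hx : x ∈ F) => hpa.coeff_one_a_smul hx
  have g0 := fun x (hx : x ∈ F) => hqa.coeff_zero_a_smul hx
  have g1 := fun x (hx : x ∈ F) => hqa.coeff_one_a_smul hx
  have hF₁ := fun u => F.smul_mem u hf
  have hF₂ := fun u v => F.smul_mem u (hF₁ v)
  have hF₃ := fun u v w => F.smul_mem u (hF₂ v w)
  have hS' : coeff 0 S = 1 := by simpa using hS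
  rw [sub_smul, map_sub, hq.smul_smul, hα, hβ]
  simp only [add_smul, mul_smul, map_add, map_sub, hq.smul_smul, PowerSeries.coeff_C_mul,
    hq.coeff_succ_b_smul _ 0, h0, h1, g0, g1, AddMonoidHom.zero_apply, hF₁, hF₂, hF₃, hf, hS', map_zero, mul_zero, add_zero]
  ring

theorem coeff_zero_linear_smul (hpa : IsCoordinate F l 0 0 p)
    (hq : IsBLinear q) (hqa : IsCoordinate F l' S p q) (hS : constantCoeff S = 1)
    (hα : α = a + τ • (a * a) + a * (a * (a * z)))
    (hβ : β = b + (2 * τ) • (b * a) + b * (a * (a * w))) (hf : f ∈ F) :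
    coeff 0 (q ((α - l • β) • f)) = coeff 0 (p f) := by
  have h0 := fun x (hx : x ∈ F) => hpa.coeff_zero_a_smul hx
  have g0 := fun x (hx : x ∈ F) => hqa.coeff_zero_a_smul hx
  have hF₁ := fun u => F.smul_mem u hf
  have hF₂ := fun u v => F.smul_mem u (hF₁ v)
  have hF₃ := fun u v w => F.smul_mem u (hF₂ v w)
  have hS' : coeff 0 S = 1 := by simpa using hS
  rw [sub_smul, map_sub, hq.smul_smul, hα, hβ]
  simp only [add_smul, mul_smul, map_add, map_sub, hq.smul_smul, PowerSeries.coeff_C_mul,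
    hq.coeff_zero_b_smul, h0, g0, AddMonoidHom.zero_apply, hF₁, hF₂, hF₃, hf, hS', map_zero, mul_zero, add_zero]
  ring

/-- The term `τ a²` descends two steps of the triangle at once, from `p` through `q` to `m`, without
gaining a power of `b`. -/
theorem coeff_zero_linear_smul_of_coordinate (hpa : IsCoordinate F l 0 0 p)
    (hqa : IsCoordinate F l' S p q) (hS : constantCoeff S = 1)
    (hm : IsBLinear m) (hma : IsCoordinate F l'' S' q m) (hS' : constantCoeff S' = 1)
    (hα : α = a + τ • (a * a) + a * (a * (a * z)))
    (hβ : β = b + (2 * τ) • (b * a) + b * (a * (a * w))) (hf : f ∈ F) :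
    coeff 0 (m ((α - l • β) • f)) = coeff 0 (q f) + τ * coeff 0 (p f) := by
  have h0 := fun x (hx : x ∈ F) => hpa.coeff_zero_a_smul hx
  have g0 := fun x (hx : x ∈ F) => hqa.coeff_zero_a_smul hx
  have m0 := fun x (hx : x ∈ F) => hma.coeff_zero_a_smul hx
  have hF₁ := fun u => F.smul_mem u hf
  have hF₂ := fun u v => F.smul_mem u (hF₁ v)
  have hF₃ := fun u v w => F.smul_mem u (hF₂ v w)
  have hS₀ : coeff 0 S = 1 := by simpa using hS
  have hS₀' : coeff 0 S' = 1 := by simpa using hS'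
  rw [sub_smul, map_sub, hm.smul_smul, hα, hβ]
  simp only [add_smul, mul_smul, map_add, map_sub, hm.smul_smul, PowerSeries.coeff_C_mul,
    hm.coeff_zero_b_smul, h0, g0, m0, AddMonoidHom.zero_apply, hF₁, hF₂, hF₃, hf, hS₀, hS₀', map_zero, mul_zero, add_zero]
  ring

theorem coeff_zero_expansion (hp : IsBLinear p) {t : ℂ} {y : E}
    (hβ : β = b + (2 * τ) • (b * a) + b * (a * (a * w))) :
    coeff 0 (p (f + (t • β) • f + b ^ 2 • y)) = coeff 0 (p f) := by
  rw [hβ, pow_two]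
  simp only [add_smul, mul_smul, map_add, hp.smul_smul, PowerSeries.coeff_C_mul,
    hp.coeff_zero_b_smul, mul_zero, add_zero]

theorem coeff_one_expansion (hp : IsBLinear p) (hpa : IsCoordinate F l 0 0 p) {t : ℂ} {y : E}
    (hβ : β = b + (2 * τ) • (b * a) + b * (a * (a * w))) (hf : f ∈ F) :
    coeff 1 (p (f + (t • β) • f + b ^ 2 • y)) = coeff 1 (p f) + t * coeff 0 (p f) := by
  have h0 := fun x (hx : x ∈ F) => hpa.coeff_zero_a_smul hx
  have hF₁ := fun u => F.smul_mem u hf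
  have hF₂ := fun u v => F.smul_mem u (hF₁ v)
  rw [hβ, pow_two]
  simp only [add_smul, mul_smul, map_add, hp.smul_smul, PowerSeries.coeff_C_mul,
    hp.coeff_succ_b_smul _ 0, hp.coeff_zero_b_smul, h0, AddMonoidHom.zero_apply, hF₂, hf, map_zero, mul_zero, add_zero]

/-- The coefficient of `e₃` modulo `b` is multiplicative, so that a generator has a unit there. -/
theorem coeff_zero_ne_zero_of_generator (hp : IsBLinear p) (hpa : IsCoordinate ⊤ l 0 0 p) {e : E}
    (he : p e = 1) (hf : ∀ x : E, ∃ u : AHat, x = u • f) : coeff 0 (p f) ≠ 0 := by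
  intro h0
  obtain ⟨u, hu⟩ := hf e
  obtain ⟨c, v, w, rfl⟩ := exists_eq_const_add u
  have := congrArg (PowerSeries.coeff 0) he
  rw [hu, add_smul, add_smul, mul_smul, mul_smul, map_add, map_add, map_add, map_add,
    hp.coeff_zero_b_smul, hpa.coeff_zero_a_smul Submodule.mem_top, hp, PowerSeries.coeff_C_mul,
    h0] at this
  simp at this

variable {l₁ l₂ l₃ : ℂ} {S₁ S₂ : ℂ⟦X⟧} {c₁ c₂ c₃ : E →+ ℂ⟦X⟧} {F₁ F₂ : Submodule AHat E}

/-- Comparison of the first order terms of `S₁, S₂` in two triangular presentations, for the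
actions of `(a, b)` and of `(α, β)`. -/
theorem linear_invariant_comparison
    (h₁ : IsBLinear c₁) (h₂ : IsBLinear c₂) (h₃ : IsBLinear c₃)
    (k₁ : IsCoordinate ⊤ l₁ S₁ c₂ c₁) (k₂ : IsCoordinate ⊤ l₂ S₂ c₃ c₂)
    (k₃ : IsCoordinate ⊤ l₃ 0 0 c₃)
    (hS₁ : constantCoeff S₁ = 1) (hS₂ : constantCoeff S₂ = 1)
    (hF₂ : ∀ x ∈ F₂, c₃ x = 0) (hF₁ : ∀ x ∈ F₁, c₂ x = 0)
    (hα : α = a + τ • (a * a) + a * (a * (a * z)))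
    (hβ : β = b + (2 * τ) • (b * a) + b * (a * (a * w)))
    {f₁ f₂ f₃ y₁ y₂ : E} {t₁ t₂ : ℂ} (m₁ : f₁ ∈ F₁) (m₂ : f₂ ∈ F₂) (n₁ : y₁ ∈ F₁) (n₂ : y₂ ∈ F₂)
    (r₁ : (α - l₁ • β) • f₁ = 0)
    (r₂ : (α - l₂ • β) • f₂ = f₁ + (t₁ • β) • f₁ + b ^ 2 • y₁)
    (r₃ : (α - l₃ • β) • f₃ = f₂ + (t₂ • β) • f₂ + b ^ 2 • y₂) (h0 : coeff 0 (c₃ f₃) ≠ 0) :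
    (l₃ - l₂) * t₁ - (l₂ - l₁) * t₂ = (l₃ - l₂) * coeff 1 S₁ - (l₂ - l₁) * coeff 1 S₂ -
      (l₂ - l₁) * (l₃ - l₂) * (l₃ - l₁ + 1) * τ := by
  -- On `F₂` and `F₁` the coordinate above vanishes, so `c₂` and `c₁` become coordinates without
  -- incoming shift there.
  have k₂' : IsCoordinate F₂ l₂ 0 0 c₂ := fun x hx => by
    rw [k₂ x Submodule.mem_top, hF₂ x hx, mul_zero, zero_mul]
  have k₁' : IsCoordinate F₂ l₁ S₁ c₂ c₁ := fun x _ => k₁ x Submodule.mem_top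
  have k₁'' : IsCoordinate F₁ l₁ 0 0 c₁ := fun x hx => by
    rw [k₁ x Submodule.mem_top, hF₁ x hx, mul_zero, zero_mul]
  have mem₁ : f₁ + (t₁ • β) • f₁ + b ^ 2 • y₁ ∈ F₁ :=
    F₁.add_mem (F₁.add_mem m₁ (F₁.smul_mem _ m₁)) (F₁.smul_mem _ n₁)
  have mem₂ : f₂ + (t₂ • β) • f₂ + b ^ 2 • y₂ ∈ F₂ :=
    F₂.add_mem (F₂.add_mem m₂ (F₂.smul_mem _ m₂)) (F₂.smul_mem _ n₂)
  have mt : f₃ ∈ (⊤ : Submodule AHat E) := Submodule.mem_top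
  have q₁ := coeff_two_linear_smul h₃ k₃ hα hβ mt
  have q₂ := coeff_two_linear_smul h₂ k₂' hα hβ m₂
  have q₃ := coeff_two_linear_smul h₁ k₁'' hα hβ m₁
  have q₄ := coeff_one_linear_smul k₃ h₂ k₂ hS₂ hα hβ mt
  have q₅ := coeff_one_linear_smul k₂' h₁ k₁' hS₁ hα hβ m₂
  have q₆ := coeff_zero_linear_smul k₃ h₂ k₂ hS₂ hα hβ mt
  have q₇ := coeff_zero_linear_smul k₂' h₁ k₁' hS₁ hα hβ m₂
  have q₈ := coeff_zero_linear_smul_of_coordinate k₃ k₂ hS₂ h₁ k₁ hS₁ hα hβ mt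
  rw [r₃, hF₂ _ mem₂, map_zero] at q₁
  rw [r₂, hF₁ _ mem₁, map_zero] at q₂
  rw [r₁, map_zero, map_zero] at q₃
  rw [r₃, coeff_one_expansion h₂ k₂' hβ m₂] at q₄
  rw [r₂, coeff_one_expansion h₁ k₁'' hβ m₁] at q₅
  rw [r₃, coeff_zero_expansion h₂ hβ] at q₆
  rw [r₂, coeff_zero_expansion h₁ hβ] at q₇
  rw [r₃, coeff_zero_expansion h₁ hβ] at q₈
  rw [q₇, q₆] at q₃ q₅
  rw [q₆] at q₂ q₄
  rw [q₈] at q₅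
  refine mul_left_cancel₀ h0 ?_
  -- The number `coeff 0 (c₂ f₃)` enters `q₅` with factor `l₁ - l₂` and `q₄` with factor `l₂ - l₃`;
  -- the weights on `q₅` and `q₄` cancel it. The equations `q₁`, `q₂`, `q₃` then eliminate the
  -- degree one coefficients of the diagonal coordinates.
  linear_combination (l₃ - l₂) * q₅ - (l₂ - l₁) * q₄ + (l₂ - l₁) * q₁ - (l₃ - l₁) * q₂ + (l₃ - l₂) * q₃

end Coefficients

end Coordinates

/-! ### Resonances, uniqueness of `γ`, and its change under `θ` -/

section Invariant

open PowerSeries (constantCoeff C)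

variable {E : Type u} [AddCommGroup E] [Module AHat E]

/-- After division by `X`, the equation reads `(n + μ) y_n = 0` in each degree; the degrees below
`k` vanish by divisibility. -/
theorem eq_zero_of_euler {Y : ℂ⟦X⟧} {μ : ℂ} {k : ℕ} (hY : PowerSeries.X ^ k ∣ Y)
    (hμ : ∀ n : ℕ, k ≤ n → (n : ℂ) + μ ≠ 0)
    (h : C μ * (PowerSeries.X * Y) + PowerSeries.X ^ 2 * PowerSeries.derivative ℂ Y = 0) :
    Y = 0 := by
  have h' : C μ * Y + PowerSeries.X * PowerSeries.derivative ℂ Y = 0 := by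
    refine (mul_eq_zero.1 (?_ : PowerSeries.X * _ = 0)).resolve_left PowerSeries.X_ne_zero
    rw [← h]; ring
  ext n
  rw [map_zero]
  by_cases hn : k ≤ n
  · have := congrArg (PowerSeries.coeff n) h'
    rw [map_add, PowerSeries.coeff_C_mul, map_zero] at this
    refine (mul_eq_zero.1 (?_ : ((n : ℂ) + μ) * _ = 0)).resolve_left (hμ n hn)
    rw [← this]
    cases n with
    | zero => simp
    | succ n =>
      rw [PowerSeries.coeff_succ_X_mul, PowerSeries.coeff_derivative]
      push_cast; ring
  · exact PowerSeries.X_pow_dvd_iff.1 hY n (by omega)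

theorem IsCoordinate.linear_smul {l l' : ℂ} {S : ℂ⟦X⟧} {p q : E →+ ℂ⟦X⟧} (hq : IsBLinear q)
    (h : IsCoordinate ⊤ l S p q) (x : E) : q ((a - l' • b) • x) =
      C (l - l') * (PowerSeries.X * q x) + PowerSeries.X ^ 2 * PowerSeries.derivative ℂ (q x) +
        S * p x := by
  rw [sub_smul, map_sub, hq.smul_smul, hq.b_smul, h x Submodule.mem_top, map_sub]
  ring

theorem dvd_of_mul_eq {T f g : ℂ⟦X⟧} {k : ℕ} (hT : constantCoeff T = 1) (h : T * f = g)
    (hg : PowerSeries.X ^ k ∣ g) : PowerSeries.X ^ k ∣ f := by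
  have hT0 : constantCoeff T ≠ 0 := by rw [hT]; exact one_ne_zero
  have : f = T⁻¹ * g := by rw [← h, ← mul_assoc, PowerSeries.inv_mul_cancel _ hT0, one_mul]
  rw [this]
  exact Dvd.dvd.mul_left hg _

/-- Under the principality conditions every triangular system is compatible with the coordinates. -/
theorem coordinates_eq_zero {l₁ l₂ l₃ : ℂ} {S₂ T₁ T₂ : ℂ⟦X⟧} {c₂ c₃ : E →+ ℂ⟦X⟧}
    (h₂ : IsBLinear c₂) (h₃ : IsBLinear c₃)
    (k₂ : IsCoordinate ⊤ l₂ S₂ c₃ c₂) (k₃ : IsCoordinate ⊤ l₃ 0 0 c₃)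
    (hT₁ : constantCoeff T₁ = 1) (hT₂ : constantCoeff T₂ = 1)
    (h₁₂ : ∀ n : ℕ, 2 ≤ n → (n : ℂ) + (l₂ - l₁) ≠ 0)
    (h₂₃ : ∀ n : ℕ, 2 ≤ n → (n : ℂ) + (l₃ - l₂) ≠ 0)
    (h₁₃ : ∀ n : ℕ, 3 ≤ n → (n : ℂ) + (l₃ - l₁) ≠ 0) {f₁ f₂ f₃ : E}
    (r₁ : (a - l₁ • b) • f₁ = 0) (r₂ : (a - l₂ • b) • f₂ = ofB T₁ • f₁)
    (r₃ : (a - l₃ • b) • f₃ = ofB T₂ • f₂) : c₃ f₂ = 0 ∧ c₃ f₁ = 0 ∧ c₂ f₁ = 0 := by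
  have e₃ := k₃.linear_smul (l' := l₃) h₃ f₃
  have e₂ := k₃.linear_smul (l' := l₂) h₃ f₂
  have e₁ := k₃.linear_smul (l' := l₁) h₃ f₁
  rw [r₃, h₃, sub_self, map_zero, zero_mul, zero_mul, zero_add, add_zero] at e₃
  rw [r₂, h₃, zero_mul, add_zero] at e₂
  rw [r₁, map_zero, zero_mul, add_zero] at e₁
  -- The third coordinate gains order on the way down: `T₂ c₃(f₂) = b² c₃(f₃)'` has order at least
  -- two, and the next relation raises this to three for `f₁`.
  have d₂ : PowerSeries.X ^ 2 ∣ c₃ f₂ := dvd_of_mul_eq hT₂ e₃ (dvd_mul_right _ _)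
  have d₁ : PowerSeries.X ^ 3 ∣ c₃ f₁ := by
    refine dvd_of_mul_eq hT₁ e₂ ?_
    obtain ⟨k, hk⟩ := d₂
    refine ⟨C (l₃ - l₂) * k + 2 * k + PowerSeries.X * PowerSeries.derivative ℂ k, ?_⟩
    rw [hk, Derivation.leibniz, Derivation.leibniz_pow, PowerSeries.derivative_X]
    simp only [smul_eq_mul, nsmul_eq_mul]
    push_cast
    ring
  -- Only the equation of `f₁` is homogeneous at first. Its solution `c₃ f₁ = 0` makes that of `c₃
  -- f₂` homogeneous, and both together leave `c₂ f₁` with an Euler equation.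
  have z₁ : c₃ f₁ = 0 := eq_zero_of_euler d₁ h₁₃ e₁.symm
  have z₂ : c₃ f₂ = 0 := by
    rw [z₁, mul_zero] at e₂
    exact eq_zero_of_euler d₂ h₂₃ e₂.symm
  have e₂' := k₂.linear_smul (l' := l₂) h₂ f₂
  have e₁' := k₂.linear_smul (l' := l₁) h₂ f₁
  rw [r₂, h₂, sub_self, map_zero, zero_mul, zero_add, z₂, mul_zero, add_zero] at e₂'
  rw [r₁, map_zero, z₁, mul_zero, add_zero] at e₁'
  exact ⟨z₂, z₁, eq_zero_of_euler (dvd_of_mul_eq hT₁ e₂' (dvd_mul_right _ _)) h₁₂ e₁'.symm⟩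

theorem ofB_eq_expansion {T : ℂ⟦X⟧} (hT : constantCoeff T = 1) :
    ofB T = 1 + PowerSeries.coeff 1 T • b + b ^ 2 * ofB (shift (shift T)) := by
  rw [ofB_C_add_X_mul T, ofB_C_add_X_mul (shift T), hT, map_one, ofB_one, mul_add, mul_ofB_C,
    pow_two, mul_assoc, add_assoc]
  simp [shift]

theorem IsTriangularBasis.exists_smul_eq {l₁ l₂ l₃ : ℂ} {S₁ S₂ : ℂ⟦X⟧} {e₁ e₂ e₃ : E}
    (h : IsTriangularBasis l₁ l₂ l₃ S₁ S₂ e₁ e₂ e₃) (x : E) : ∃ u : AHat, x = u • e₃ := by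
  have hS₁ : constantCoeff S₁ ≠ 0 := by rw [h.constantCoeff_left]; exact one_ne_zero
  have hS₂ : constantCoeff S₂ ≠ 0 := by rw [h.constantCoeff_right]; exact one_ne_zero
  have q₂ : e₂ = (ofB S₂⁻¹ * (a - l₃ • b)) • e₃ := by
    rw [mul_smul, h.smul₃, ← mul_smul, ofB_inv_mul hS₂, one_smul]
  have q₁ : e₁ = (ofB S₁⁻¹ * (a - l₂ • b)) • e₂ := by
    rw [mul_smul, h.smul₂, ← mul_smul, ofB_inv_mul hS₁, one_smul]
  obtain ⟨d₁, d₂, d₃, rfl⟩ := h.span x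
  rw [q₁, q₂, ← mul_smul, ← mul_smul, ← mul_smul, ← add_smul, ← add_smul]
  exact ⟨_, rfl⟩

theorem gammaValue_eq (l₁ l₂ l₃ : ℚ) (S₁ S₂ : ℂ⟦X⟧) : gammaValue l₁ l₂ l₃ S₁ S₂ =
    ((l₃ : ℂ) - l₂) * PowerSeries.coeff 1 S₁ - ((l₂ : ℂ) - l₁) * PowerSeries.coeff 1 S₂ := by
  have : ∀ S : ℂ⟦X⟧, constantCoeff (PowerSeries.derivative ℂ S) = PowerSeries.coeff 1 S := by
    intro S
    rw [← PowerSeries.coeff_zero_eq_constantCoeff_apply, PowerSeries.coeff_derivative]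
    simp
  rw [gammaValue, this, this]
  push_cast
  ring

variable {ord : LinearOrder (AddCircle (1 : ℚ))} {l₁ l₂ l₃ : ℚ}

/-- A zero would mean `l - l' = n`, an integer, so the two classes modulo `ℤ` coincide and the
hypothesis bounds `n` by `k`. -/
theorem natCast_add_ne_zero_of_principal {l l' : ℚ} {k n : ℕ} (h : (l : AddCircle (1 : ℚ)) = l' →
    l ≤ l' + k) (hn : k < n) : (n : ℂ) + ((l' : ℂ) - l) ≠ 0 := by
  intro h0
  have h1 : l = l' + n := by
    have : ((n + (l' - l) : ℚ) : ℂ) = 0 := by push_cast; exact h0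
    have := Rat.cast_eq_zero.1 this
    linarith
  have h2 : (l : AddCircle (1 : ℚ)) = l' := by
    rw [h1, AddCircle.coe_add]
    have : ((n : ℚ) : AddCircle (1 : ℚ)) = 0 := by
      rw [AddCircle.coe_eq_zero_iff]
      exact ⟨n, by simp⟩
    rw [this, add_zero]
  have h3 := h h2
  rw [h1, add_le_add_iff_left] at h3
  exact absurd (Nat.cast_le.1 h3) (by omega)

/-- `a³ E ⊆ b E` for a triangular module of rank three. -/
theorem IsTriangularBasis.exists_a_pow_smul {l₁ l₂ l₃ : ℂ} {S₁ S₂ : ℂ⟦X⟧} {e₁ e₂ e₃ : E}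
    (h : IsTriangularBasis l₁ l₂ l₃ S₁ S₂ e₁ e₂ e₃) (x : E) : ∃ y : E, a ^ 3 • x = b • y := by
  obtain ⟨c₁, c₂, c₃, -, ⟨k₁, k₂, k₃⟩, hc⟩ := h.exists_coordinates
  have h0 := fun x => k₃.coeff_zero_a_smul (Submodule.mem_top (x := x))
  have g0 := fun x => k₂.coeff_zero_a_smul (Submodule.mem_top (x := x))
  have m0 := fun x => k₁.coeff_zero_a_smul (Submodule.mem_top (x := x))
  have e : a ^ 3 • x = a • a • a • x := by
    rw [pow_succ a 2, pow_two, mul_smul, mul_smul]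
  have key : ∀ f : ℂ⟦X⟧, PowerSeries.coeff 0 f = 0 → ofB f = b * ofB (shift f) := by
    intro f hf
    nth_rewrite 1 [ofB_C_add_X_mul f]
    rw [← PowerSeries.coeff_zero_eq_constantCoeff_apply, hf, map_zero, ofB_zero, zero_add]
  obtain ⟨d₁, d₂, d₃, hd⟩ := h.span (a ^ 3 • x)
  obtain ⟨p₁, p₂, p₃⟩ := hc d₁ d₂ d₃
  rw [← hd, e] at p₁ p₂ p₃
  rw [hd, key d₁ (by rw [← p₁]; simp [h0, g0, m0]), key d₂ (by rw [← p₂]; simp [h0, g0]),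
    key d₃ (by rw [← p₃]; simp [h0]), mul_smul, mul_smul, mul_smul, ← smul_add, ← smul_add]
  exact ⟨_, rfl⟩

/-- The comparison of a triangular basis adapted to `F` with generators for `(α, β)`. -/
theorem IsTriangularBasis.gammaValue_comparison {S₁ S₂ : ℂ⟦X⟧} {e₁ e₂ e₃ : E}
    (h : IsTriangularBasis (l₁ : ℂ) l₂ l₃ S₁ S₂ e₁ e₂ e₃) {F₁ F₂ : Submodule AHat E}
    (m₁ : ∀ x, x ∈ F₁ ↔ ∃ d₁, x = ofB d₁ • e₁)
    (m₂ : ∀ x, x ∈ F₂ ↔ ∃ d₁ d₂, x = ofB d₁ • e₁ + ofB d₂ • e₂)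
    {α β z w : AHat} {τ : ℂ}
    (hα : α = a + τ • (a * a) + a * (a * (a * z)))
    (hβ : β = b + (2 * τ) • (b * a) + b * (a * (a * w)))
    {f₁ f₂ f₃ y₁ y₂ : E} {T₁ T₂ : ℂ⟦X⟧} (hf₁ : f₁ ∈ F₁) (hf₂ : f₂ ∈ F₂) (n₁ : y₁ ∈ F₁) (n₂ : y₂ ∈ F₂)
    (r₁ : (α - (l₁ : ℂ) • β) • f₁ = 0)
    (r₂ : (α - (l₂ : ℂ) • β) • f₂ = f₁ + (PowerSeries.coeff 1 T₁ • β) • f₁ + b ^ 2 • y₁)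
    (r₃ : (α - (l₃ : ℂ) • β) • f₃ = f₂ + (PowerSeries.coeff 1 T₂ • β) • f₂ + b ^ 2 • y₂)
    (hf : ∀ x : E, ∃ u : AHat, x = u • f₃) :
    gammaValue l₁ l₂ l₃ T₁ T₂ = gammaValue l₁ l₂ l₃ S₁ S₂ -
      ((l₂ : ℂ) - l₁) * ((l₃ : ℂ) - l₂) * ((l₃ : ℂ) - l₁ + 1) * τ := by
  obtain ⟨c₁, c₂, c₃, ⟨b₁, b₂, b₃⟩, ⟨k₁, k₂, k₃⟩, hc⟩ := h.exists_coordinates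
  have he : c₃ e₃ = 1 := by simpa [ofB_zero, ofB_one] using (hc 0 0 1).2.2
  rw [gammaValue_eq, gammaValue_eq]
  refine linear_invariant_comparison b₁ b₂ b₃ k₁ k₂ k₃ h.constantCoeff_left h.constantCoeff_right
    (F₁ := F₁) (F₂ := F₂) ?_ ?_ hα hβ hf₁ hf₂ n₁ n₂ r₁ r₂ r₃
    (coeff_zero_ne_zero_of_generator b₃ k₃ he hf)
  · intro x hx
    obtain ⟨d₁, d₂, rfl⟩ := (m₂ x).1 hx
    simpa [ofB_zero] using (hc d₁ d₂ 0).2.2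
  · intro x hx
    obtain ⟨d₁, rfl⟩ := (m₁ x).1 hx
    simpa [ofB_zero] using (hc d₁ 0 0).2.1

/-- One basis adapted to `F` is the reference for all comparisons. Another presentation of `E` must
be shown compatible with `F`, through principality; the basis of `θ_*(E)` is compatible by
construction, as it comes from the transported sequence. -/
theorem HasFundamentalInvariants.exists_adapted_basis
    (hE : HasFundamentalInvariants ord ![l₁, l₂, l₃] E) :
    ∃ (S₁ S₂ : ℂ⟦X⟧), IsPresentation l₁ l₂ l₃ S₁ S₂ E ∧
      (∀ T₁ T₂ : ℂ⟦X⟧, IsPresentation l₁ l₂ l₃ T₁ T₂ E →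
        gammaValue l₁ l₂ l₃ T₁ T₂ = gammaValue l₁ l₂ l₃ S₁ S₂) ∧
      ∀ θ : ChangeOfVariable, θ.IsUnimodular →
        HasFundamentalInvariants ord ![l₁, l₂, l₃] (θ.Pushforward E) ∧
        ∃ T₁ T₂, IsPresentation l₁ l₂ l₃ T₁ T₂ (θ.Pushforward E) ∧
          gammaValue l₁ l₂ l₃ T₁ T₂ = gammaValue l₁ l₂ l₃ S₁ S₂ -
            ((l₂ : ℂ) - l₁) * ((l₃ : ℂ) - l₂) * ((l₃ : ℂ) - l₁ + 1) *
              PowerSeries.coeff 2 θ.series := by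
  obtain ⟨hfr, F, hF⟩ := hE
  obtain ⟨S₁, S₂, e₁, e₂, e₃, he, m₁, m₂⟩ := hF.exists_isTriangularBasis hfr.monogenic
  refine ⟨S₁, S₂, he.isPresentation, fun T₁ T₂ hT => ?_, fun θ hθ => ?_⟩
  · obtain ⟨f₁, f₂, f₃, r₁, r₂, r₃, hf⟩ := hT.exists_generator
    obtain ⟨c₁, c₂, c₃, ⟨b₁, b₂, b₃⟩, ⟨k₁, k₂, k₃⟩, hc⟩ := he.exists_coordinates
    obtain ⟨z₁, z₂, z₃⟩ := coordinates_eq_zero b₂ b₃ k₂ k₃ hT.constantCoeff_left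
      hT.constantCoeff_right
      -- Within a class modulo `ℤ`, principality gives `λ₁ ≤ λ₂ + 1`, `λ₂ ≤ λ₃ + 1` and `λ₁ ≤ λ₃ +
      -- 2`, which matches exactly the starting orders `2`, `2` and `3`.
      (fun n hn => natCast_add_ne_zero_of_principal (k := 1) (fun h => by
        have : l₁ + ((0 : ℕ) + 1 : ℚ) ≤ l₂ + ((1 : ℕ) + 1 : ℚ) :=
          hF.principal 0 1 (by decide) h
        norm_num at this ⊢
        linarith) hn)
      (fun n hn => natCast_add_ne_zero_of_principal (k := 1) (fun h => by
        have : l₂ + ((1 : ℕ) + 1 : ℚ) ≤ l₃ + ((2 : ℕ) + 1 : ℚ) :=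
          hF.principal 1 2 (by decide) h
        norm_num at this ⊢
        linarith) hn)
      (fun n hn => natCast_add_ne_zero_of_principal (k := 2) (fun h => by
        have : l₁ + ((0 : ℕ) + 1 : ℚ) ≤ l₃ + ((2 : ℕ) + 1 : ℚ) :=
          hF.principal 0 2 (by decide) h
        norm_num at this ⊢
        linarith) hn) r₁ r₂ r₃
    have hf₂ : f₂ ∈ F 2 := by
      obtain ⟨d₁, d₂, d₃, rfl⟩ := he.span f₂
      rw [(hc d₁ d₂ d₃).2.2] at z₁
      exact (m₂ _).2 ⟨d₁, d₂, by rw [z₁, ofB_zero, zero_smul, add_zero]⟩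
    have hf₁ : f₁ ∈ F 1 := by
      obtain ⟨d₁, d₂, d₃, rfl⟩ := he.span f₁
      rw [(hc d₁ d₂ d₃).2.2] at z₂
      rw [(hc d₁ d₂ d₃).2.1] at z₃
      exact (m₁ _).2 ⟨d₁, by rw [z₂, z₃, ofB_zero, zero_smul, zero_smul, add_zero, add_zero]⟩
    -- The trivial change of variable: `α = a`, `β = b`, `τ = 0`.
    have := he.gammaValue_comparison (α := a) (β := b) (z := 0) (w := 0) (τ := 0) m₁ m₂ (by simp)
      (by simp) hf₁ hf₂ ((F 1).smul_mem (ofB (shift (shift T₁))) hf₁)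
      ((F 2).smul_mem (ofB (shift (shift T₂))) hf₂) r₁
      (r₂.trans (by
        rw [ofB_eq_expansion hT.constantCoeff_left, add_smul, add_smul, one_smul, mul_smul]))
      (r₃.trans (by
        rw [ofB_eq_expansion hT.constantCoeff_right, add_smul, add_smul, one_smul, mul_smul])) hf
    simpa using this
  · obtain ⟨hfr', hF'⟩ := θ.hasFundamentalInvariants_pushforward he.exists_a_pow_smul hfr hF
    obtain ⟨T₁, T₂, f₁, f₂, f₃, hf, n₁, n₂⟩ := hF'.exists_isTriangularBasis hfr'.monogenic
    refine ⟨⟨hfr', _, hF'⟩, T₁, T₂, hf.isPresentation, ?_⟩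
    obtain ⟨f₁, rfl⟩ := θ.push.surjective f₁
    obtain ⟨f₂, rfl⟩ := θ.push.surjective f₂
    obtain ⟨f₃, rfl⟩ := θ.push.surjective f₃
    have hf₁ : f₁ ∈ F 1 := (n₁ (θ.push f₁)).2 ⟨1, by rw [ofB_one, one_smul]⟩
    have hf₂ : f₂ ∈ F 2 := (n₂ (θ.push f₂)).2 ⟨0, 1, by rw [ofB_one, one_smul, ofB_zero, zero_smul, zero_add]⟩
    obtain ⟨z, hz⟩ := θ.exists_alpha_eq
    obtain ⟨w, hw⟩ := θ.exists_beta_eq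
    have hθ' : PowerSeries.coeff 1 θ.series = 1 := hθ
    rw [hθ', one_smul] at hz hw
    -- In `θ_*(E)` the series `T(b)` acts as `T(β)`; writing `β² = b² v` puts its terms of order at
    -- least two in the form `b² y` required by the comparison.
    obtain ⟨v, hv⟩ := exists_eq_b_pow_mul (van_pow θ.beta_mem 2)
    have hT : ∀ T : ℂ⟦X⟧, constantCoeff T = 1 → ∀ x : E, θ.Theta (ofB T) • x =
        x + (PowerSeries.coeff 1 T • θ.beta) • x +
          b ^ 2 • v • θ.Theta (ofB (shift (shift T))) • x := by
      intro T hT x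
      rw [ofB_eq_expansion hT, map_add, map_add, map_one, map_mul, map_pow, θ.Theta_smul, θ.Theta_b,
        hv, add_smul, add_smul, one_smul, mul_smul, mul_smul]
    have hl : ∀ (l : ℂ) (x : E), (a - l • b) • θ.push x = θ.push ((θ.alpha - l • θ.beta) • x) := by
      intro l x
      rw [θ.smul_push, map_sub, θ.Theta_smul, θ.Theta_a, θ.Theta_b]
    have r₁ := hf.smul₁
    have r₂ := hf.smul₂
    have r₃ := hf.smul₃
    rw [hl, map_eq_zero_iff _ θ.push.injective] at r₁
    rw [hl, θ.smul_push, θ.push.injective.eq_iff, hT T₁ hf.constantCoeff_left] at r₂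
    rw [hl, θ.smul_push, θ.push.injective.eq_iff, hT T₂ hf.constantCoeff_right] at r₃
    refine he.gammaValue_comparison m₁ m₂ hz hw hf₁ hf₂
      ((F 1).smul_mem _ ((F 1).smul_mem _ hf₁)) ((F 2).smul_mem _ ((F 2).smul_mem _ hf₂)) r₁ r₂ r₃
      fun x => ?_
    obtain ⟨u, hu⟩ := hf.exists_smul_eq (θ.push x)
    exact ⟨θ.Theta u, θ.push.injective hu⟩

theorem gammaParam_eq (hE : HasFundamentalInvariants ord ![l₁, l₂, l₃] E) {S₁ S₂ : ℂ⟦X⟧}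
    (h : IsPresentation l₁ l₂ l₃ S₁ S₂ E) :
    gammaParam l₁ l₂ l₃ E = gammaValue l₁ l₂ l₃ S₁ S₂ := by
  obtain ⟨T₁, T₂, -, hT, -⟩ := hE.exists_adapted_basis
  have hex : ∃ S : ℂ⟦X⟧ × ℂ⟦X⟧, IsPresentation l₁ l₂ l₃ S.1 S.2 E := ⟨(S₁, S₂), h⟩
  rw [gammaParam, dif_pos hex, hT _ _ hex.choose_spec, hT _ _ h]

theorem IsPresentation.of_equiv {E' : Type v} [AddCommGroup E'] [Module AHat E'] {S₁ S₂ : ℂ⟦X⟧}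
    (h : IsPresentation l₁ l₂ l₃ S₁ S₂ E) (f : E ≃ₗ[ATilde] E') :
    IsPresentation l₁ l₂ l₃ S₁ S₂ E' :=
  ⟨h.constantCoeff_left, h.constantCoeff_right, h.iso.map f.symm.trans⟩

end Invariant

theorem mainTheorem4 (ord : LinearOrder (AddCircle (1 : ℚ))) (l₁ l₂ l₃ p₁ p₂ : ℚ)
    (hp₁ : l₂ = l₁ + p₁ - 1) (hp₂ : l₃ = l₂ + p₂ - 1)
    (E : Type u) [AddCommGroup E] [Module AHat E]
    (hE : HasFundamentalInvariants ord ![l₁, l₂, l₃] E) :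
    (∃ S₁ S₂ : ℂ⟦X⟧, IsPresentation l₁ l₂ l₃ S₁ S₂ E) ∧
    (∀ S₁ S₂ : ℂ⟦X⟧, IsPresentation l₁ l₂ l₃ S₁ S₂ E →
      gammaParam l₁ l₂ l₃ E =
        ((p₂ : ℂ) - 1) * PowerSeries.constantCoeff (PowerSeries.derivative ℂ S₁) -
        ((p₁ : ℂ) - 1) * PowerSeries.constantCoeff (PowerSeries.derivative ℂ S₂)) ∧
    (∀ (E' : Type v) [AddCommGroup E'] [Module AHat E'], Nonempty (E ≃ₗ[ATilde] E') →
      gammaParam l₁ l₂ l₃ E' = gammaParam l₁ l₂ l₃ E) ∧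
    (∀ θ : ChangeOfVariable, θ.IsUnimodular →
      HasFundamentalInvariants ord ![l₁, l₂, l₃] (θ.Pushforward E) ∧
      gammaParam l₁ l₂ l₃ (θ.Pushforward E) = gammaParam l₁ l₂ l₃ E -
        ((p₁ : ℂ) - 1) * ((p₂ : ℂ) - 1) * ((p₁ : ℂ) + (p₂ : ℂ) - 1) *
          PowerSeries.coeff 2 θ.series) := by
  obtain ⟨S₁, S₂, hS, hu, hθ⟩ := hE.exists_adapted_basis
  have q₁ : (p₁ : ℂ) = l₂ - l₁ + 1 := by rw [hp₁]; push_cast; ring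
  have q₂ : (p₂ : ℂ) = l₃ - l₂ + 1 := by rw [hp₂]; push_cast; ring
  refine ⟨⟨S₁, S₂, hS⟩, fun T₁ T₂ hT => ?_, fun E' _ _ ⟨f⟩ => ?_, fun θ h => ?_⟩
  · rw [gammaParam_eq hE hT, gammaValue, q₁, q₂]
    push_cast
    ring
  -- `E'` carries no filtration of its own: the presentation chosen for it is carried back to `E`,
  -- where uniqueness holds. An `Ã`-linear isomorphism suffices.
  · have hex : ∃ S : ℂ⟦X⟧ × ℂ⟦X⟧, IsPresentation l₁ l₂ l₃ S.1 S.2 E' :=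
      ⟨(S₁, S₂), hS.of_equiv f⟩
    rw [gammaParam, dif_pos hex, gammaParam_eq hE (hex.choose_spec.of_equiv f.symm)]
  · obtain ⟨hE', T₁, T₂, hT, e⟩ := hθ θ h
    refine ⟨hE', ?_⟩
    rw [gammaParam_eq hE' hT, gammaParam_eq hE hS, e, q₁, q₂]
    ring
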